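/- Let $n\ge 2$ be an integer, $p>-n$ and $\hbar>0$ real. For $z,w\in\mathbb C^n$ put $z\cdot w=\sum_j z_j\overline{w_j}$ and $|z|=\sqrt{z\cdot z}$; for a multi-index $k\in\mathbb Z_{\ge0}^n$ put $|k|=\sum_j k_j$, $k!=\prod_j k_j!$, $z^k=\prod_j z_j^{k_j}$; for $b>0$ put $(b)_\ell=\Gamma(b+\ell)/\Gamma(b)$. Let $\mathbf S^n=\{x\in\mathbb C^n: |x|=1\}$ with its normalized surface measure $d\mathbf S_n$ and $\langle\phi,\psi\rangle=\int_{\mathbf S^n}\phi\,\overline{\psi}\,d\mathbf S_n$, and let $\mathcal O\subset L^2(\mathbf S^n)$ be the subspace of all $\Psi$ whose Poisson extension $$z\mapsto\int_{\mathbf S^n}\frac{1-|z|^2}{|z-x|^{2n}}\Psi(x)\,d\mathbf S_n(x)$$ is holomorphic in the open unit ball. Let $$dm^{\hbar}_{n,p}(z)=\frac{1}{\Gamma(n+p)}\,\frac{2}{(\pi\hbar^2)^n}\left(\frac{|z|}{\hbar}\right)^{p}K_p\!\left(\frac{2|z|}{\hbar}\right)dz\,d\bar z$$ on $\mathbb C^n$,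 where $dz\,d\bar z$ is Lebesgue measure and $K_p(x)=\int_0^\infty e^{-x\cosh t}\cosh(pt)\,dt$ is the MacDonald--Bessel function; put $(f,g)_p=\int_{\mathbb C^n} f\,\overline g\,dm^\hbar_{n,p}$ and $\|f\|_p=\sqrt{(f,f)_p}$, and let $\mathcal E_{n,p}$ be the space of entire functions $f$ on $\mathbb C^n$ with $\|f\|_p<\infty$. For $k\in\mathbb Z_{\ge0}^n$ let $$\phi_k(x)=\sqrt{\frac{(n)_{|k|}}{k!}}\;x^k\quad(x\in\mathbf S^n),\qquad \Phi^\hbar_{k,p}(z)=\frac1{\hbar^{|k|}}\sqrt{\frac{1}{(n+p)_{|k|}\,k!}}\;z^k\quad(z\in\mathbb C^n).$$ Define $\mathbf U_{n,p}$ on $\mathcal O$ as follows: if $\Psi=\sum_{\ell\ge0}\Psi_\ell$ in $L^2(\mathbf S^n)$ with $\Psi_\ell=\sum_{|k|=\ell}a_k\phi_k$ (the restriction to $\mathbf S^n$ of a homogeneous polynomial of degree $\ell$), then $\mathbf U_{n,p}\Psi\in\mathcal E_{n,p}$ is the limit of $\sum_{\ell=0}^{K}\sum_{|k|=\ell}a_k\Phi^\hbar_{k,p}$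 in the norm $\|\cdot\|_p$ as $K\to\infty$. Theorem. The operator $\mathbf U_{n,p}$ is well defined on $\mathcal O$ (for each $\Psi\in\mathcal O$ such a decomposition and limit exist, and the limit is unique), every $\phi_k$ lies in $\mathcal O$ and $\mathbf U_{n,p}\phi_k=\Phi^\hbar_{k,p}$, and $\mathbf U_{n,p}$ is a linear isometry of $\mathcal O$ onto $\mathcal E_{n,p}$: it is a linear bijection with $\|\mathbf U_{n,p}\Psi\|_p=\|\Psi\|_{L^2(\mathbf S^n)}$ and $(\mathbf U_{n,p}\Psi,\mathbf U_{n,p}\Phi)_p=\langle\Psi,\Phi\rangle$ for all $\Psi,\Phi\in\mathcal O$. Moreover, for all $\Psi\in\mathcal O$ and $z\in\mathbb C^n$, $$\mathbf U_{n,p}\Psi(z)=\int_{\mathbf S^n}\Psi(x)\sum_{\ell=0}^\infty\frac{c_{\ell,p}}{\ell!}\left(\frac{z\cdot x}{\hbar}\right)^{\ell}d\mathbf S_n(x),\qquad c_{\ell,p}=\sqrt{\frac{(n)_\ell}{(n+p)_\ell}},$$ where the series converges absolutely for all $z\in\mathbb C^n$, $x\in\mathbf S^n$ and the integrand is integrable.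 -/

import Mathlib

open MeasureTheory Filter Topology
open scoped ENNReal ComplexConjugate

noncomputable section

namespace SphereTransform

/-- `ℂⁿ` with its Euclidean norm `|z| = √(z · z)`. -/
abbrev CSpace (n : ℕ) : Type := EuclideanSpace ℂ (Fin n)

/-- The unit sphere `{x ∈ ℂⁿ : |x₁|² + ⋯ + |xₙ|² = 1}`. -/
abbrev CSphere (n : ℕ) : Type := Metric.sphere (0 : CSpace n) 1

/-- The Hermitian product `z · w = ∑ zⱼ conj(wⱼ)`. -/
def cdot {n : ℕ} (z w : CSpace n) : ℂ := ∑ j, z j * conj (w j)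

/-- The length `|k|` of a multi-index. -/
def len {n : ℕ} (k : Fin n → ℕ) : ℕ := ∑ j, k j

/-- The factorial `k!` of a multi-index. -/
def mfact {n : ℕ} (k : Fin n → ℕ) : ℕ := ∏ j, (k j).factorial

/-- The monomial `zᵏ`. -/
def monom {n : ℕ} (k : Fin n → ℕ) (z : CSpace n) : ℂ := ∏ j, z j ^ k j

/-- The Pochhammer symbol `(b)_ℓ = Γ(b + ℓ) / Γ(b)`, used for `b > 0`. -/
def poch (b : ℝ) (l : ℕ) : ℝ := Real.Gamma (b + l) / Real.Gamma b

/-- The normalized surface measure on the unit sphere of `ℂⁿ`. -/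
def sphereMeasure (n : ℕ) : Measure (CSphere n) :=
  ((volume : Measure (CSpace n)).toSphere Set.univ)⁻¹ • (volume : Measure (CSpace n)).toSphere

instance (n : ℕ) : IsFiniteMeasure (sphereMeasure n) := by
  refine ⟨?_⟩
  rw [sphereMeasure, Measure.smul_apply, smul_eq_mul]
  exact lt_of_le_of_lt (ENNReal.inv_mul_le_one _) ENNReal.one_lt_top

/-- The Poisson kernel of the unit ball of `ℂⁿ = ℝ²ⁿ`, relative to the normalized surface
measure. -/
def poissonKernel {n : ℕ} (z : CSpace n) (x : CSphere n) : ℝ :=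
  (1 - ‖z‖ ^ 2) / ‖z - (x : CSpace n)‖ ^ (2 * n)

/-- The Poisson extension to the open unit ball of a function on the unit sphere. -/
def poissonExt {n : ℕ} (Ψ : CSphere n → ℂ) (z : CSpace n) : ℂ :=
  ∫ x, (poissonKernel z x : ℂ) * Ψ x ∂(sphereMeasure n)

lemma continuous_poissonKernel {n : ℕ} {z : CSpace n} (hz : z ∈ Metric.ball (0 : CSpace n) 1) :
    Continuous (fun x : CSphere n => (poissonKernel z x : ℂ)) := by
  refine Complex.continuous_ofReal.comp ?_
  refine continuous_const.div (by fun_prop) fun x => pow_ne_zero _ ?_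
  rw [norm_ne_zero_iff, sub_ne_zero]
  rintro rfl
  have h1 := x.2
  rw [mem_sphere_zero_iff_norm] at h1
  rw [mem_ball_zero_iff] at hz
  linarith

lemma integrable_poisson {n : ℕ} (Ψ : Lp ℂ 2 (sphereMeasure n)) {z : CSpace n}
    (hz : z ∈ Metric.ball (0 : CSpace n) 1) :
    Integrable (fun x => (poissonKernel z x : ℂ) * Ψ x) (sphereMeasure n) := by
  have hc := continuous_poissonKernel hz
  obtain ⟨C, hC⟩ := isCompact_univ.exists_bound_of_continuousOn hc.continuousOn
  exact ((Lp.memLp Ψ).integrable (by norm_num)).bdd_mul hc.aestronglyMeasurable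
    (Eventually.of_forall fun x => hC x (Set.mem_univ x))

/-- The space `𝒪` of all functions in `L²` of the sphere whose Poisson extension into the
interior is holomorphic. -/
def hardyO (n : ℕ) : Submodule ℂ (Lp ℂ 2 (sphereMeasure n)) where
  carrier := {Ψ | DifferentiableOn ℂ (poissonExt (Ψ : CSphere n → ℂ)) (Metric.ball 0 1)}
  zero_mem' := by
    refine (differentiableOn_const (0 : ℂ)).congr fun z _ => ?_
    refine integral_eq_zero_of_ae ?_
    filter_upwards [Lp.coeFn_zero ℂ 2 (sphereMeasure n)] with x hx
    rw [hx, Pi.zero_apply, mul_zero]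
  add_mem' := by
    intro Ψ Φ h1 h2
    refine (DifferentiableOn.add h1 h2).congr fun z hz => ?_
    simp only [poissonExt, Pi.add_apply]
    rw [← integral_add (integrable_poisson Ψ hz) (integrable_poisson Φ hz)]
    refine integral_congr_ae ?_
    filter_upwards [Lp.coeFn_add Ψ Φ] with x hx
    rw [hx, Pi.add_apply, mul_add]
  smul_mem' := by
    intro c Ψ h1
    refine (DifferentiableOn.const_smul h1 c).congr fun z _ => ?_
    simp only [poissonExt, Pi.smul_apply]
    rw [← integral_smul]
    refine integral_congr_ae ?_
    filter_upwards [Lp.coeFn_smul c Ψ] with x hx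
    rw [hx, Pi.smul_apply, smul_eq_mul, smul_eq_mul]
    ring

/-- The MacDonald–Bessel function `K_p(x) = ∫₀^∞ exp(-x cosh t) cosh(p t) dt`, for `x > 0`. -/
def besselK (p x : ℝ) : ℝ :=
  ∫ t in Set.Ioi (0 : ℝ), Real.exp (-x * Real.cosh t) * Real.cosh (p * t)

/-- The density of the measure `m_{n,p}^ħ` with respect to Lebesgue measure on `ℂⁿ`. -/
def densityM (n : ℕ) (p ħ : ℝ) (z : CSpace n) : ℝ :=
  1 / Real.Gamma (n + p) * (2 / (Real.pi * ħ ^ 2) ^ n) * (‖z‖ / ħ) ^ p *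
    besselK p (2 * (‖z‖ / ħ))

/-- The measure `m_{n,p}^ħ` on `ℂⁿ`. -/
def measureM (n : ℕ) (p ħ : ℝ) : Measure (CSpace n) :=
  (volume : Measure (CSpace n)).withDensity fun z => ENNReal.ofReal (densityM n p ħ z)

/-- The inner product `(f, g)_p = ∫ f conj(g) dm_{n,p}^ħ`. -/
def innerP (n : ℕ) (p ħ : ℝ) (f g : CSpace n → ℂ) : ℂ :=
  ∫ z, f z * conj (g z) ∂(measureM n p ħ)

/-- The norm `‖f‖_p = √(f, f)_p`. -/
def normP (n : ℕ) (p ħ : ℝ) (f : CSpace n → ℂ) : ℝ := Real.sqrt (innerP n p ħ f f).re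

/-- The space `ℰ_{n,p}` of entire functions on `ℂⁿ` that are square integrable with respect to
`m_{n,p}^ħ`. -/
def entireE (n : ℕ) (p ħ : ℝ) : Submodule ℂ (CSpace n → ℂ) where
  carrier := {f | Differentiable ℂ f ∧ MemLp f 2 (measureM n p ħ)}
  zero_mem' := ⟨differentiable_const 0, MemLp.zero⟩
  add_mem' := fun h1 h2 => ⟨h1.1.add h2.1, h1.2.add h2.2⟩
  smul_mem' := fun c _ h => ⟨h.1.const_smul c, h.2.const_smul c⟩

/-- The functions `φ_k(x) = √((n)_{|k|} / k!) xᵏ` on the sphere. -/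
def phi {n : ℕ} (k : Fin n → ℕ) (x : CSphere n) : ℂ :=
  (Real.sqrt (poch n (len k) / mfact k) : ℂ) * monom k (x : CSpace n)

/-- The functions `Φ_{k,p}^ħ(z) = ħ^{-|k|} √(1 / ((n+p)_{|k|} k!)) zᵏ` on `ℂⁿ`. -/
def bigPhi {n : ℕ} (p ħ : ℝ) (k : Fin n → ℕ) (z : CSpace n) : ℂ :=
  ((1 / ħ ^ len k * Real.sqrt (1 / (poch (n + p) (len k) * mfact k)) : ℝ) : ℂ) * monom k z

/-- `f` is the image of `Ψ` under the linear and limit extension of `φ_k ↦ Φ_{k,p}^ħ`: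
one has `Ψ = ∑_ℓ Ψ_ℓ` in `L²` of the sphere with `Ψ_ℓ = ∑_{|k| = ℓ} a_k φ_k` a homogeneous
polynomial of degree `ℓ`, and `f ∈ ℰ_{n,p}` is the limit in the norm `‖·‖_p` of the partial sums
of `∑_ℓ U^ℓ Ψ_ℓ`, where `U^ℓ Ψ_ℓ = ∑_{|k| = ℓ} a_k Φ_{k,p}^ħ`. -/
def IsTransform (n : ℕ) (p ħ : ℝ) (Ψ : CSphere n → ℂ) (f : CSpace n → ℂ) : Prop :=
  f ∈ entireE n p ħ ∧ ∃ a : (Fin n → ℕ) → ℂ,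
    Tendsto (fun K : ℕ => eLpNorm (fun x => Ψ x - ∑ l ∈ Finset.range (K + 1),
      ∑ k ∈ Finset.univ.piAntidiag l, a k * phi k x) 2 (sphereMeasure n)) atTop (𝓝 0) ∧
    Tendsto (fun K : ℕ => eLpNorm (fun z => f z - ∑ l ∈ Finset.range (K + 1),
      ∑ k ∈ Finset.univ.piAntidiag l, a k * bigPhi p ħ k z) 2 (measureM n p ħ)) atTop (𝓝 0)

open Classical in
/-- The operator `U_{n,p}` on `𝒪`. That the limit that defines it exists and is unique is part of
what is claimed about it. -/
def transformU (n : ℕ) (p ħ : ℝ) (Ψ : hardyO n) : CSpace n → ℂ :=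
  if h : ∃ f, IsTransform n p ħ (Ψ : Lp ℂ 2 (sphereMeasure n)) f then h.choose else 0

/-- The coefficients `c_{ℓ,p} = √((n)_ℓ / (n+p)_ℓ)`. -/
def coeffC (n : ℕ) (p : ℝ) (l : ℕ) : ℝ := Real.sqrt (poch n l / poch (n + p) l)

/-- The `ℓ`-th term `(c_{ℓ,p} / ℓ!) ((z · x) / ħ)^ℓ` of the kernel of `U_{n,p}`. -/
def kernelTerm {n : ℕ} (p ħ : ℝ) (z x : CSpace n) (l : ℕ) : ℂ :=
  ((coeffC n p l / l.factorial : ℝ) : ℂ) * (cdot z x / (ħ : ℂ)) ^ l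

end SphereTransform

end

/-!
The transform maps the orthonormal system `φ_k` of `𝒪` to the orthonormal system `Φ_k` of
`ℰ_{n,p}`, so the theorem amounts to orthonormality and completeness on both sides, and to the
identification of the resulting isometry with an integral operator.

**Orthonormality.** The moments of the sphere come from those of the Gaussian in polar
coordinates (`integral_sphere_monom`). The substitution `a = s eᵗ` turns the Bessel function into
`s ^ p K_p(2 s) = ½ ∫₀^∞ a ^ (p - 1) exp (-a - s² / a) da`, so the measure `m` is a mixture of
Gaussians, and its moments are Gamma integrals (`integral_monom_measureM`).

**Sums of the `φ_k` belong to `𝒪`.** The Poisson extension of `x ^ k` is `z ^ k`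
(`poissonExt_monom`): the Poisson kernel is expanded in powers of `2 Re (z · x)`, the integrals
against `x ^ k` are explicit, and the resulting series is the generating function of the binomial
coefficients `C(N + 2 j, j)`. Consequently, on the closed span of the `φ_k` the Poisson kernel may
be replaced by the Szegő kernel, a power series in `z · x`, and integrating against the latter
yields holomorphic functions (`mem_hardyO_of_hasSum`).

**Completeness in `𝒪`.** Let `D ∈ 𝒪` be orthogonal to all `φ_k`. By the symmetry of the Poisson
kernel the holomorphic function `P[D]` is orthogonal to all `z ^ k` on every sphere of radius
`r < 1`, hence its Taylor coefficients vanish (`exists_coeff`) and `P[D] = 0`. On a ray, the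
Poisson integral is a power series in `2 s / (1 + s²)` whose coefficients are nonzero
multiples of `∫ D(x) Re (z · x) ^ m`, so that all of these vanish. Then `D` annihilates all
characters `exp (2 i Re (z · x))`, which are total by the Stone–Weierstrass theorem
(`eq_zero_of_mem_hardyO`).

**Completeness in `ℰ_{n,p}`.** The measure `m` is rotation invariant, so by Fubini in polar
coordinates the `k`-th moment of an entire function is its `k`-th Taylor coefficient times a
positive constant (`eq_zero_of_integral_mul_conj_monom`).

**The integral formula.** The kernel `∑_l (c_l / l!) ((z · x) / ħ) ^ l` maps `φ_k` to `Φ_k`, and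
hence `∑ a_k φ_k` to the pointwise sum `∑ a_k Φ_k(z)` (`hasSum_kernelTransform`), which agrees with
the sum in `L²(m)` almost everywhere. Both candidates for the transform being continuous, and the
density of `m` being positive, they are equal (`isTransform_iff`).
-/

namespace SphereTransform

/-! ### Gaussian moments on `ℂⁿ` -/

lemma finrank_real_cspace (n : ℕ) : Module.finrank ℝ (CSpace n) = 2 * n := by
  have h := Module.finrank_mul_finrank ℝ ℂ (CSpace n)
  rw [Complex.finrank_real_complex, finrank_euclideanSpace_fin] at h
  exact h.symm

lemma norm_sq_cspace {n : ℕ} (z : CSpace n) : ‖z‖ ^ 2 = ∑ j, ‖z j‖ ^ 2 :=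
  EuclideanSpace.norm_sq_eq z

lemma integral_complex_gaussian {b : ℝ} (hb : 0 < b) :
    ∫ w : ℂ, Real.exp (-b * ‖w‖ ^ 2) = Real.pi / b := by
  have h := GaussianFourier.integral_rexp_neg_mul_sq_norm (V := ℂ) hb
  simpa using h

/-- The identification of `CSpace n` with `ℂⁿ` as a product carries Lebesgue measure to the
product measure. Both are Haar measures, and the constant is found from the Gaussian integral. -/
lemma measurePreserving_ofLp_complex (n : ℕ) :
    MeasurePreserving (WithLp.ofLp : CSpace n → (Fin n → ℂ)) := by
  let L : CSpace n ≃L[ℝ] (Fin n → ℂ) :=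
    (PiLp.continuousLinearEquiv 2 ℝ (fun _ : Fin n => ℂ))
  have hL : ∀ z, L z = WithLp.ofLp z := fun z => rfl
  have hmeas : Measurable (WithLp.ofLp : CSpace n → (Fin n → ℂ)) := L.continuous.measurable
  have : ((volume : Measure (CSpace n)).map L).IsAddHaarMeasure :=
    L.isAddHaarMeasure_map volume
  have h1 := Measure.isAddLeftInvariant_eq_smul ((volume : Measure (CSpace n)).map L)
    (volume : Measure (Fin n → ℂ))
  set c := ((volume : Measure (CSpace n)).map L).addHaarScalarFactor
    (volume : Measure (Fin n → ℂ)) with hc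
  have h2 : ∫ w, (∏ j, Real.exp (-1 * ‖w j‖ ^ 2)) ∂((volume : Measure (CSpace n)).map L)
      = Real.pi ^ n := by
    have := L.toHomeomorph.measurableEmbedding.integral_map (μ := (volume : Measure (CSpace n)))
      (fun w : Fin n → ℂ => ∏ j, Real.exp (-1 * ‖w j‖ ^ 2))
    refine (this.trans ?_)
    have h3 := GaussianFourier.integral_rexp_neg_mul_sq_norm (V := CSpace n) one_pos
    rw [finrank_real_cspace] at h3
    have h4 : (((2 * n : ℕ) : ℝ) / 2) = (n : ℝ) := by push_cast; ring
    rw [h4, div_one, Real.rpow_natCast] at h3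
    rw [← h3]
    refine integral_congr_ae (Eventually.of_forall fun z => ?_)
    simp only
    rw [← Real.exp_sum, norm_sq_cspace, Finset.mul_sum]
    rfl
  have h5 : ∫ w : Fin n → ℂ, (∏ j, Real.exp (-1 * ‖w j‖ ^ 2)) = Real.pi ^ n := by
    rw [integral_fintype_prod_volume_eq_prod (f := fun (_ : Fin n) (w : ℂ) =>
      Real.exp (-1 * ‖w‖ ^ 2)), integral_complex_gaussian one_pos]
    simp
  rw [h1, integral_smul_nnreal_measure, h5] at h2
  have h6 : (c : ℝ) = 1 := by
    have : Real.pi ^ n ≠ 0 := pow_ne_zero _ Real.pi_ne_zero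
    rw [NNReal.smul_def, smul_eq_mul] at h2
    exact (mul_eq_right₀ this).1 h2
  refine ⟨hmeas, ?_⟩
  have h7 : c = 1 := by exact_mod_cast h6
  rw [h7, one_smul] at h1
  exact h1

lemma integral_cspace_eq_pi {n : ℕ} (f : (Fin n → ℂ) → ℂ) :
    ∫ z : CSpace n, f (fun j => z j) = ∫ w : Fin n → ℂ, f w :=
  (measurePreserving_ofLp_complex n).integral_comp
    (PiLp.continuousLinearEquiv 2 ℝ (fun _ : Fin n => ℂ)).toHomeomorph.measurableEmbedding f

/-- The moments of a Gaussian on `ℂ`. Off the diagonal they vanish by rotation invariance. -/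
lemma integral_complex_gaussian_moment (a b : ℕ) {c : ℝ} (hc : 0 < c) :
    ∫ w : ℂ, w ^ a * conj w ^ b * (Real.exp (-c * ‖w‖ ^ 2) : ℂ) =
      if a = b then ((Real.pi * a.factorial / c ^ (a + 1) : ℝ) : ℂ) else 0 := by
  split_ifs with hab
  · subst hab
    have h := Complex.integral_rpow_mul_exp_neg_mul_rpow (p := 2) (q := 2 * a) (b := c)
      (by norm_num) (by have : (0 : ℝ) ≤ a := a.cast_nonneg
                        linarith) hc
    have h2 : ∫ w : ℂ, w ^ a * conj w ^ a * (Real.exp (-c * ‖w‖ ^ 2) : ℂ) =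
        ((∫ w : ℂ, ‖w‖ ^ (2 * (a : ℝ)) * Real.exp (-c * ‖w‖ ^ (2 : ℝ)) : ℝ) : ℂ) := by
      rw [← integral_complex_ofReal]
      refine integral_congr_ae (Eventually.of_forall fun w => ?_)
      simp only
      have h3 : ‖w‖ ^ (2 * (a : ℝ)) = ‖w‖ ^ (2 * a) := by
        rw [← Real.rpow_natCast]; push_cast; rfl
      rw [h3, Real.rpow_two, ← mul_pow, Complex.mul_conj, Complex.normSq_eq_norm_sq, pow_mul]
      push_cast
      ring
    rw [h2, h]
    congr 1
    have h4 : (-(2 * (a : ℝ) + 2) / 2) = -((a + 1 : ℕ) : ℝ) := by push_cast; ring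
    have h5 : (2 * (a : ℝ) + 2) / 2 = a + 1 := by ring
    rw [h4, h5, Real.Gamma_nat_eq_factorial, Real.rpow_neg hc.le, Real.rpow_natCast]
    field_simp
  · -- a rotation by an angle `1` multiplies the integral by `exp (i (a - b)) ≠ 1`
    set ζ : Circle := Circle.exp 1
    have hrot := (rotation ζ).measurePreserving.integral_comp
      (rotation ζ).toHomeomorph.measurableEmbedding
      (fun w : ℂ => w ^ a * conj w ^ b * (Real.exp (-c * ‖w‖ ^ 2) : ℂ))
    set I := ∫ w : ℂ, w ^ a * conj w ^ b * (Real.exp (-c * ‖w‖ ^ 2) : ℂ) with hI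
    have h1 : ((ζ : ℂ) ^ a * conj (ζ : ℂ) ^ b) * I = I := by
      refine Eq.trans ?_ hrot
      rw [hI, ← integral_const_mul]
      refine integral_congr_ae (Eventually.of_forall fun w => ?_)
      simp only [rotation_apply, norm_mul, Circle.norm_coe, one_mul, map_mul, mul_pow]
      ring
    by_contra hne
    have h2 : (ζ : ℂ) ^ a * conj (ζ : ℂ) ^ b = 1 := mul_right_cancel₀ hne (by rw [h1, one_mul])
    have h3 : (ζ : ℂ) = Complex.exp Complex.I := by simp [ζ]
    rw [h3, ← Complex.exp_conj, Complex.conj_I, ← Complex.exp_nat_mul, ← Complex.exp_nat_mul,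
      ← Complex.exp_add, Complex.exp_eq_one_iff] at h2
    obtain ⟨N, hN⟩ := h2
    have h4 : ((a : ℂ) - b) = N * (2 * Real.pi) := by
      have := congrArg (fun t => t * (-Complex.I)) hN
      ring_nf at this
      rw [Complex.I_sq] at this
      linear_combination this
    have h5 : ((a : ℝ) - b) = N * (2 * Real.pi) := by exact_mod_cast h4
    have hN0 : N ≠ 0 := by
      rintro rfl
      apply hab
      have : (a : ℝ) = b := by linarith [h5, (by simp : ((0 : ℤ) : ℝ) * (2 * Real.pi) = 0)]
      exact_mod_cast this
    apply irrational_pi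
    refine ⟨((a : ℚ) - b) / (2 * N), ?_⟩
    have : (N : ℝ) ≠ 0 := by exact_mod_cast hN0
    push_cast
    field_simp
    linarith

/-- The moments of a Gaussian on `ℂⁿ`. -/
lemma integral_cspace_gaussian_moment {n : ℕ} (α β : Fin n → ℕ) {c : ℝ} (hc : 0 < c) :
    ∫ z : CSpace n, monom α z * conj (monom β z) * (Real.exp (-c * ‖z‖ ^ 2) : ℂ) =
      if α = β then (((Real.pi / c) ^ n * mfact α / c ^ len α : ℝ) : ℂ) else 0 := by
  have h1 : ∀ z : CSpace n, monom α z * conj (monom β z) * (Real.exp (-c * ‖z‖ ^ 2) : ℂ) =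
      ∏ j, ((z j) ^ α j * conj (z j) ^ β j * (Real.exp (-c * ‖z j‖ ^ 2) : ℂ)) := by
    intro z
    rw [Finset.prod_mul_distrib, Finset.prod_mul_distrib, norm_sq_cspace, Finset.mul_sum,
      Real.exp_sum]
    simp only [monom, map_prod, map_pow, Complex.ofReal_prod]
  simp_rw [h1]
  rw [integral_cspace_eq_pi (fun w => ∏ j, ((w j) ^ α j * conj (w j) ^ β j *
    (Real.exp (-c * ‖w j‖ ^ 2) : ℂ))), integral_fintype_prod_volume_eq_prod
    (f := fun (j : Fin n) (w : ℂ) => w ^ α j * conj w ^ β j * (Real.exp (-c * ‖w‖ ^ 2) : ℂ))]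
  simp_rw [integral_complex_gaussian_moment _ _ hc]
  split_ifs with h
  · subst h
    simp only [if_true]
    rw [← Complex.ofReal_prod]
    congr 1
    rw [Finset.prod_div_distrib, Finset.prod_mul_distrib, Finset.prod_pow_eq_pow_sum,
      Finset.sum_add_distrib]
    simp only [Finset.prod_const, Finset.card_univ, Fintype.card_fin, Finset.sum_const,
      smul_eq_mul, mul_one, mfact, len, Nat.cast_prod]
    rw [pow_add, div_pow]
    field_simp
  · obtain ⟨j, hj⟩ := Function.ne_iff.1 h
    exact Finset.prod_eq_zero (Finset.mem_univ j) (by rw [if_neg hj])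

/-! ### Polar coordinates and the moments of the sphere -/

lemma monom_smul {n : ℕ} (k : Fin n → ℕ) (c : ℂ) (z : CSpace n) :
    monom k (c • z) = c ^ len k * monom k z := by
  simp only [monom, len, PiLp.smul_apply, smul_eq_mul, mul_pow, Finset.prod_mul_distrib,
    Finset.prod_pow_eq_pow_sum]

lemma monom_real_smul {n : ℕ} (k : Fin n → ℕ) (r : ℝ) (z : CSpace n) :
    monom k (r • z) = (r : ℂ) ^ len k * monom k z := by
  rw [← monom_smul]
  congr 1

lemma continuous_monom {n : ℕ} (k : Fin n → ℕ) : Continuous (monom k) := by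
  unfold monom
  fun_prop

lemma norm_sphere {n : ℕ} (x : CSphere n) : ‖(x : CSpace n)‖ = 1 :=
  mem_sphere_zero_iff_norm.1 x.2

/-- Polar coordinates preserve measure. -/
lemma measurePreserving_polar {n : ℕ} (hn : 0 < n) :
    MeasurePreserving (fun y : CSphere n × Set.Ioi (0 : ℝ) => (y.2 : ℝ) • (y.1 : CSpace n))
      ((volume : Measure (CSpace n)).toSphere.prod (.volumeIoiPow (2 * n - 1))) volume := by
  have : Nonempty (Fin n) := ⟨⟨0, hn⟩⟩
  have h2 := (volume : Measure (CSpace n)).measurePreserving_homeomorphUnitSphereProd.symm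
    (homeomorphUnitSphereProd _).toMeasurableEquiv
  have h3 := (measurePreserving_subtype_coe (μa := (volume : Measure (CSpace n)))
    (measurableSet_singleton (0 : CSpace n)).compl)
  rw [restrict_compl_singleton] at h3
  rw [finrank_real_cspace] at h2
  exact h3.comp h2

lemma measurableEmbedding_polar {n : ℕ} :
    MeasurableEmbedding
      (fun y : CSphere n × Set.Ioi (0 : ℝ) => (y.2 : ℝ) • (y.1 : CSpace n)) :=
  (MeasurableEmbedding.subtype_coe (measurableSet_singleton (0 : CSpace n)).compl).comp
    (homeomorphUnitSphereProd (CSpace n)).symm.measurableEmbedding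

/-- Integration in polar coordinates, over the product of the sphere and the half-line. -/
lemma integral_cspace_polar {n : ℕ} (hn : 0 < n) (F : CSpace n → ℂ) :
    ∫ z, F z = ∫ y : CSphere n × Set.Ioi (0 : ℝ), F ((y.2 : ℝ) • (y.1 : CSpace n))
      ∂((volume : Measure (CSpace n)).toSphere.prod (.volumeIoiPow (2 * n - 1))) :=
  ((measurePreserving_polar hn).integral_comp measurableEmbedding_polar F).symm

lemma integral_volumeIoiPow (d : ℕ) (g : ℝ → ℂ) :
    ∫ r : Set.Ioi (0 : ℝ), g r ∂(Measure.volumeIoiPow d) =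
      ∫ r in Set.Ioi (0 : ℝ), (r : ℂ) ^ d * g r := by
  simp only [Measure.volumeIoiPow, ENNReal.ofReal]
  rw [integral_withDensity_eq_integral_smul,
    integral_subtype_comap measurableSet_Ioi fun a => Real.toNNReal (a ^ d) • g a]
  · refine setIntegral_congr_fun measurableSet_Ioi fun x hx => ?_
    rw [NNReal.smul_def, Real.coe_toNNReal _ (pow_nonneg hx.out.le _), Complex.real_smul]
    push_cast
    rfl
  · exact (measurable_subtype_coe.pow_const _).real_toNNReal

/-- The integral of a monomial against a radial function splits into a spherical and a radial
factor. No integrability is needed. -/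
lemma integral_monom_radial {n : ℕ} (hn : 0 < n) (α β : Fin n → ℕ) (g : ℝ → ℂ) :
    ∫ z : CSpace n, monom α z * conj (monom β z) * g ‖z‖ =
      (∫ x : CSphere n, monom α x * conj (monom β x) ∂(volume : Measure (CSpace n)).toSphere) *
      ∫ r in Set.Ioi (0 : ℝ), (r : ℂ) ^ (2 * n - 1) * ((r : ℂ) ^ (len α + len β) * g r) := by
  rw [integral_cspace_polar hn, ← integral_volumeIoiPow _ (fun r => (r : ℂ) ^ (len α + len β) * g r),
    ← integral_prod_mul]
  refine integral_congr_ae (Eventually.of_forall fun y => ?_)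
  simp only [monom_real_smul, norm_smul, norm_sphere, mul_one, Real.norm_eq_abs,
    abs_of_pos y.2.2.out, map_mul, map_pow, Complex.conj_ofReal]
  ring

lemma integral_radial_gaussian {n : ℕ} (hn : 0 < n) (d : ℕ) :
    ∫ r in Set.Ioi (0 : ℝ), (r : ℂ) ^ (2 * n - 1) *
      ((r : ℂ) ^ d * (Real.exp (-1 * r ^ 2) : ℂ)) = ((Real.Gamma (n + d / 2) / 2 : ℝ) : ℂ) := by
  have h := integral_rpow_mul_exp_neg_rpow (p := 2) (q := 2 * n - 1 + d) (by norm_num) (by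
    have h1 : (1 : ℝ) ≤ n := by exact_mod_cast hn
    have h2 : (0 : ℝ) ≤ d := d.cast_nonneg
    linarith)
  have h3 : Real.Gamma (n + d / 2) / 2 = 1 / 2 * Real.Gamma ((2 * n - 1 + d + 1) / 2) := by
    rw [show ((2 * n - 1 + d + 1) / 2 : ℝ) = n + d / 2 by ring]
    ring
  rw [h3, ← h, ← integral_complex_ofReal]
  refine setIntegral_congr_fun measurableSet_Ioi fun r hr => ?_
  have h4 : r ^ (2 * (n : ℝ) - 1 + d) = r ^ (2 * n - 1 + d) := by
    rw [← Real.rpow_natCast]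
    congr 1
    rw [Nat.cast_add, Nat.cast_sub (by omega)]
    push_cast
    ring
  rw [h4, Real.rpow_two]
  push_cast
  rw [pow_add]
  ring_nf

lemma poch_pos {b : ℝ} (hb : 0 < b) (l : ℕ) : 0 < poch b l :=
  div_pos (Real.Gamma_pos_of_pos (by positivity)) (Real.Gamma_pos_of_pos hb)

lemma mfact_pos {n : ℕ} (k : Fin n → ℕ) : 0 < mfact k :=
  Finset.prod_pos fun _ _ => Nat.factorial_pos _

lemma integral_toSphere_monom {n : ℕ} (hn : 0 < n) (α β : Fin n → ℕ) :
    ∫ x : CSphere n, monom α x * conj (monom β x) ∂(volume : Measure (CSpace n)).toSphere =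
      if α = β then ((2 * Real.pi ^ n * mfact α / Real.Gamma (n + len α) : ℝ) : ℂ) else 0 := by
  have h := integral_monom_radial hn α β (fun r => (Real.exp (-1 * r ^ 2) : ℂ))
  rw [integral_radial_gaussian hn, integral_cspace_gaussian_moment α β one_pos] at h
  have hn' : (0 : ℝ) < n := by exact_mod_cast hn
  have hG : Real.Gamma (n + ((len α + len β : ℕ) : ℝ) / 2) ≠ 0 :=
    (Real.Gamma_pos_of_pos (by positivity)).ne'
  split_ifs at h ⊢ with hab
  · subst hab
    have h2 : (n : ℝ) + ((len α + len α : ℕ) : ℝ) / 2 = n + len α := by push_cast; ring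
    rw [h2] at h hG
    have hG' : ((Real.Gamma (n + len α) : ℝ) : ℂ) ≠ 0 := by exact_mod_cast hG
    push_cast at h ⊢
    rw [eq_div_iff hG']
    simp only [div_one, one_pow] at h
    linear_combination (-2) * h
  · have hG' : ((Real.Gamma (n + ((len α + len β : ℕ) : ℝ) / 2) / 2 : ℝ) : ℂ) ≠ 0 := by
      exact_mod_cast div_ne_zero hG two_ne_zero
    exact (mul_eq_zero.1 h.symm).resolve_right hG'

lemma toSphere_univ_toReal {n : ℕ} (hn : 0 < n) :
    ((volume : Measure (CSpace n)).toSphere Set.univ).toReal =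
      2 * Real.pi ^ n / Real.Gamma n := by
  have h := integral_toSphere_monom hn (0 : Fin n → ℕ) 0
  simp only [monom, mfact, len, Pi.zero_apply, pow_zero, Finset.prod_const_one, map_one, mul_one,
    integral_const, if_true, Nat.factorial_zero, Finset.sum_const_zero, Nat.cast_one,
    Nat.cast_zero, add_zero, Measure.real, Complex.real_smul] at h
  exact_mod_cast h

lemma integral_sphereMeasure {n : ℕ} (f : CSphere n → ℂ) :
    ∫ x, f x ∂(sphereMeasure n) =
      (((volume : Measure (CSpace n)).toSphere Set.univ).toReal : ℂ)⁻¹ *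
        ∫ x, f x ∂(volume : Measure (CSpace n)).toSphere := by
  rw [sphereMeasure, integral_smul_measure, ENNReal.toReal_inv, Complex.real_smul]
  push_cast
  rfl

/-- The moments of the normalized surface measure. -/
lemma integral_sphere_monom {n : ℕ} (hn : 0 < n) (α β : Fin n → ℕ) :
    ∫ x : CSphere n, monom α x * conj (monom β x) ∂(sphereMeasure n) =
      if α = β then ((mfact α / poch n (len α) : ℝ) : ℂ) else 0 := by
  rw [integral_sphereMeasure, toSphere_univ_toReal hn, integral_toSphere_monom hn]
  split_ifs
  · rw [← Complex.ofReal_inv, ← Complex.ofReal_mul]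
    have hn' : (0 : ℝ) < n := by exact_mod_cast hn
    have h1 := (Real.Gamma_pos_of_pos hn').ne'
    have h2 := (Real.Gamma_pos_of_pos (s := n + len α) (by positivity)).ne'
    congr 1
    unfold poch
    field_simp
  · simp

/-! ### The measure `m` as a mixture of Gaussians -/

/-- The integrand of the representation of `s ^ p * K_p(2 s)` as a mixture of Gaussians in `s`. -/
noncomputable def mixInt (p s a : ℝ) : ℝ := a ^ (p - 1) * Real.exp (-a - s ^ 2 / a)

lemma mixInt_pos (p s : ℝ) {a : ℝ} (ha : 0 < a) : 0 < mixInt p s a :=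
  mul_pos (Real.rpow_pos_of_pos ha _) (Real.exp_pos _)

lemma measurable_mixInt (p : ℝ) : Measurable (fun y : ℝ × ℝ => mixInt p y.1 y.2) := by
  unfold mixInt
  fun_prop

lemma integrableOn_mixInt (p : ℝ) {s : ℝ} (hs : 0 < s) :
    IntegrableOn (mixInt p s) (Set.Ioi 0) := by
  obtain ⟨N, hN⟩ := exists_nat_gt (-p)
  have h1 := (Real.GammaIntegral_convergent (s := p + N) (by linarith)).const_mul
    ((N.factorial : ℝ) / s ^ (2 * N))
  refine Integrable.mono' h1 ((measurable_mixInt p).comp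
    (measurable_const.prodMk measurable_id)).aestronglyMeasurable ?_
  filter_upwards [ae_restrict_mem measurableSet_Ioi] with a ha
  have ha : 0 < a := ha
  rw [Real.norm_of_nonneg (mixInt_pos p s ha).le, mixInt, sub_eq_add_neg (-a), Real.exp_add]
  -- `exp (-x) ≤ N! / x ^ N` with `x = s² / a` absorbs the singularity at `a = 0`
  have hx : 0 < s ^ 2 / a := by positivity
  have h2 : Real.exp (-(s ^ 2 / a)) ≤ N.factorial / (s ^ 2 / a) ^ N := by
    rw [Real.exp_neg, inv_le_comm₀ (Real.exp_pos _) (by positivity), inv_div]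
    exact Real.pow_div_factorial_le_exp _ hx.le N
  calc a ^ (p - 1) * (Real.exp (-a) * Real.exp (-(s ^ 2 / a)))
      ≤ a ^ (p - 1) * (Real.exp (-a) * (N.factorial / (s ^ 2 / a) ^ N)) := by gcongr
    _ = N.factorial / s ^ (2 * N) * (Real.exp (-a) * a ^ (p + N - 1)) := by
        rw [show p + N - 1 = p - 1 + N by ring, Real.rpow_add ha, Real.rpow_natCast, div_pow,
          ← pow_mul]
        field_simp

lemma integral_mixInt_pos (p : ℝ) {s : ℝ} (hs : 0 < s) :
    0 < ∫ a in Set.Ioi (0 : ℝ), mixInt p s a := by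
  rw [setIntegral_pos_iff_support_of_nonneg_ae _ (integrableOn_mixInt p hs)]
  · have : Function.support (mixInt p s) ∩ Set.Ioi 0 = Set.Ioi 0 :=
      Set.inter_eq_right.2 fun a ha => (mixInt_pos p s ha).ne'
    rw [this]
    simp
  · filter_upwards [ae_restrict_mem measurableSet_Ioi] with a ha
    exact (mixInt_pos p s ha).le

/-- The substitution `a = s * exp t` in the definition of the MacDonald–Bessel function. -/
lemma rpow_mul_besselK (p : ℝ) {s : ℝ} (hs : 0 < s) :
    s ^ p * besselK p (2 * s) = (1 / 2) * ∫ a in Set.Ioi (0 : ℝ), mixInt p s a := by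
  set h : ℝ → ℝ := fun t => s ^ p * (Real.exp (-(2 * s) * Real.cosh t) * Real.exp (p * t)) with hh
  have himg : (fun t => s * Real.exp t) '' Set.univ = Set.Ioi 0 := by
    ext a
    simp only [Set.image_univ, Set.mem_range, Set.mem_Ioi]
    constructor
    · rintro ⟨t, rfl⟩
      positivity
    · intro ha
      refine ⟨Real.log (a / s), ?_⟩
      rw [Real.exp_log (by positivity)]
      field_simp
  have hder : ∀ t ∈ (Set.univ : Set ℝ),
      HasDerivWithinAt (fun t => s * Real.exp t) (s * Real.exp t) Set.univ t :=
    fun t _ => ((Real.hasDerivAt_exp t).const_mul s).hasDerivWithinAt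
  have hinj : Set.InjOn (fun t => s * Real.exp t) Set.univ := by
    intro t _ t' _ htt
    exact Real.exp_injective (mul_left_cancel₀ hs.ne' htt)
  have hpt : ∀ t, |s * Real.exp t| • mixInt p s (s * Real.exp t) = h t := by
    intro t
    have h0 : 0 < s * Real.exp t := by positivity
    rw [abs_of_pos h0, smul_eq_mul, mixInt, ← mul_assoc, mul_comm (s * Real.exp t),
      ← Real.rpow_add_one h0.ne', sub_add_cancel, Real.mul_rpow hs.le (Real.exp_pos t).le,
      ← Real.exp_mul, mul_comm t p, hh]
    have h1 : -(s * Real.exp t) - s ^ 2 / (s * Real.exp t) = -(2 * s) * Real.cosh t := by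
      rw [Real.cosh_eq, Real.exp_neg]
      field_simp
      ring
    simp only
    rw [h1]
    ring
  have hint : Integrable h := by
    have := (integrableOn_image_iff_integrableOn_abs_deriv_smul MeasurableSet.univ hder hinj
      (mixInt p s)).1 (by rw [himg]; exact integrableOn_mixInt p hs)
    simp_rw [hpt] at this
    rwa [integrableOn_univ] at this
  have hval : ∫ a in Set.Ioi (0 : ℝ), mixInt p s a = ∫ t, h t := by
    rw [← himg, integral_image_eq_integral_abs_deriv_smul MeasurableSet.univ hder hinj]
    simp_rw [hpt]
    rw [setIntegral_univ]
  have hneg : ∫ t in Set.Iic (0 : ℝ), h t = ∫ t in Set.Ioi (0 : ℝ), h (-t) := by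
    have := integral_comp_neg_Ioi (0 : ℝ) h
    rw [neg_zero] at this
    exact this.symm
  have hintneg : IntegrableOn (fun t => h (-t)) (Set.Ioi 0) := hint.comp_neg.integrableOn
  rw [hval, ← intervalIntegral.integral_Iic_add_Ioi hint.integrableOn hint.integrableOn, hneg,
    ← integral_add hintneg hint.integrableOn, besselK, ← integral_const_mul, ← integral_const_mul]
  refine setIntegral_congr_fun measurableSet_Ioi fun t _ => ?_
  simp only [hh, Real.cosh_neg, Real.cosh_eq (p * t)]
  rw [mul_neg]
  ring

lemma densityM_eq {n : ℕ} (p : ℝ) {ħ : ℝ} (hħ : 0 < ħ) {z : CSpace n} (hz : z ≠ 0) :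
    densityM n p ħ z = 1 / Real.Gamma (n + p) * (1 / (Real.pi * ħ ^ 2) ^ n) *
      ∫ a in Set.Ioi (0 : ℝ), mixInt p (‖z‖ / ħ) a := by
  have hs : 0 < ‖z‖ / ħ := div_pos (norm_pos_iff.2 hz) hħ
  have h := rpow_mul_besselK p hs
  rw [densityM, mul_assoc, h]
  ring

lemma densityM_pos {n : ℕ} {p ħ : ℝ} (hp : -(n : ℝ) < p) (hħ : 0 < ħ) {z : CSpace n}
    (hz : z ≠ 0) : 0 < densityM n p ħ z := by
  rw [densityM_eq p hħ hz]
  have := Real.Gamma_pos_of_pos (s := n + p) (by linarith)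
  have := integral_mixInt_pos p (div_pos (norm_pos_iff.2 hz) hħ)
  have := Real.pi_pos
  positivity

lemma measurable_densityM (n : ℕ) (p ħ : ℝ) : Measurable (densityM n p ħ) := by
  have h1 : Measurable (besselK p) := by
    refine StronglyMeasurable.measurable (StronglyMeasurable.integral_prod_right
      (f := fun x t : ℝ => Real.exp (-x * Real.cosh t) * Real.cosh (p * t)) ?_)
    refine Continuous.stronglyMeasurable ?_
    fun_prop
  unfold densityM
  exact ((measurable_const.mul ((measurable_norm.div_const ħ).pow_const p))).mul
    (h1.comp ((measurable_norm.div_const ħ).const_mul 2))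

lemma ae_ne_zero {n : ℕ} (hn : 0 < n) : ∀ᵐ z : CSpace n, z ≠ 0 := by
  have : Nonempty (Fin n) := ⟨⟨0, hn⟩⟩
  have := (measure_singleton (μ := (volume : Measure (CSpace n))) 0)
  exact measure_eq_zero_iff_ae_notMem.1 this

lemma continuous_norm_monom_sq {n : ℕ} (α : Fin n → ℕ) :
    Continuous (fun z : CSpace n => ‖monom α z‖ ^ 2) :=
  (continuous_monom α).norm.pow 2

lemma integral_measureM {n : ℕ} (hn : 0 < n) {p ħ : ℝ} (hp : -(n : ℝ) < p) (hħ : 0 < ħ)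
    (f : CSpace n → ℂ) :
    ∫ z, f z ∂(measureM n p ħ) = ∫ z, f z * (densityM n p ħ z : ℂ) := by
  rw [measureM, integral_withDensity_eq_integral_toReal_smul
    (measurable_densityM n p ħ).ennreal_ofReal (Eventually.of_forall fun _ => ENNReal.ofReal_lt_top)]
  refine integral_congr_ae ?_
  filter_upwards [ae_ne_zero hn] with z hz
  rw [ENNReal.toReal_ofReal (densityM_pos hp hħ hz).le, Complex.real_smul, mul_comm]

lemma integrable_measureM {n : ℕ} (hn : 0 < n) {p ħ : ℝ} (hp : -(n : ℝ) < p) (hħ : 0 < ħ)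
    {f : CSpace n → ℂ} :
    Integrable f (measureM n p ħ) ↔ Integrable (fun z => f z * (densityM n p ħ z : ℂ)) := by
  rw [measureM, integrable_withDensity_iff_integrable_smul'
    (measurable_densityM n p ħ).ennreal_ofReal (Eventually.of_forall fun _ => ENNReal.ofReal_lt_top)]
  refine integrable_congr ?_
  filter_upwards [ae_ne_zero hn] with z hz
  rw [ENNReal.toReal_ofReal (densityM_pos hp hħ hz).le, Complex.real_smul, mul_comm]

lemma volume_absolutelyContinuous_measureM {n : ℕ} (hn : 0 < n) {p ħ : ℝ} (hp : -(n : ℝ) < p)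
    (hħ : 0 < ħ) : (volume : Measure (CSpace n)) ≪ measureM n p ħ := by
  refine withDensity_absolutelyContinuous' (measurable_densityM n p ħ).ennreal_ofReal.aemeasurable
    ?_
  filter_upwards [ae_ne_zero hn] with z hz
  exact (ENNReal.ofReal_pos.2 (densityM_pos hp hħ hz)).ne'

/-- The squared norms of the monomials: each Gaussian of the mixture contributes its moment, and
what remains is a Gamma integral. -/
lemma lintegral_monom_measureM {n : ℕ} (hn : 0 < n) {p ħ : ℝ} (hp : -(n : ℝ) < p) (hħ : 0 < ħ)
    (α : Fin n → ℕ) :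
    ∫⁻ z, ENNReal.ofReal (‖monom α z‖ ^ 2) ∂(measureM n p ħ) =
      ENNReal.ofReal (ħ ^ (2 * len α) * mfact α * poch (n + p) (len α)) := by
  have hpi := Real.pi_pos
  have hΓ := Real.Gamma_pos_of_pos (s := n + p) (by linarith)
  set C : ℝ := 1 / Real.Gamma (n + p) * (1 / (Real.pi * ħ ^ 2) ^ n) with hC
  have hCpos : 0 < C := by positivity
  set H : CSpace n → ℝ → ℝ := fun z a => C * mixInt p (‖z‖ / ħ) a * ‖monom α z‖ ^ 2 with hH
  have hmeas : Measurable (fun y : CSpace n × ℝ => H y.1 y.2) := by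
    have h1 : Measurable (fun y : CSpace n × ℝ => mixInt p (‖y.1‖ / ħ) y.2) :=
      (measurable_mixInt p).comp (((measurable_norm.comp measurable_fst).div_const ħ).prodMk
        measurable_snd)
    have h2 : Measurable (fun y : CSpace n × ℝ => ‖monom α y.1‖ ^ 2) :=
      (((continuous_monom α).comp continuous_fst).norm.pow 2).measurable
    exact (h1.const_mul C).mul h2
  have hsec : ∀ a : ℝ, 0 < a → ∫⁻ z, ENNReal.ofReal (H z a) = ENNReal.ofReal
      (ħ ^ (2 * len α) * mfact α / Real.Gamma (n + p) *
        (Real.exp (-a) * a ^ ((n + p + len α) - 1))) := by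
    intro a ha
    have hb : 0 < 1 / (a * ħ ^ 2) := by positivity
    have hm := integral_cspace_gaussian_moment α α hb
    rw [if_pos rfl] at hm
    have hptw : ∀ z : CSpace n, monom α z * conj (monom α z) *
        (Real.exp (-(1 / (a * ħ ^ 2)) * ‖z‖ ^ 2) : ℂ) =
        ((‖monom α z‖ ^ 2 * Real.exp (-(1 / (a * ħ ^ 2)) * ‖z‖ ^ 2) : ℝ) : ℂ) := by
      intro z
      rw [Complex.mul_conj, Complex.normSq_eq_norm_sq]
      push_cast
      rfl
    simp_rw [hptw] at hm
    rw [integral_complex_ofReal] at hm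
    have hm' := Complex.ofReal_injective hm
    have hval : 0 < (Real.pi / (1 / (a * ħ ^ 2))) ^ n * mfact α / (1 / (a * ħ ^ 2)) ^ len α := by
      have : (0 : ℝ) < mfact α := by exact_mod_cast mfact_pos α
      positivity
    have hint : Integrable (fun z : CSpace n =>
        ‖monom α z‖ ^ 2 * Real.exp (-(1 / (a * ħ ^ 2)) * ‖z‖ ^ 2)) :=
      Integrable.of_integral_ne_zero (by rw [hm']; exact hval.ne')
    have hHz : ∀ z, H z a = C * a ^ (p - 1) * Real.exp (-a) *
        (‖monom α z‖ ^ 2 * Real.exp (-(1 / (a * ħ ^ 2)) * ‖z‖ ^ 2)) := by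
      intro z
      simp only [hH, mixInt]
      rw [sub_eq_add_neg (-a), Real.exp_add]
      have : -((‖z‖ / ħ) ^ 2 / a) = -(1 / (a * ħ ^ 2)) * ‖z‖ ^ 2 := by field_simp
      rw [this]
      ring
    simp_rw [hHz]
    rw [← ofReal_integral_eq_lintegral_ofReal (hint.const_mul _)
      (Eventually.of_forall fun z => by positivity), integral_const_mul, hm']
    congr 1
    have h5 : a ^ ((n : ℝ) + p + len α - 1) = a ^ (p - 1) * a ^ n * a ^ len α := by
      rw [show (n : ℝ) + p + len α - 1 = p - 1 + n + len α by ring, Real.rpow_add ha,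
        Real.rpow_add ha, Real.rpow_natCast, Real.rpow_natCast]
    rw [h5, hC, one_div (a * ħ ^ 2), div_inv_eq_mul, inv_pow, div_inv_eq_mul, mul_pow a, ← pow_mul]
    field_simp
    ring
  have hbase : ∫⁻ z, ENNReal.ofReal (‖monom α z‖ ^ 2) ∂(measureM n p ħ) =
      ∫⁻ z, ∫⁻ a in Set.Ioi (0 : ℝ), ENNReal.ofReal (H z a) := by
    rw [measureM, lintegral_withDensity_eq_lintegral_mul _
      (measurable_densityM n p ħ).ennreal_ofReal
      (continuous_norm_monom_sq α).measurable.ennreal_ofReal]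
    refine lintegral_congr_ae ?_
    filter_upwards [ae_ne_zero hn] with z hz
    have hs : 0 < ‖z‖ / ħ := div_pos (norm_pos_iff.2 hz) hħ
    rw [Pi.mul_apply, ← ENNReal.ofReal_mul (densityM_pos hp hħ hz).le, densityM_eq p hħ hz,
      ← integral_const_mul, ← integral_mul_const]
    exact ofReal_integral_eq_lintegral_ofReal
      (((integrableOn_mixInt p hs).const_mul C).mul_const _) (by
        filter_upwards [ae_restrict_mem measurableSet_Ioi] with a ha
        have := mixInt_pos p (‖z‖ / ħ) ha
        positivity)
  rw [hbase, lintegral_lintegral_swap hmeas.ennreal_ofReal.aemeasurable,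
    setLIntegral_congr_fun measurableSet_Ioi (fun a ha => hsec a ha)]
  have hpos : 0 < (n : ℝ) + p + len α := by
    have : (0 : ℝ) ≤ len α := Nat.cast_nonneg _
    linarith
  rw [← ofReal_integral_eq_lintegral_ofReal ((Real.GammaIntegral_convergent hpos).const_mul _) (by
      filter_upwards [ae_restrict_mem measurableSet_Ioi] with a ha
      have : 0 < a := ha
      positivity),
    integral_const_mul, ← Real.Gamma_eq_integral hpos]
  congr 1
  unfold poch
  field_simp

lemma memLp_monom_measureM {n : ℕ} (hn : 0 < n) {p ħ : ℝ} (hp : -(n : ℝ) < p) (hħ : 0 < ħ)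
    (α : Fin n → ℕ) : MemLp (monom α) 2 (measureM n p ħ) := by
  rw [memLp_two_iff_integrable_sq_norm (continuous_monom α).aestronglyMeasurable]
  refine ⟨(continuous_norm_monom_sq α).aestronglyMeasurable, ?_⟩
  rw [hasFiniteIntegral_iff_ofReal (Eventually.of_forall fun z => by positivity),
    lintegral_monom_measureM hn hp hħ]
  exact ENNReal.ofReal_lt_top

/-- The moments of the measure `m`. -/
lemma integral_monom_measureM {n : ℕ} (hn : 0 < n) {p ħ : ℝ} (hp : -(n : ℝ) < p) (hħ : 0 < ħ)
    (α β : Fin n → ℕ) :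
    ∫ z, monom α z * conj (monom β z) ∂(measureM n p ħ) =
      if α = β then ((ħ ^ (2 * len α) * mfact α * poch (n + p) (len α) : ℝ) : ℂ) else 0 := by
  split_ifs with hab
  · subst hab
    have hptw : ∀ z : CSpace n, monom α z * conj (monom α z) = ((‖monom α z‖ ^ 2 : ℝ) : ℂ) := by
      intro z
      rw [Complex.mul_conj, Complex.normSq_eq_norm_sq]
    simp_rw [hptw]
    rw [integral_complex_ofReal, integral_eq_lintegral_of_nonneg_ae
      (Eventually.of_forall fun z => by positivity)
      (continuous_norm_monom_sq α).aestronglyMeasurable,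
      lintegral_monom_measureM hn hp hħ, ENNReal.toReal_ofReal]
    have := poch_pos (b := n + p) (by linarith) (len α)
    positivity
  · rw [integral_measureM hn hp hħ]
    have h := integral_monom_radial hn α β (fun r => ((1 / Real.Gamma (n + p) *
      (2 / (Real.pi * ħ ^ 2) ^ n) * (r / ħ) ^ p * besselK p (2 * (r / ħ)) : ℝ) : ℂ))
    rw [integral_toSphere_monom hn, if_neg hab, zero_mul] at h
    exact h

/-! ### A generating function for binomial coefficients -/

lemma choose_mul_pow_le (N j : ℕ) {y : ℝ} (hy : 0 ≤ y) :
    ((N + 2 * j).choose j : ℝ) * y ^ j ≤ 2 ^ N * (4 * y) ^ j := by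
  have h : ((N + 2 * j).choose j : ℝ) ≤ 2 ^ (N + 2 * j) := by
    exact_mod_cast Nat.choose_le_two_pow (N + 2 * j) j
  calc ((N + 2 * j).choose j : ℝ) * y ^ j ≤ 2 ^ (N + 2 * j) * y ^ j := by gcongr
    _ = 2 ^ N * (4 * y) ^ j := by
        rw [pow_add, pow_mul, mul_pow]
        norm_num
        ring

lemma summable_choose_mul_pow (N : ℕ) {y : ℝ} (hy : 0 ≤ y) (hy4 : 4 * y < 1) :
    Summable (fun j : ℕ => ((N + 2 * j).choose j : ℝ) * y ^ j) :=
  Summable.of_nonneg_of_le (fun j => by positivity) (fun j => choose_mul_pow_le N j hy)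
    ((summable_geometric_of_lt_one (by positivity) hy4).mul_left _)

/-- With `y = s / (1 + s) ^ 2`, the series `G_N = ∑_j (N + 2 j choose j) y ^ j` satisfies the
recurrence `G_{N+1} = G_N + y * G_{N+2}` with characteristic roots `1 + s` and `(1 + s) / s`. The
growth bound `G_N = O(2 ^ N)` excludes the second root, and `G_0 = 1 + 2 y G_1` fixes the
constant. -/
lemma hasSum_choose_add_two_mul (N : ℕ) {s : ℝ} (hs : 0 ≤ s) (hs1 : s < 1) :
    HasSum (fun j : ℕ => ((N + 2 * j).choose j : ℝ) * (s / (1 + s) ^ 2) ^ j)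
      ((1 + s) ^ (N + 1) / (1 - s)) := by
  rcases hs.eq_or_lt with rfl | hs0
  · convert! hasSum_single (f := fun j : ℕ => ((N + 2 * j).choose j : ℝ) *
      ((0 : ℝ) / (1 + 0) ^ 2) ^ j) 0 (fun j hj => by simp [hj]) using 1
    simp
  set y := s / (1 + s) ^ 2 with hy
  have hy0 : 0 < y := by positivity
  have hys : y * (1 + s) ^ 2 = s := by rw [hy]; field_simp
  have hy4 : 4 * y < 1 := by
    rw [hy, mul_div_assoc', div_lt_one (by positivity)]
    nlinarith [sq_pos_of_pos (sub_pos.2 hs1)]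
  have hsum := fun N => summable_choose_mul_pow N hy0.le hy4
  set G : ℕ → ℝ := fun N => ∑' j : ℕ, ((N + 2 * j).choose j : ℝ) * y ^ j with hG
  have hrec : ∀ N, G (N + 1) = G N + y * G (N + 2) := by
    intro N
    have hshift : Summable (fun j : ℕ => ((N + 2 * (j + 1)).choose (j + 1) : ℝ) * y ^ (j + 1)) :=
      (summable_nat_add_iff 1).2 (hsum N)
    simp only [hG]
    rw [(hsum (N + 1)).tsum_eq_zero_add, (hsum N).tsum_eq_zero_add, ← tsum_mul_left,
      add_assoc (((N + 2 * 0).choose 0 : ℝ) * y ^ 0),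
      ← hshift.tsum_add ((hsum (N + 2)).mul_left y)]
    congr 1
    · simp
    refine tsum_congr fun j => ?_
    have h : (N + 1 + 2 * (j + 1)).choose (j + 1) =
        (N + 2 + 2 * j).choose j + (N + 2 * (j + 1)).choose (j + 1) := by
      rw [show N + 1 + 2 * (j + 1) = (N + 2 * (j + 1)) + 1 by ring, Nat.choose_succ_succ]
      congr 2
      ring
    rw [h]
    push_cast
    ring
  have h0 : G 0 = 1 + 2 * y * G 1 := by
    simp only [hG]
    rw [(hsum 0).tsum_eq_zero_add, ← tsum_mul_left]
    congr 1
    · simp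
    refine tsum_congr fun j => ?_
    have h : (0 + 2 * (j + 1)).choose (j + 1) = 2 * (1 + 2 * j).choose j := by
      have h1 : 0 + 2 * (j + 1) = (2 * j + 1) + 1 := by ring
      have h2 : (2 * j + 1).choose (j + 1) = (2 * j + 1).choose j := by
        rw [← Nat.choose_symm_half]
      rw [h1, Nat.choose_succ_succ, h2, add_comm 1 (2 * j)]
      ring
    rw [h]
    push_cast
    ring
  have hbd : ∀ N, |G N| ≤ (1 - 4 * y)⁻¹ * 2 ^ N := by
    intro N
    rw [abs_of_nonneg (tsum_nonneg fun j => by positivity), mul_comm,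
      ← tsum_geometric_of_lt_one (by positivity) hy4, ← tsum_mul_left]
    exact (hsum N).tsum_le_tsum (fun j => choose_mul_pow_le N j hy0.le)
      ((summable_geometric_of_lt_one (by positivity) hy4).mul_left _)
  -- `d N` is the component of the sequence along the root `(1 + s) / s`
  set d : ℕ → ℝ := fun N => G (N + 1) - (1 + s) * G N with hd
  have hdrec : ∀ N, s * d (N + 1) = (1 + s) * d N := by
    intro N
    simp only [hd]
    have := hrec N
    have h2 : s * G (N + 2) = (1 + s) ^ 2 * (G (N + 1) - G N) := by
      linear_combination (-(1 + s) ^ 2) * this - G (N + 2) * hys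
    rw [mul_sub, show N + 1 + 1 = N + 2 by rfl, h2]
    ring
  have hdN : ∀ N, d N = ((1 + s) / s) ^ N * d 0 := by
    intro N
    induction N with
    | zero => simp
    | succ N ih =>
      rw [pow_succ, mul_right_comm, ← ih]
      have := hdrec N
      field_simp
      linarith
  have hd0 : d 0 = 0 := by
    have hr : |2 * s / (1 + s)| < 1 := by
      rw [abs_of_nonneg (by positivity), div_lt_one (by positivity)]
      linarith
    have ht := (tendsto_pow_atTop_nhds_zero_of_abs_lt_one hr).mul_const
      ((1 - 4 * y)⁻¹ * (3 + s))
    rw [zero_mul] at ht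
    have hle : ∀ N : ℕ, |d 0| ≤ (2 * s / (1 + s)) ^ N * ((1 - 4 * y)⁻¹ * (3 + s)) := by
      intro N
      have h1 : |d N| ≤ (1 - 4 * y)⁻¹ * (3 + s) * 2 ^ N := by
        calc |d N| ≤ |G (N + 1)| + |(1 + s) * G N| := abs_sub _ _
          _ ≤ (1 - 4 * y)⁻¹ * 2 ^ (N + 1) + (1 + s) * ((1 - 4 * y)⁻¹ * 2 ^ N) := by
              rw [abs_mul, abs_of_pos (by linarith : 0 < 1 + s)]
              gcongr
              · exact hbd _
              · exact hbd _
          _ = _ := by ring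
      rw [hdN N, abs_mul, abs_of_nonneg (by positivity)] at h1
      calc |d 0| = (s / (1 + s)) ^ N * (((1 + s) / s) ^ N * |d 0|) := by
            rw [← mul_assoc, ← mul_pow, div_mul_div_cancel₀ (by positivity), div_self hs0.ne',
              one_pow, one_mul]
        _ ≤ (s / (1 + s)) ^ N * ((1 - 4 * y)⁻¹ * (3 + s) * 2 ^ N) := by gcongr
        _ = _ := by rw [mul_div_assoc, mul_pow 2]; ring
    exact abs_eq_zero.1 (le_antisymm (ge_of_tendsto' ht hle) (abs_nonneg _))
  have hgeo : ∀ N, G N = (1 + s) ^ N * G 0 := by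
    intro N
    induction N with
    | zero => simp
    | succ N ih =>
      have := hdN N
      rw [hd0, mul_zero] at this
      rw [pow_succ, mul_right_comm, ← ih]
      simp only [hd] at this
      linarith
  have hG0 : G 0 * (1 - s) = 1 + s := by
    have h1 := hgeo 1
    rw [h1, pow_one] at h0
    have h3 : (1 + s) * G 0 = (1 + s) + 2 * s * G 0 := by
      calc (1 + s) * G 0 = (1 + s) * (1 + 2 * y * ((1 + s) * G 0)) := by rw [← h0]
        _ = (1 + s) + 2 * (y * (1 + s) ^ 2) * G 0 := by ring
        _ = _ := by rw [hys]
    linarith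
  have hfin : G N = (1 + s) ^ (N + 1) / (1 - s) := by
    rw [hgeo N, eq_div_iff (by linarith), mul_assoc, hG0, pow_succ]
  rw [← hfin]
  exact (hsum N).hasSum

/-! ### The Hermitian product and integrals over the sphere -/

lemma cdot_eq_inner {n : ℕ} (z w : CSpace n) : cdot z w = inner ℂ w z := by
  simp [cdot, PiLp.inner_apply, RCLike.inner_apply]

lemma norm_cdot_le {n : ℕ} (z w : CSpace n) : ‖cdot z w‖ ≤ ‖z‖ * ‖w‖ := by
  rw [cdot_eq_inner, mul_comm]
  exact norm_inner_le_norm w z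

lemma cdot_self {n : ℕ} (z : CSpace n) : cdot z z = ((‖z‖ ^ 2 : ℝ) : ℂ) := by
  rw [cdot_eq_inner, inner_self_eq_norm_sq_to_K]
  push_cast
  rfl

lemma conj_cdot {n : ℕ} (z w : CSpace n) : conj (cdot z w) = cdot w z := by
  rw [cdot_eq_inner, cdot_eq_inner, inner_conj_symm]

lemma continuous_cdot_right {n : ℕ} (z : CSpace n) : Continuous (fun w : CSpace n => cdot z w) := by
  unfold cdot
  fun_prop

lemma continuous_cdot_left {n : ℕ} (w : CSpace n) : Continuous (fun z : CSpace n => cdot z w) := by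
  unfold cdot
  fun_prop

/-- The multinomial theorem for `(z · w) ^ l`. -/
lemma cdot_pow {n : ℕ} (z w : CSpace n) (l : ℕ) :
    cdot z w ^ l = ∑ k ∈ Finset.univ.piAntidiag l,
      ((l.factorial / mfact k : ℝ) : ℂ) * monom k z * conj (monom k w) := by
  rw [cdot, Finset.sum_pow_eq_sum_piAntidiag]
  refine Finset.sum_congr rfl fun k hk => ?_
  have h1 := Nat.multinomial_spec Finset.univ k
  rw [Finset.mem_piAntidiag] at hk
  rw [hk.1] at h1
  have h2 : (mfact k : ℂ) ≠ 0 := by exact_mod_cast (mfact_pos k).ne'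
  have h3 : (mfact k : ℂ) * (Nat.multinomial Finset.univ k : ℂ) = l.factorial := by
    exact_mod_cast h1
  push_cast
  rw [← h3, mul_div_cancel_left₀ _ h2]
  simp only [monom, map_prod, map_pow, mul_pow, Finset.prod_mul_distrib, mul_assoc]

lemma integrable_sphere {n : ℕ} {f : CSphere n → ℂ} (hf : Continuous f) :
    Integrable f (sphereMeasure n) :=
  hf.integrable_of_hasCompactSupport (HasCompactSupport.of_compactSpace f)

lemma continuous_monom_sphere {n : ℕ} (k : Fin n → ℕ) :
    Continuous (fun x : CSphere n => monom k (x : CSpace n)) :=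
  (continuous_monom k).comp continuous_subtype_val

lemma continuous_cdot_sphere {n : ℕ} (z : CSpace n) :
    Continuous (fun x : CSphere n => cdot z (x : CSpace n)) :=
  (continuous_cdot_right z).comp continuous_subtype_val

lemma continuous_cdot_sphere' {n : ℕ} (z : CSpace n) :
    Continuous (fun x : CSphere n => cdot (x : CSpace n) z) :=
  (continuous_cdot_left z).comp continuous_subtype_val

lemma mem_piAntidiag_univ {n : ℕ} {k : Fin n → ℕ} {l : ℕ} :
    k ∈ (Finset.univ : Finset (Fin n)).piAntidiag l ↔ len k = l := by
  simp [Finset.mem_piAntidiag, len]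

/-- The powers of the Hermitian product reproduce monomials up to a factor. -/
lemma integral_monom_mul_cdot_pow {n : ℕ} (hn : 0 < n) (k : Fin n → ℕ) (z : CSpace n) (l : ℕ) :
    ∫ x : CSphere n, monom k x * cdot z x ^ l ∂(sphereMeasure n) =
      if len k = l then ((l.factorial / poch n l : ℝ) : ℂ) * monom k z else 0 := by
  simp_rw [cdot_pow, Finset.mul_sum]
  rw [integral_finsetSum _ fun β _ => integrable_sphere (by
    have := continuous_monom_sphere k
    have := continuous_monom_sphere β
    fun_prop)]
  have h1 : ∀ β : Fin n → ℕ, ∫ x : CSphere n, monom k x *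
      (((l.factorial / mfact β : ℝ) : ℂ) * monom β z * conj (monom β (x : CSpace n)))
        ∂(sphereMeasure n) = if k = β then ((l.factorial / poch n (len k) : ℝ) : ℂ) * monom k z
          else 0 := by
    intro β
    have h2 : ∀ x : CSphere n, monom k x *
      (((l.factorial / mfact β : ℝ) : ℂ) * monom β z * conj (monom β (x : CSpace n))) =
      (((l.factorial / mfact β : ℝ) : ℂ) * monom β z) * (monom k x * conj (monom β (x : CSpace n)))
      := fun x => by ring
    simp_rw [h2]
    rw [integral_const_mul, integral_sphere_monom hn]
    split_ifs with h
    · subst h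
      have h3 : (mfact k : ℂ) ≠ 0 := by exact_mod_cast (mfact_pos k).ne'
      push_cast
      field_simp
    · simp
  simp_rw [h1]
  rw [Finset.sum_ite_eq]
  simp only [mem_piAntidiag_univ]
  split_ifs with h
  · rw [h]
  · rfl

lemma monom_mul {n : ℕ} (α β : Fin n → ℕ) (z : CSpace n) :
    monom α z * monom β z = monom (α + β) z := by
  simp only [monom, ← Finset.prod_mul_distrib, Pi.add_apply, pow_add]

lemma len_add {n : ℕ} (α β : Fin n → ℕ) : len (α + β) = len α + len β := by
  simp [len, Finset.sum_add_distrib]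

lemma integral_monom_mul_cdot_pow_mul_cdot_pow {n : ℕ} (hn : 0 < n) (k : Fin n → ℕ)
    (z : CSpace n) (i j : ℕ) :
    ∫ x : CSphere n, monom k x * (cdot z x ^ i * cdot x z ^ j) ∂(sphereMeasure n) =
      if len k + j = i then ((i.factorial / poch n i * ‖z‖ ^ (2 * j) : ℝ) : ℂ) * monom k z
      else 0 := by
  have h0 : ∀ x : CSphere n, monom k x * (cdot z x ^ i * cdot (x : CSpace n) z ^ j) =
      ∑ β ∈ Finset.univ.piAntidiag j, (((j.factorial / mfact β : ℝ) : ℂ) * conj (monom β z)) *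
        (monom (k + β) x * cdot z x ^ i) := by
    intro x
    rw [cdot_pow (x : CSpace n) z, Finset.mul_sum, Finset.mul_sum]
    refine Finset.sum_congr rfl fun β _ => ?_
    rw [← monom_mul]
    ring
  simp_rw [h0]
  rw [integral_finsetSum _ fun β _ => integrable_sphere (by
    have := continuous_monom_sphere (k + β)
    have := continuous_cdot_sphere z
    fun_prop)]
  simp_rw [integral_const_mul, integral_monom_mul_cdot_pow hn]
  split_ifs with h
  · calc _ = ∑ β ∈ Finset.univ.piAntidiag j, (((i.factorial / poch n i : ℝ) : ℂ) * monom k z) *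
          (((j.factorial / mfact β : ℝ) : ℂ) * monom β z * conj (monom β z)) := by
          refine Finset.sum_congr rfl fun β hβ => ?_
          rw [mem_piAntidiag_univ] at hβ
          rw [if_pos (by rw [len_add, hβ, h]), ← monom_mul]
          ring
      _ = _ := by
          rw [← Finset.mul_sum, ← cdot_pow, cdot_self]
          push_cast
          rw [pow_mul]
          ring
  · refine Finset.sum_eq_zero fun β hβ => ?_
    rw [mem_piAntidiag_univ] at hβ
    rw [if_neg (by rw [len_add, hβ]; exact h), mul_zero]

/-! ### The Poisson extension of a monomial -/

/-- `2 Re (z · w)`, as a complex number. -/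
noncomputable def twoRe {n : ℕ} (z w : CSpace n) : ℂ := cdot z w + cdot w z

lemma twoRe_eq {n : ℕ} (z w : CSpace n) : twoRe z w = ((2 * (cdot z w).re : ℝ) : ℂ) := by
  rw [twoRe, ← conj_cdot z w, Complex.add_conj]

lemma continuous_twoRe_sphere {n : ℕ} (z : CSpace n) :
    Continuous (fun x : CSphere n => twoRe z (x : CSpace n)) :=
  (continuous_cdot_sphere z).add (continuous_cdot_sphere' z)

lemma norm_twoRe_le {n : ℕ} (z : CSpace n) (x : CSphere n) : ‖twoRe z x‖ ≤ 2 * ‖z‖ := by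
  have h1 := norm_cdot_le z x
  have h2 := norm_cdot_le (x : CSpace n) z
  rw [norm_sphere] at h1 h2
  refine (norm_add_le _ _).trans ?_
  linarith

lemma norm_sub_sq_sphere {n : ℕ} (z : CSpace n) (x : CSphere n) :
    ‖z - x‖ ^ 2 = 1 + ‖z‖ ^ 2 - 2 * (cdot z x).re := by
  rw [@norm_sub_sq ℂ, norm_sphere, cdot_eq_inner, inner_re_symm]
  simp only [RCLike.re_to_complex, one_pow]
  ring

/-- Expansion of the Poisson kernel as a binomial series in `2 Re (z · x)`. -/
lemma hasSum_poissonKernel {n : ℕ} (hn : 0 < n) {z : CSpace n} (hz : ‖z‖ < 1) (x : CSphere n) :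
    HasSum (fun m : ℕ => (((1 - ‖z‖ ^ 2) * ((m + (n - 1)).choose (n - 1) : ℝ) /
      (1 + ‖z‖ ^ 2) ^ (n + m) : ℝ) : ℂ) * twoRe z x ^ m) (poissonKernel z x : ℂ) := by
  set s := ‖z‖ ^ 2 with hs
  have hs0 : 0 < 1 + s := by positivity
  have hlt : 2 * ‖z‖ < 1 + s := by nlinarith [sq_pos_of_pos (sub_pos.2 hz)]
  have hr : ‖2 * (cdot z x).re / (1 + s)‖ < 1 := by
    have h1 := norm_twoRe_le z x
    rw [twoRe_eq, Complex.norm_real] at h1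
    rw [norm_div, Real.norm_of_nonneg hs0.le, div_lt_one hs0]
    linarith
  have h := (hasSum_choose_mul_geometric_of_norm_lt_one (n - 1) hr).mul_left
    ((1 - s) / (1 + s) ^ n)
  rw [Nat.sub_add_cancel hn] at h
  have hval : (1 - s) / (1 + s) ^ n * (1 / (1 - 2 * (cdot z x).re / (1 + s)) ^ n) =
      poissonKernel z x := by
    rw [poissonKernel, pow_mul, norm_sub_sq_sphere, div_mul_div_comm, mul_one, ← mul_pow,
      mul_sub, mul_one, mul_div_cancel₀ _ hs0.ne']
  rw [hval] at h
  have h' := Complex.hasSum_ofReal.2 h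
  convert! h' using 1
  funext m
  rw [twoRe_eq, div_pow, pow_add]
  push_cast
  field_simp

/-- Term by term integration against the Poisson kernel. -/
lemma hasSum_integral_poissonKernel {n : ℕ} (hn : 0 < n) {z : CSpace n} (hz : ‖z‖ < 1)
    {f : CSphere n → ℂ} (hf : Integrable f (sphereMeasure n)) :
    HasSum (fun m : ℕ => (((1 - ‖z‖ ^ 2) * ((m + (n - 1)).choose (n - 1) : ℝ) /
      (1 + ‖z‖ ^ 2) ^ (n + m) : ℝ) : ℂ) * ∫ x : CSphere n, f x * twoRe z x ^ m ∂(sphereMeasure n))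
      (poissonExt f z) := by
  set s := ‖z‖ ^ 2 with hs
  have hs0 : 0 < 1 + s := by positivity
  have hs1 : 0 ≤ 1 - s := by rw [hs]; nlinarith [norm_nonneg z]
  have hlt : 2 * ‖z‖ < 1 + s := by nlinarith [sq_pos_of_pos (sub_pos.2 hz)]
  set b : ℕ → ℝ := fun m => (1 - s) * ((m + (n - 1)).choose (n - 1) : ℝ) / (1 + s) ^ (n + m)
    with hb
  have hb0 : ∀ m, 0 ≤ b m := fun m => by positivity
  set F : ℕ → CSphere n → ℂ := fun m x => (b m : ℂ) * (f x * twoRe z x ^ m) with hF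
  have hFint : ∀ m, Integrable (F m) (sphereMeasure n) := fun m =>
    (hf.mul_bdd (c := (2 * ‖z‖) ^ m) ((continuous_twoRe_sphere z).pow m).aestronglyMeasurable
      (Eventually.of_forall fun x => by
        simp only [Pi.pow_apply, norm_pow]
        exact pow_le_pow_left₀ (norm_nonneg _) (norm_twoRe_le z x) m)).const_mul _
  have hbsum : Summable (fun m => b m * (2 * ‖z‖) ^ m) := by
    have hr : ‖2 * ‖z‖ / (1 + s)‖ < 1 := by
      rw [Real.norm_of_nonneg (by positivity), div_lt_one hs0]
      exact hlt
    convert! (summable_choose_mul_geometric_of_norm_lt_one (n - 1) hr).mul_left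
      ((1 - s) / (1 + s) ^ n) using 1
    funext m
    simp only [hb]
    rw [div_pow, pow_add]
    field_simp
  have hsum : Summable (fun m => ∫ x, ‖F m x‖ ∂(sphereMeasure n)) := by
    refine Summable.of_nonneg_of_le (fun m => integral_nonneg fun x => norm_nonneg _) (fun m => ?_)
      (hbsum.mul_right (∫ x, ‖f x‖ ∂(sphereMeasure n)))
    rw [← integral_const_mul]
    refine integral_mono (hFint m).norm (hf.norm.const_mul _) fun x => ?_
    simp only [hF, norm_mul, norm_pow, Complex.norm_real, Real.norm_of_nonneg (hb0 m)]
    have := pow_le_pow_left₀ (norm_nonneg _) (norm_twoRe_le z x) m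
    calc b m * (‖f x‖ * ‖twoRe z x‖ ^ m) ≤ b m * (‖f x‖ * (2 * ‖z‖) ^ m) := by
          have := hb0 m
          gcongr
      _ = _ := by ring
  have h := hasSum_integral_of_summable_integral_norm hFint hsum
  have h2 : ∫ x, ∑' m, F m x ∂(sphereMeasure n) = poissonExt f z := by
    refine integral_congr_ae (Eventually.of_forall fun x => ?_)
    have := (hasSum_poissonKernel hn hz x).mul_right (f x)
    simp only
    rw [← this.tsum_eq]
    refine tsum_congr fun m => ?_
    simp only [hF]
    ring
  rw [h2] at h
  simpa only [hF, integral_const_mul] using h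

lemma poch_natCast {n : ℕ} (hn : 0 < n) (l : ℕ) :
    poch n l = ((n - 1 + l).factorial : ℝ) / (n - 1).factorial := by
  obtain ⟨m, rfl⟩ : ∃ m, n = m + 1 := ⟨n - 1, by omega⟩
  rw [poch, ← Nat.cast_add, show m + 1 + l = (m + l) + 1 by ring, Nat.cast_add_one,
    Real.Gamma_nat_eq_factorial, Nat.cast_add_one, Real.Gamma_nat_eq_factorial]
  simp

lemma integral_monom_mul_twoRe_pow {n : ℕ} (hn : 0 < n) (k : Fin n → ℕ) (z : CSpace n) (m : ℕ) :
    ∫ x : CSphere n, monom k x * twoRe z x ^ m ∂(sphereMeasure n) =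
      ∑ i ∈ Finset.range (m + 1), if len k + (m - i) = i then
        ((m.choose i * (i.factorial / poch n i * ‖z‖ ^ (2 * (m - i))) : ℝ) : ℂ) * monom k z
        else 0 := by
  have h0 : ∀ x : CSphere n, monom k x * twoRe z x ^ m = ∑ i ∈ Finset.range (m + 1),
      (m.choose i : ℂ) * (monom k x * (cdot z x ^ i * cdot (x : CSpace n) z ^ (m - i))) := by
    intro x
    rw [twoRe, add_pow, Finset.mul_sum]
    exact Finset.sum_congr rfl fun i _ => by ring
  simp_rw [h0]
  rw [integral_finsetSum _ fun i _ => integrable_sphere (by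
    have := continuous_monom_sphere k
    have := continuous_cdot_sphere z
    have := continuous_cdot_sphere' z
    fun_prop)]
  simp_rw [integral_const_mul, integral_monom_mul_cdot_pow_mul_cdot_pow hn]
  refine Finset.sum_congr rfl fun i _ => ?_
  split_ifs
  · push_cast
    ring
  · simp

/-- Monomials are their own Poisson extensions: the integrated series is the generating function
`hasSum_choose_add_two_mul` at `s = |z| ^ 2`. -/
lemma poissonExt_monom {n : ℕ} (hn : 0 < n) (k : Fin n → ℕ) {z : CSpace n} (hz : ‖z‖ < 1) :
    poissonExt (fun x : CSphere n => monom k x) z = monom k z := by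
  have h := hasSum_integral_poissonKernel hn hz (integrable_sphere (continuous_monom_sphere k))
  set s := ‖z‖ ^ 2 with hs
  have hs0 : 0 < 1 + s := by positivity
  have hs1 : s < 1 := by rw [hs]; nlinarith [norm_nonneg z]
  simp_rw [integral_monom_mul_twoRe_pow hn] at h
  have hinj : Function.Injective (fun j : ℕ => len k + 2 * j) := fun a b hab => by
    simp only at hab
    omega
  rw [← hinj.hasSum_iff] at h
  · have h2 := (hasSum_choose_add_two_mul (n - 1 + len k) (sq_nonneg ‖z‖) hs1).mul_left
      ((1 - s) / (1 + s) ^ (n + len k))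
    rw [← hs] at h2
    have h3 : (1 - s) / (1 + s) ^ (n + len k) * ((1 + s) ^ (n - 1 + len k + 1) / (1 - s)) = 1 := by
      have : 1 - s ≠ 0 := by linarith
      rw [show n - 1 + len k + 1 = n + len k by omega]
      field_simp
    rw [h3] at h2
    have h4 := (Complex.hasSum_ofReal.2 h2).mul_right (monom k z)
    rw [Complex.ofReal_one, one_mul] at h4
    refine h.unique ?_
    convert! h4 using 1
    funext j
    simp only [Function.comp_apply]
    rw [Finset.sum_eq_single (len k + j)]
    · have e1 : len k + 2 * j - (len k + j) = j := by omega
      rw [e1, if_pos rfl, ← mul_assoc, ← Complex.ofReal_mul]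
      congr 2
      have f1 : ((len k + 2 * j + (n - 1)).choose (n - 1) : ℝ) =
          (n - 1 + len k + 2 * j).factorial / ((n - 1).factorial * (len k + 2 * j).factorial) := by
        rw [Nat.cast_choose ℝ (by omega), Nat.add_sub_cancel,
          show len k + 2 * j + (n - 1) = n - 1 + len k + 2 * j by omega]
      have f2 : ((len k + 2 * j).choose (len k + j) : ℝ) =
          (len k + 2 * j).factorial / ((len k + j).factorial * j.factorial) := by
        rw [Nat.cast_choose ℝ (by omega), e1]
      have f3 : ((n - 1 + len k + 2 * j).choose j : ℝ) =
          (n - 1 + len k + 2 * j).factorial / (j.factorial * (n - 1 + len k + j).factorial) := by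
        rw [Nat.cast_choose ℝ (by omega),
          show n - 1 + len k + 2 * j - j = n - 1 + len k + j by omega]
      rw [f1, f2, f3, poch_natCast hn, ← add_assoc (n - 1), pow_mul, ← hs, div_pow, ← pow_mul,
        ← add_assoc n, pow_add (1 + s) (n + len k)]
      have g1 := (n - 1).factorial_ne_zero
      have g2 := (len k + 2 * j).factorial_ne_zero
      have g3 := (len k + j).factorial_ne_zero
      have g4 := (n - 1 + len k + j).factorial_ne_zero
      have g5 := j.factorial_ne_zero
      field_simp
      rw [← pow_mul (1 + s) 2 j]
      ring
    · intro i hi hne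
      rw [Finset.mem_range] at hi
      rw [if_neg (by omega)]
    · intro hi
      exact absurd (Finset.mem_range.2 (by omega)) hi
  · intro m hm
    rw [Finset.sum_eq_zero, mul_zero]
    intro i hi
    rw [Finset.mem_range] at hi
    rw [if_neg]
    intro hmi
    exact hm ⟨m - i, by simp only; omega⟩

/-! ### Homogeneous expansion of holomorphic functions -/

/-- The degree `m` term of the Taylor expansion of `f` at the origin, computed on complex lines
through the origin. -/
noncomputable def taylorTerm {n : ℕ} (f : CSpace n → ℂ) (m : ℕ) (z : CSpace n) : ℂ :=
  (m.factorial : ℂ)⁻¹ * iteratedDeriv m (fun c : ℂ => f (c • z)) 0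

lemma iteratedDeriv_comp_mul_left (g : ℂ → ℂ) (c : ℂ) (m : ℕ) :
    iteratedDeriv m (fun x => g (c * x)) = fun x => c ^ m * iteratedDeriv m g (c * x) := by
  induction m with
  | zero => simp
  | succ m ih =>
    funext x
    rw [iteratedDeriv_succ, ih, iteratedDeriv_succ, deriv_const_mul_field,
      deriv_comp_mul_left, smul_eq_mul, pow_succ]
    ring

lemma taylorTerm_smul {n : ℕ} (f : CSpace n → ℂ) (m : ℕ) (c : ℂ) (z : CSpace n) :
    taylorTerm f m (c • z) = c ^ m * taylorTerm f m z := by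
  have h : (fun x : ℂ => f (x • c • z)) = fun x => (fun y : ℂ => f (y • z)) (c * x) := by
    funext x
    rw [smul_smul, mul_comm]
  rw [taylorTerm, h, iteratedDeriv_comp_mul_left (fun y : ℂ => f (y • z)), taylorTerm]
  simp only [mul_zero]
  ring

lemma differentiableOn_line {n : ℕ} {f : CSpace n → ℂ} {R : ℝ}
    (hf : DifferentiableOn ℂ f (Metric.ball 0 R)) (y w : CSpace n) {r : ℝ}
    (hr : ∀ c : ℂ, ‖c‖ < r → ‖y + c • w‖ < R) :
    DifferentiableOn ℂ (fun c : ℂ => f (y + c • w)) (Metric.ball 0 r) := by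
  refine hf.comp (by fun_prop) fun c hc => ?_
  rw [mem_ball_zero_iff] at hc ⊢
  exact hr c hc

lemma differentiableOn_slice {n : ℕ} {f : CSpace n → ℂ} {R : ℝ}
    (hf : DifferentiableOn ℂ f (Metric.ball 0 R)) (w : CSpace n) {r : ℝ}
    (hr : ∀ c : ℂ, ‖c‖ < r → ‖c • w‖ < R) :
    DifferentiableOn ℂ (fun c : ℂ => f (c • w)) (Metric.ball 0 r) := by
  simpa using differentiableOn_line hf 0 w (r := r) (by simpa using hr)

lemma hasSum_taylorTerm {n : ℕ} {f : CSpace n → ℂ} {R : ℝ}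
    (hf : DifferentiableOn ℂ f (Metric.ball 0 R)) {z : CSpace n} (hz : ‖z‖ < R) :
    HasSum (fun m => taylorTerm f m z) (f z) := by
  obtain ⟨r, hr1, hr⟩ : ∃ r : ℝ, 1 < r ∧ r * ‖z‖ < R := by
    rcases (norm_nonneg z).eq_or_lt with h | h
    · exact ⟨2, by norm_num, by rw [← h] at hz ⊢; simpa using hz⟩
    · obtain ⟨a, ha1, ha2⟩ := exists_between ((one_lt_div h).2 hz)
      exact ⟨a, ha1, (lt_div_iff₀ h).1 ha2⟩
  have hs := differentiableOn_slice hf z (r := r) fun c hc => by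
    rw [norm_smul]
    exact lt_of_le_of_lt (by gcongr) hr
  have h := Complex.hasSum_taylorSeries_on_ball hs (z := 1) (by simpa using hr1)
  simpa [taylorTerm] using h

lemma norm_taylorTerm_le {n : ℕ} {f : CSpace n → ℂ} {R ρ M : ℝ}
    (hf : DifferentiableOn ℂ f (Metric.ball 0 R)) (hρ : 0 < ρ) (hρR : ρ < R)
    (hM : ∀ z, ‖z‖ ≤ ρ → ‖f z‖ ≤ M) (m : ℕ) (x : CSphere n) :
    ‖taylorTerm f m x‖ ≤ M * (ρ⁻¹) ^ m := by
  have hs := differentiableOn_slice hf x (r := R) fun c hc => by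
    rwa [norm_smul, norm_sphere, mul_one]
  have hd : DiffContOnCl ℂ (fun c : ℂ => f (c • (x : CSpace n))) (Metric.ball 0 ρ) :=
    (hs.mono (Metric.closedBall_subset_ball hρR)).diffContOnCl_ball subset_rfl
  have h := Complex.norm_iteratedDeriv_le_of_forall_mem_sphere_norm_le m hρ hd (C := M)
    fun c hc => hM _ (by
      rw [norm_smul, norm_sphere, mul_one]
      exact (mem_sphere_zero_iff_norm.1 hc).le)
  have hm : (0 : ℝ) < m.factorial := by exact_mod_cast m.factorial_pos
  rw [taylorTerm, norm_mul, norm_inv, Complex.norm_natCast]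
  calc (m.factorial : ℝ)⁻¹ * _ ≤ (m.factorial : ℝ)⁻¹ * (m.factorial * M / ρ ^ m) := by gcongr
    _ = M * (ρ⁻¹) ^ m := by
      rw [inv_pow]
      field_simp

/-- Taylor's formula on a disc, with a remainder controlled by Cauchy's estimates. -/
lemma norm_sub_taylor_le {g : ℂ → ℂ} {δ M : ℝ} (hδ : 0 < δ)
    (hg : DiffContOnCl ℂ g (Metric.ball 0 δ)) (hM : ∀ μ, ‖μ‖ ≤ δ → ‖g μ‖ ≤ M) (m : ℕ) {μ : ℂ}
    (hμ : ‖μ‖ ≤ δ / 2) :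
    ‖(∑ j ∈ Finset.range m, (j.factorial : ℂ)⁻¹ * iteratedDeriv j g 0 * μ ^ j) - g μ‖ ≤
      2 * M * (‖μ‖ / δ) ^ m := by
  have hM0 : 0 ≤ M := (norm_nonneg _).trans (hM 0 (by simpa using hδ.le))
  have hr : ‖μ‖ / δ ≤ 1 / 2 := by
    rw [div_le_iff₀ hδ]
    linarith
  have hsum := Complex.hasSum_taylorSeries_on_ball hg.differentiableOn (z := μ) (by
    rw [mem_ball_zero_iff]
    linarith)
  have hbd : ∀ j : ℕ, ‖((j.factorial : ℂ)⁻¹ • (μ - 0) ^ j • iteratedDeriv j g 0)‖ ≤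
      M * (‖μ‖ / δ) ^ j := by
    intro j
    have h := Complex.norm_iteratedDeriv_le_of_forall_mem_sphere_norm_le j hδ hg (C := M)
      fun c hc => hM _ (mem_sphere_zero_iff_norm.1 hc).le
    have hm : (0 : ℝ) < j.factorial := by exact_mod_cast j.factorial_pos
    rw [sub_zero, norm_smul, norm_smul, norm_inv, Complex.norm_natCast, norm_pow]
    calc (j.factorial : ℝ)⁻¹ * (‖μ‖ ^ j * _)
        ≤ (j.factorial : ℝ)⁻¹ * (‖μ‖ ^ j * (j.factorial * M / δ ^ j)) := by gcongr
      _ = M * (‖μ‖ / δ) ^ j := by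
        rw [div_pow]
        field_simp
  have h := norm_sub_le_of_geometric_bound_of_hasSum (by linarith) hbd hsum m
  have he : ∀ j : ℕ, (j.factorial : ℂ)⁻¹ * iteratedDeriv j g 0 * μ ^ j =
      (j.factorial : ℂ)⁻¹ • (μ - 0) ^ j • iteratedDeriv j g 0 := by
    intro j
    rw [sub_zero, smul_eq_mul, smul_eq_mul]
    ring
  simp_rw [he]
  refine h.trans ?_
  rw [div_le_iff₀ (by linarith)]
  have : 0 ≤ M * (‖μ‖ / δ) ^ m := by positivity
  nlinarith

/-- The value at `t` of the Lagrange polynomial of the node `i` among the nodes `0, …, m`. -/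
noncomputable def lagr (m i : ℕ) (t : ℂ) : ℂ :=
  (Lagrange.basis (Finset.range (m + 1)) (fun j : ℕ => (j : ℂ)) i).eval t

lemma sum_lagr_mul (m : ℕ) (t : ℂ) (a : ℕ → ℂ) :
    ∑ i ∈ Finset.range (m + 1), lagr m i t * (∑ j ∈ Finset.range (m + 1), a j * (i : ℂ) ^ j) =
      ∑ j ∈ Finset.range (m + 1), a j * t ^ j := by
  set P : Polynomial ℂ := ∑ j ∈ Finset.range (m + 1), Polynomial.C (a j) * Polynomial.X ^ j
    with hP
  have heval : ∀ s : ℂ, P.eval s = ∑ j ∈ Finset.range (m + 1), a j * s ^ j := by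
    intro s
    simp [hP, Polynomial.eval_finsetSum]
  have hdeg : P.degree < (Finset.range (m + 1)).card := by
    rw [Finset.card_range]
    refine (Polynomial.degree_sum_le _ _).trans_lt ?_
    rw [Finset.sup_lt_iff (by exact_mod_cast WithBot.bot_lt_coe (m + 1))]
    intro j hj
    refine (Polynomial.degree_C_mul_X_pow_le _ _).trans_lt ?_
    exact_mod_cast Finset.mem_range.1 hj
  have h := Lagrange.eq_interpolate (s := Finset.range (m + 1)) (v := fun j : ℕ => (j : ℂ))
    (Nat.cast_injective.injOn) hdeg
  have h2 := congrArg (Polynomial.eval t) h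
  rw [heval, Lagrange.interpolate_apply, Polynomial.eval_finsetSum] at h2
  rw [h2]
  simp only [Polynomial.eval_mul, Polynomial.eval_C, heval]
  exact Finset.sum_congr rfl fun i _ => mul_comm _ _

/-- On every complex line the degree `m` Taylor term agrees with its Lagrange interpolation at the
nodes `0, …, m`: the interpolation error of `t ↦ f (c • (z + t • w))` is `O(c ^ (m + 1))`, so that
Cauchy's estimate on small circles kills its `m`-th Taylor coefficient in `c`. -/
lemma taylorTerm_line {n : ℕ} {f : CSpace n → ℂ} {R : ℝ} (hR : 0 < R)
    (hf : DifferentiableOn ℂ f (Metric.ball 0 R)) (m : ℕ) (z w : CSpace n) (t : ℂ) :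
    taylorTerm f m (z + t • w) =
      ∑ i ∈ Finset.range (m + 1), lagr m i t * taylorTerm f m (z + (i : ℂ) • w) := by
  set N : ℝ := ‖z‖ + ‖w‖ + 1 with hN
  have hN0 : 0 < N := by positivity
  set δ : ℝ := R / (2 * N) with hδ
  have hδ0 : 0 < δ := by positivity
  have hδN : δ * N = R / 2 := by rw [hδ]; field_simp
  obtain ⟨M, hM⟩ : ∃ M, ∀ y, ‖y‖ ≤ R / 2 → ‖f y‖ ≤ M := by
    obtain ⟨M, hM⟩ := (isCompact_closedBall (0 : CSpace n) (R / 2)).exists_bound_of_continuousOn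
      (hf.continuousOn.mono (Metric.closedBall_subset_ball (by linarith)))
    exact ⟨M, fun y hy => hM y (by simpa using hy)⟩
  have hnorm : ∀ c μ : ℂ, ‖c‖ ≤ δ → ‖μ‖ ≤ δ → ‖c • z + μ • w‖ ≤ R / 2 := by
    intro c μ hc hμ
    calc ‖c • z + μ • w‖ ≤ ‖c‖ * ‖z‖ + ‖μ‖ * ‖w‖ := by
          refine (norm_add_le _ _).trans ?_
          rw [norm_smul, norm_smul]
      _ ≤ δ * ‖z‖ + δ * ‖w‖ := by gcongr
      _ ≤ δ * N := by rw [hN]; nlinarith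
      _ = R / 2 := hδN
  set B : ℝ := ‖t‖ + m + 1 with hB
  have hB0 : 0 < B := by positivity
  set ε₀ : ℝ := δ / (2 * B) with hε₀
  have hε0 : 0 < ε₀ := by positivity
  have hεB : ε₀ * B = δ / 2 := by rw [hε₀]; field_simp
  have hB1 : 1 ≤ B := by
    have : (0 : ℝ) ≤ m := m.cast_nonneg
    have := norm_nonneg t
    linarith
  have hεδ : ε₀ ≤ δ / 2 := by rw [← hεB]; nlinarith
  have hM0 : 0 ≤ M := (norm_nonneg _).trans (hM 0 (by simpa using by linarith))
  set Φ : ℂ → ℂ := fun c => f (c • (z + t • w)) -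
    ∑ i ∈ Finset.range (m + 1), lagr m i t * f (c • (z + (i : ℂ) • w)) with hΦ
  set A : ℝ := 1 + ∑ i ∈ Finset.range (m + 1), ‖lagr m i t‖ with hA
  -- the Taylor polynomial in `μ` of `f (c • z + μ • w)`
  have hmain : ∀ c : ℂ, ‖c‖ ≤ ε₀ → ‖Φ c‖ ≤ A * (2 * M * (‖c‖ * B / δ) ^ (m + 1)) := by
    intro c hc
    have hcδ : ‖c‖ ≤ δ := by linarith
    set g : ℂ → ℂ := fun μ => f (c • z + μ • w) with hg
    have hgd : DiffContOnCl ℂ g (Metric.ball 0 δ) := by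
      refine DifferentiableOn.diffContOnCl_ball (U := Metric.closedBall 0 δ) ?_ subset_rfl
      refine hf.comp (by fun_prop) fun μ hμ => ?_
      rw [mem_closedBall_zero_iff] at hμ
      rw [mem_ball_zero_iff]
      linarith [hnorm c μ hcδ hμ]
    set a : ℕ → ℂ := fun j => (j.factorial : ℂ)⁻¹ * iteratedDeriv j g 0 * c ^ j with ha
    have hrem : ∀ s : ℂ, ‖s‖ ≤ B →
        ‖(∑ j ∈ Finset.range (m + 1), a j * s ^ j) - f (c • (z + s • w))‖ ≤
          2 * M * (‖c‖ * B / δ) ^ (m + 1) := by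
      intro s hs
      have hcs : ‖c * s‖ ≤ ‖c‖ * B := by rw [norm_mul]; gcongr
      have h := norm_sub_taylor_le hδ0 hgd (fun μ hμ => hM _ (hnorm c μ hcδ hμ)) (m + 1)
        (μ := c * s) (by
          refine hcs.trans ?_
          rw [← hεB]
          gcongr)
      have e1 : g (c * s) = f (c • (z + s • w)) := by
        simp only [hg, smul_add, smul_smul]
      have e2 : ∀ j, (j.factorial : ℂ)⁻¹ * iteratedDeriv j g 0 * (c * s) ^ j = a j * s ^ j := by
        intro j
        simp only [ha, mul_pow]
        ring
      simp_rw [e1, e2] at h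
      refine h.trans ?_
      gcongr
    have hE : Φ c = -((∑ j ∈ Finset.range (m + 1), a j * t ^ j) - f (c • (z + t • w))) +
        ∑ i ∈ Finset.range (m + 1), lagr m i t *
          ((∑ j ∈ Finset.range (m + 1), a j * (i : ℂ) ^ j) - f (c • (z + (i : ℂ) • w))) := by
      simp only [mul_sub, Finset.sum_sub_distrib]
      rw [sum_lagr_mul]
      simp only [hΦ]
      ring
    rw [hE]
    refine (norm_add_le _ _).trans ?_
    rw [norm_neg, hA, add_mul, one_mul]
    refine add_le_add (hrem t (by
      have : (0 : ℝ) ≤ m := m.cast_nonneg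
      linarith)) ?_
    rw [Finset.sum_mul]
    refine (norm_sum_le _ _).trans (Finset.sum_le_sum fun i hi => ?_)
    rw [norm_mul]
    refine mul_le_mul_of_nonneg_left (hrem i ?_) (norm_nonneg _)
    rw [Complex.norm_natCast]
    have : (i : ℝ) ≤ m := by exact_mod_cast Nat.lt_succ_iff.1 (Finset.mem_range.1 hi)
    linarith [norm_nonneg t]
  have hsl : ∀ s : ℂ, ‖s‖ ≤ B →
      DifferentiableOn ℂ (fun c : ℂ => f (c • (z + s • w))) (Metric.closedBall 0 ε₀) := by
    intro s hs
    refine hf.comp (by fun_prop) fun c hc => ?_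
    rw [mem_closedBall_zero_iff] at hc
    rw [mem_ball_zero_iff, smul_add, smul_smul]
    have : ‖c * s‖ ≤ δ := by
      rw [norm_mul]
      calc ‖c‖ * ‖s‖ ≤ ε₀ * B := by gcongr
        _ ≤ δ := by rw [hεB]; linarith
    linarith [hnorm c (c * s) (by linarith) this]
  have hi_le : ∀ i ∈ Finset.range (m + 1), ‖(i : ℂ)‖ ≤ B := by
    intro i hi
    rw [Complex.norm_natCast]
    have : (i : ℝ) ≤ m := by exact_mod_cast Nat.lt_succ_iff.1 (Finset.mem_range.1 hi)
    linarith [norm_nonneg t]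
  have ht_le : ‖t‖ ≤ B := by
    have : (0 : ℝ) ≤ m := m.cast_nonneg
    linarith
  have hΦd : DifferentiableOn ℂ Φ (Metric.closedBall 0 ε₀) :=
    (hsl t ht_le).sub (DifferentiableOn.fun_sum fun i hi => (hsl i (hi_le i hi)).const_mul _)
  -- Cauchy's estimate on circles of radius `ε` shows that the `m`-th derivative is `O(ε)`
  have hzero : iteratedDeriv m Φ 0 = 0 := by
    rw [← norm_le_zero_iff]
    have hcau : ∀ ε : ℝ, 0 < ε → ε ≤ ε₀ → ‖iteratedDeriv m Φ 0‖ ≤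
        (m.factorial * (A * (2 * M * (B / δ) ^ (m + 1)))) * ε := by
      intro ε hε hεε
      have h := Complex.norm_iteratedDeriv_le_of_forall_mem_sphere_norm_le m hε
        ((hΦd.mono (Metric.closedBall_subset_closedBall hεε)).diffContOnCl_ball subset_rfl)
        (C := A * (2 * M * (ε * B / δ) ^ (m + 1))) (fun c hc => by
          have hc' := mem_sphere_zero_iff_norm.1 hc
          rw [← hc']
          exact hmain c (by rw [hc']; exact hεε))
      refine h.trans (le_of_eq ?_)
      rw [mul_div_assoc ε, mul_pow, pow_succ ε]
      field_simp
    have ht : Tendsto (fun ε : ℝ => (m.factorial * (A * (2 * M * (B / δ) ^ (m + 1)))) * ε)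
        (𝓝[>] 0) (𝓝 0) := by
      have : Tendsto (fun ε : ℝ => (m.factorial * (A * (2 * M * (B / δ) ^ (m + 1)))) * ε)
        (𝓝 0) (𝓝 ((m.factorial * (A * (2 * M * (B / δ) ^ (m + 1)))) * 0)) :=
        tendsto_id.const_mul _
      rw [mul_zero] at this
      exact this.mono_left nhdsWithin_le_nhds
    refine ge_of_tendsto ht ?_
    filter_upwards [Ioc_mem_nhdsGT hε0] with ε hε
    exact hcau ε hε.1 hε.2
  have hcd : ∀ s : ℂ, ‖s‖ ≤ B → ContDiffAt ℂ m (fun c : ℂ => f (c • (z + s • w))) 0 := by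
    intro s hs
    exact ((hsl s hs).analyticAt (Metric.closedBall_mem_nhds 0 hε0)).contDiffAt
  have hexp : iteratedDeriv m Φ 0 = iteratedDeriv m (fun c : ℂ => f (c • (z + t • w))) 0 -
      ∑ i ∈ Finset.range (m + 1), lagr m i t *
        iteratedDeriv m (fun c : ℂ => f (c • (z + (i : ℂ) • w))) 0 := by
    have hci : ∀ i ∈ Finset.range (m + 1), ContDiffAt ℂ m
        (fun c : ℂ => lagr m i t * f (c • (z + (i : ℂ) • w))) 0 :=
      fun i hi => contDiffAt_const.mul (hcd i (hi_le i hi))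
    rw [hΦ, iteratedDeriv_fun_sub (hcd t ht_le) (ContDiffAt.sum hci),
      iteratedDeriv_fun_sum hci]
    simp_rw [iteratedDeriv_const_mul_field]
  rw [hexp, sub_eq_zero] at hzero
  rw [taylorTerm, hzero, Finset.mul_sum]
  refine Finset.sum_congr rfl fun i _ => ?_
  rw [taylorTerm]
  ring

/-- A function that agrees with its Lagrange interpolation at `0, …, m` in each coordinate is a
polynomial. -/
lemma exists_mvPolynomial_of_lagr (m : ℕ) : ∀ (n : ℕ) (g : (Fin n → ℂ) → ℂ),
    (∀ (z : Fin n → ℂ) (j : Fin n) (t : ℂ), g (Function.update z j t) =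
      ∑ i ∈ Finset.range (m + 1), lagr m i t * g (Function.update z j i)) →
    ∃ P : MvPolynomial (Fin n) ℂ, ∀ z, g z = MvPolynomial.eval z P := by
  intro n
  induction n with
  | zero =>
    intro g _
    exact ⟨MvPolynomial.C (g 0), fun z => by
      rw [MvPolynomial.eval_C, Subsingleton.elim z 0]⟩
  | succ n ih =>
    intro g hg
    have h1 : ∀ i : ℕ, ∃ P : MvPolynomial (Fin n) ℂ, ∀ z : Fin n → ℂ,
        g (Fin.cons (i : ℂ) z) = MvPolynomial.eval z P := by
      intro i
      refine ih (fun z => g (Fin.cons (i : ℂ) z)) fun z j t => ?_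
      have := hg (Fin.cons (i : ℂ) z) j.succ t
      simpa only [← Fin.cons_update] using this
    choose P hP using h1
    refine ⟨∑ i ∈ Finset.range (m + 1), MvPolynomial.rename Fin.succ (P i) *
      Polynomial.aeval (MvPolynomial.X 0)
        (Lagrange.basis (Finset.range (m + 1)) (fun j : ℕ => (j : ℂ)) i), fun z => ?_⟩
    have h2 := hg z 0 (z 0)
    rw [Function.update_eq_self] at h2
    rw [h2, map_sum]
    refine Finset.sum_congr rfl fun i _ => ?_
    have h3 : Function.update z 0 (i : ℂ) = Fin.cons (i : ℂ) (Fin.tail z) := by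
      rw [← Fin.cons_self_tail z, Fin.update_cons_zero, Fin.tail_cons]
    have h4 : MvPolynomial.eval z (Polynomial.aeval (MvPolynomial.X 0)
        (Lagrange.basis (Finset.range (m + 1)) (fun j : ℕ => (j : ℂ)) i)) = lagr m i (z 0) := by
      rw [← MvPolynomial.coe_aeval_eq_eval, RingHom.coe_coe, ← Polynomial.aeval_algHom_apply,
        MvPolynomial.aeval_X, lagr, Polynomial.coe_aeval_eq_eval]
    rw [h3, hP, map_mul, MvPolynomial.eval_rename, h4, mul_comm]
    rfl

/-- The Taylor terms are homogeneous polynomials. -/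
lemma exists_taylorTerm_eq {n : ℕ} {f : CSpace n → ℂ} {R : ℝ} (hR : 0 < R)
    (hf : DifferentiableOn ℂ f (Metric.ball 0 R)) (m : ℕ) :
    ∃ c : (Fin n → ℕ) → ℂ, ∀ z, taylorTerm f m z =
      ∑ k ∈ Finset.univ.piAntidiag m, c k * monom k z := by
  obtain ⟨P, hP⟩ := exists_mvPolynomial_of_lagr m n (fun z => taylorTerm f m (WithLp.toLp 2 z)) (by
    intro z j t
    have h1 : ∀ s : ℂ, (WithLp.toLp 2 (Function.update z j s) : CSpace n) =
        WithLp.toLp 2 (Function.update z j 0) + s • EuclideanSpace.single j (1 : ℂ) := by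
      intro s
      ext i
      by_cases h : i = j
      · subst h
        simp
      · simp [h]
    simp only
    rw [h1 t, taylorTerm_line hR hf]
    exact Finset.sum_congr rfl fun i _ => by rw [h1 i])
  have hP' : ∀ z : CSpace n, taylorTerm f m z = MvPolynomial.eval (fun j => z j) P := fun z => by
    rw [← hP]
  have hev : ∀ z : CSpace n, MvPolynomial.eval (fun j => z j) P =
      ∑ d ∈ P.support, P.coeff d * monom d z := by
    intro z
    rw [MvPolynomial.eval_eq']
    rfl
  -- compare the coefficients of `X ^ m` in the scaling identity
  have hhom : ∀ z : CSpace n, taylorTerm f m z =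
      ∑ d ∈ P.support.filter (fun d : Fin n →₀ ℕ => len (⇑d) = m), P.coeff d * monom d z := by
    intro z
    have hpoly : (∑ d ∈ P.support, Polynomial.C (P.coeff d * monom d z) *
        Polynomial.X ^ (len d)) = Polynomial.C (taylorTerm f m z) * Polynomial.X ^ m := by
      refine Polynomial.funext fun s => ?_
      have h := taylorTerm_smul f m s z
      rw [hP' (s • z), hev] at h
      simp only [Polynomial.eval_finsetSum, Polynomial.eval_mul, Polynomial.eval_C,
        Polynomial.eval_pow, Polynomial.eval_X]
      rw [mul_comm _ (s ^ m), ← h]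
      refine Finset.sum_congr rfl fun d _ => ?_
      rw [monom_smul]
      ring
    have h := congrArg (fun Q => Polynomial.coeff Q m) hpoly
    simp only [Polynomial.finsetSum_coeff, Polynomial.coeff_C_mul, Polynomial.coeff_X_pow,
      if_true, mul_one] at h
    rw [← h, Finset.sum_filter]
    refine Finset.sum_congr rfl fun d _ => ?_
    by_cases hd : len d = m
    · simp [hd]
    · simp [hd, Ne.symm hd]
  refine ⟨fun k => P.coeff (Finsupp.equivFunOnFinite.symm k), fun z => ?_⟩
  rw [hhom]
  refine Finset.sum_bij_ne_zero (fun d _ _ => (d : Fin n → ℕ)) ?_ ?_ ?_ ?_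
  · intro d hd _
    exact mem_piAntidiag_univ.2 (Finset.mem_filter.1 hd).2
  · intro d _ _ d' _ _ h
    exact DFunLike.coe_injective h
  · intro k hk hne
    refine ⟨Finsupp.equivFunOnFinite.symm k, ?_, ?_, ?_⟩
    · rw [Finset.mem_filter, MvPolynomial.mem_support_iff]
      exact ⟨left_ne_zero_of_mul hne, by simpa using mem_piAntidiag_univ.1 hk⟩
    · simpa using hne
    · simp
  · intro d _ _
    simp

/-- The integrals over spheres of a holomorphic function against the conjugate monomials are given
by coefficients that determine the function. -/
lemma exists_coeff {n : ℕ} (hn : 0 < n) {f : CSpace n → ℂ} {R : ℝ} (hR : 0 < R)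
    (hf : DifferentiableOn ℂ f (Metric.ball 0 R)) :
    ∃ c : (Fin n → ℕ) → ℂ,
      (∀ (r : ℝ) (k : Fin n → ℕ), 0 < r → r < R →
        ∫ x : CSphere n, f (r • (x : CSpace n)) * conj (monom k x) ∂(sphereMeasure n) =
          c k * ((mfact k / poch n (len k) : ℝ) : ℂ) * (r : ℂ) ^ len k) ∧
      ((∀ k, c k = 0) → ∀ z, ‖z‖ < R → f z = 0) := by
  choose c hc using fun m => exists_taylorTerm_eq hR hf m
  refine ⟨fun k => c (len k) k, ?_, ?_⟩
  · intro r k hr hrR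
    obtain ⟨ρ, hrρ, hρR⟩ := exists_between hrR
    have hρ : 0 < ρ := hr.trans hrρ
    obtain ⟨M, hM⟩ := (isCompact_closedBall (0 : CSpace n) ρ).exists_bound_of_continuousOn
      (hf.continuousOn.mono (Metric.closedBall_subset_ball hρR))
    have hbd := norm_taylorTerm_le hf hρ hρR fun z hz => hM z (by simpa using hz)
    have hcont : ∀ m, Continuous (taylorTerm f m) := fun m => by
      have : taylorTerm f m = fun z => ∑ k ∈ Finset.univ.piAntidiag m, c m k * monom k z :=
        funext (hc m)
      rw [this]
      exact continuous_finsetSum _ fun k _ => continuous_const.mul (continuous_monom k)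
    set F : ℕ → CSphere n → ℂ := fun m x =>
      (r : ℂ) ^ m * taylorTerm f m x * conj (monom k x) with hF
    have hFc : ∀ m, Continuous (F m) := fun m => by
      have h1 := (hcont m).comp (continuous_subtype_val (p := (· ∈ Metric.sphere (0 : CSpace n) 1)))
      have h2 := continuous_monom_sphere k
      exact (continuous_const.mul h1).mul (Complex.continuous_conj.comp h2)
    have hFsum : ∀ x : CSphere n, HasSum (fun m => F m x)
        (f (r • (x : CSpace n)) * conj (monom k x)) := by
      intro x
      have hx : ‖r • (x : CSpace n)‖ < R := by
        rw [norm_smul, norm_sphere, mul_one, Real.norm_of_nonneg hr.le]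
        exact hrR
      refine HasSum.mul_right _ ?_
      have h := hasSum_taylorTerm hf hx
      have e : ∀ m, taylorTerm f m (r • (x : CSpace n)) = (r : ℂ) ^ m * taylorTerm f m x :=
        fun m => by rw [← taylorTerm_smul]; rfl
      simpa only [e] using h
    have hM0 : 0 ≤ M := (norm_nonneg _).trans (hM 0 (by simpa using hρ.le))
    obtain ⟨K, hK⟩ := isCompact_univ.exists_bound_of_continuousOn
      (continuous_monom_sphere k).continuousOn
    have hFb : ∀ m, ∫ x, ‖F m x‖ ∂(sphereMeasure n) ≤
        (M * K * (sphereMeasure n).real Set.univ) * (r / ρ) ^ m := by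
      intro m
      have : ∀ x, ‖F m x‖ ≤ M * K * (r / ρ) ^ m := by
        intro x
        simp only [hF, norm_mul, norm_pow, Complex.norm_real, Real.norm_of_nonneg hr.le,
          RCLike.norm_conj]
        have h1 := hbd m x
        have h2 := hK x (Set.mem_univ _)
        calc r ^ m * ‖taylorTerm f m x‖ * ‖monom k (x : CSpace n)‖
            ≤ r ^ m * (M * (ρ⁻¹) ^ m) * K := by gcongr
          _ = _ := by rw [div_eq_mul_inv, mul_pow]; ring
      calc _ ≤ ∫ _x, M * K * (r / ρ) ^ m ∂(sphereMeasure n) :=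
            integral_mono (integrable_sphere (hFc m)).norm (integrable_const _) this
        _ = _ := by rw [integral_const, smul_eq_mul]; ring
    have hsumm : Summable (fun m => ∫ x, ‖F m x‖ ∂(sphereMeasure n)) :=
      Summable.of_nonneg_of_le (fun m => integral_nonneg fun x => norm_nonneg _) hFb
        ((summable_geometric_of_lt_one (by positivity) ((div_lt_one hρ).2 hrρ)).mul_left _)
    have h := hasSum_integral_of_summable_integral_norm (fun m => integrable_sphere (hFc m)) hsumm
    simp_rw [(hFsum _).tsum_eq] at h
    refine h.unique ?_
    have hterm : ∀ m, ∫ x, F m x ∂(sphereMeasure n) = if m = len k then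
        c (len k) k * ((mfact k / poch n (len k) : ℝ) : ℂ) * (r : ℂ) ^ len k else 0 := by
      intro m
      have e : ∀ x, F m x = ∑ κ ∈ Finset.univ.piAntidiag m, ((r : ℂ) ^ m * c m κ) *
          (monom κ x * conj (monom k (x : CSpace n))) := by
        intro x
        simp only [hF, hc]
        rw [Finset.mul_sum, Finset.sum_mul]
        exact Finset.sum_congr rfl fun κ _ => by ring
      simp_rw [e]
      rw [integral_finsetSum _ fun κ _ => integrable_sphere (by
        have := continuous_monom_sphere k
        have := continuous_monom_sphere κ
        fun_prop)]
      simp_rw [integral_const_mul, integral_sphere_monom hn, mul_ite, mul_zero]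
      rw [Finset.sum_ite_eq']
      simp only [mem_piAntidiag_univ, eq_comm (a := m)]
      split_ifs with hm
      · rw [hm]
        ring
      · rfl
    simp_rw [hterm]
    exact hasSum_ite_eq _ _
  · intro h0 z hz
    refine (hasSum_taylorTerm hf hz).unique ?_
    have : ∀ m, taylorTerm f m z = 0 := by
      intro m
      rw [hc]
      refine Finset.sum_eq_zero fun k hk => ?_
      have := h0 k
      simp only [mem_piAntidiag_univ.1 hk] at this
      rw [this, zero_mul]
    simp_rw [this]
    exact hasSum_zero

/-! ### Pairings on the sphere and the orthonormal system `φ_k` -/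

/-- The functional `Ψ ↦ ∫ Ψ c` on `L²` of the sphere, for a continuous function `c`. -/
noncomputable def pairing {n : ℕ} (c : C(CSphere n, ℂ)) : Lp ℂ 2 (sphereMeasure n) →L[ℂ] ℂ :=
  innerSL ℂ (ContinuousMap.toLp (E := ℂ) 2 (sphereMeasure n) ℂ (star c))

lemma pairing_apply {n : ℕ} (c : C(CSphere n, ℂ)) (Ψ : Lp ℂ 2 (sphereMeasure n)) :
    pairing c Ψ = ∫ x, Ψ x * c x ∂(sphereMeasure n) := by
  rw [pairing, innerSL_apply_apply, L2.inner_def]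
  refine integral_congr_ae ?_
  filter_upwards [ContinuousMap.coeFn_toLp (E := ℂ) (p := 2) (𝕜 := ℂ) (sphereMeasure n) (star c)]
    with x hx
  rw [hx, RCLike.inner_apply]
  simp

lemma integrable_sphere_Lp {n : ℕ} (Ψ : Lp ℂ 2 (sphereMeasure n)) :
    Integrable Ψ (sphereMeasure n) :=
  (Lp.memLp Ψ).integrable (by norm_num)

lemma integrable_mul_sphere {n : ℕ} {Ψ c : CSphere n → ℂ} (hΨ : Integrable Ψ (sphereMeasure n))
    (hc : Continuous c) : Integrable (fun x => Ψ x * c x) (sphereMeasure n) := by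
  obtain ⟨C, hC⟩ := isCompact_univ.exists_bound_of_continuousOn hc.continuousOn
  exact hΨ.mul_bdd (c := C) hc.aestronglyMeasurable
    (Eventually.of_forall fun x => hC x (Set.mem_univ x))

lemma continuous_phi {n : ℕ} (k : Fin n → ℕ) : Continuous (phi k : CSphere n → ℂ) :=
  continuous_const.mul (continuous_monom_sphere k)

/-- `φ_k` as an element of `L²` of the sphere. -/
noncomputable def phiLp {n : ℕ} (k : Fin n → ℕ) : Lp ℂ 2 (sphereMeasure n) :=
  ContinuousMap.toLp (E := ℂ) 2 (sphereMeasure n) ℂ ⟨phi k, continuous_phi k⟩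

lemma coeFn_phiLp {n : ℕ} (k : Fin n → ℕ) : phiLp k =ᵐ[sphereMeasure n] phi k :=
  ContinuousMap.coeFn_toLp (E := ℂ) (p := 2) (𝕜 := ℂ) (sphereMeasure n) ⟨phi k, continuous_phi k⟩

lemma pairing_phiLp {n : ℕ} (c : C(CSphere n, ℂ)) (k : Fin n → ℕ) :
    pairing c (phiLp k) = (Real.sqrt (poch n (len k) / mfact k) : ℂ) *
      ∫ x : CSphere n, monom k x * c x ∂(sphereMeasure n) := by
  rw [pairing_apply, ← integral_const_mul]
  refine integral_congr_ae ?_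
  filter_upwards [coeFn_phiLp k] with x hx
  rw [hx, phi]
  ring

lemma inner_phiLp {n : ℕ} (k : Fin n → ℕ) (Ψ : Lp ℂ 2 (sphereMeasure n)) :
    inner ℂ (phiLp k) Ψ = (Real.sqrt (poch n (len k) / mfact k) : ℂ) *
      ∫ x, Ψ x * conj (monom k (x : CSpace n)) ∂(sphereMeasure n) := by
  rw [L2.inner_def, ← integral_const_mul]
  refine integral_congr_ae ?_
  filter_upwards [coeFn_phiLp k] with x hx
  rw [hx, RCLike.inner_apply, phi]
  simp only [map_mul, Complex.conj_ofReal]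
  ring

lemma poch_div_mfact_pos {n : ℕ} (hn : 0 < n) (k : Fin n → ℕ) :
    0 < poch n (len k) / mfact k :=
  div_pos (poch_pos (by exact_mod_cast hn) _) (by exact_mod_cast mfact_pos k)

lemma orthonormal_phiLp {n : ℕ} (hn : 0 < n) :
    Orthonormal ℂ (phiLp : (Fin n → ℕ) → Lp ℂ 2 (sphereMeasure n)) := by
  rw [orthonormal_iff_ite]
  intro k l
  have h : ∫ x, phiLp l x * conj (monom k (x : CSpace n)) ∂(sphereMeasure n) =
      (Real.sqrt (poch n (len l) / mfact l) : ℂ) *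
      ∫ x : CSphere n, monom l x * conj (monom k (x : CSpace n)) ∂(sphereMeasure n) := by
    rw [← integral_const_mul]
    refine integral_congr_ae ?_
    filter_upwards [coeFn_phiLp l] with x hx
    rw [hx, phi]
    ring
  rw [inner_phiLp, h, integral_sphere_monom hn]
  by_cases hkl : k = l
  · subst hkl
    rw [if_pos rfl, if_pos rfl, ← mul_assoc, ← Complex.ofReal_mul,
      Real.mul_self_sqrt (poch_div_mfact_pos hn k).le, ← Complex.ofReal_mul]
    have h1 : (mfact k : ℝ) ≠ 0 := by exact_mod_cast (mfact_pos k).ne'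
    have h2 := (poch_pos (b := n) (by exact_mod_cast hn) (len k)).ne'
    rw [div_mul_div_cancel₀ h1, div_self h2, Complex.ofReal_one]
  · rw [if_neg (Ne.symm hkl), if_neg hkl, mul_zero, mul_zero]

/-! ### Kernels that are power series in `z · x` -/

lemma norm_cdot_sphere_le {n : ℕ} (z : CSpace n) (x : CSphere n) : ‖cdot z x‖ ≤ ‖z‖ := by
  have := norm_cdot_le z x
  rwa [norm_sphere, mul_one] at this

lemma summable_kernel {n : ℕ} {g : ℕ → ℂ} {z : CSpace n} (hg : Summable fun l => ‖g l‖ * ‖z‖ ^ l)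
    (x : CSphere n) : Summable (fun l => g l * cdot z x ^ l) := by
  refine Summable.of_norm_bounded hg fun l => ?_
  rw [norm_mul, norm_pow]
  have := norm_cdot_sphere_le z x
  gcongr

/-- The kernel `∑_l g_l (z · x) ^ l` as a continuous function of `x`. -/
noncomputable def kernelMap {n : ℕ} (g : ℕ → ℂ) (z : CSpace n)
    (hg : Summable fun l => ‖g l‖ * ‖z‖ ^ l) : C(CSphere n, ℂ) where
  toFun x := ∑' l, g l * cdot z (x : CSpace n) ^ l
  continuous_toFun := by
    refine continuous_tsum (fun l => continuous_const.mul ((continuous_cdot_sphere z).pow l)) hg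
      fun l x => ?_
    rw [norm_mul, norm_pow]
    have := norm_cdot_sphere_le z x
    gcongr

lemma integral_monom_mul_kernelMap {n : ℕ} (hn : 0 < n) {g : ℕ → ℂ} {z : CSpace n}
    (hg : Summable fun l => ‖g l‖ * ‖z‖ ^ l) (k : Fin n → ℕ) :
    ∫ x : CSphere n, monom k x * kernelMap g z hg x ∂(sphereMeasure n) =
      g (len k) * (((len k).factorial / poch n (len k) : ℝ) : ℂ) * monom k z := by
  obtain ⟨K, hK⟩ := isCompact_univ.exists_bound_of_continuousOn
    (continuous_monom_sphere k).continuousOn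
  set F : ℕ → CSphere n → ℂ := fun l x => g l * (monom k x * cdot z x ^ l) with hF
  have hFc : ∀ l, Continuous (F l) := fun l =>
    continuous_const.mul ((continuous_monom_sphere k).mul ((continuous_cdot_sphere z).pow l))
  have hFb : ∀ l, ∫ x, ‖F l x‖ ∂(sphereMeasure n) ≤
      (K * (sphereMeasure n).real Set.univ) * (‖g l‖ * ‖z‖ ^ l) := by
    intro l
    have : ∀ x, ‖F l x‖ ≤ K * (‖g l‖ * ‖z‖ ^ l) := by
      intro x
      simp only [hF, norm_mul, norm_pow]
      have h1 := norm_cdot_sphere_le z x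
      have h2 := hK x (Set.mem_univ _)
      calc ‖g l‖ * (‖monom k (x : CSpace n)‖ * ‖cdot z x‖ ^ l) ≤ ‖g l‖ * (K * ‖z‖ ^ l) := by
            have : 0 ≤ K := (norm_nonneg _).trans h2
            gcongr
        _ = _ := by ring
    calc _ ≤ ∫ _x, K * (‖g l‖ * ‖z‖ ^ l) ∂(sphereMeasure n) :=
          integral_mono (integrable_sphere (hFc l)).norm (integrable_const _) this
      _ = _ := by rw [integral_const, smul_eq_mul]; ring
  have hs := Summable.of_nonneg_of_le (fun l => integral_nonneg fun x => norm_nonneg (F l x)) hFb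
    (hg.mul_left _)
  have h := hasSum_integral_of_summable_integral_norm (fun l => integrable_sphere (hFc l)) hs
  have h1 : ∀ x, ∑' l, F l x = monom k x * kernelMap g z hg x := by
    intro x
    rw [kernelMap, ContinuousMap.coe_mk, ← tsum_mul_left]
    refine tsum_congr fun l => ?_
    simp only [hF]
    ring
  simp_rw [h1] at h
  refine h.unique ?_
  have h2 : ∀ l, ∫ x, F l x ∂(sphereMeasure n) = if l = len k then
      g (len k) * (((len k).factorial / poch n (len k) : ℝ) : ℂ) * monom k z else 0 := by
    intro l
    simp only [hF]
    rw [integral_const_mul, integral_monom_mul_cdot_pow hn]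
    simp only [eq_comm (a := l)]
    split_ifs with hl
    · rw [← hl, mul_assoc]
    · rw [mul_zero]
  simp_rw [h2]
  exact hasSum_ite_eq _ _

/-- A kernel that is a power series in `z · x` maps integrable functions on the sphere to
holomorphic functions. -/
lemma differentiableOn_integral_kernel {n : ℕ} {g : ℕ → ℂ} {R : ℝ}
    (hg : ∀ r, 0 ≤ r → r < R → Summable fun l => ‖g l‖ * r ^ l) {Ψ : CSphere n → ℂ}
    (hΨ : Integrable Ψ (sphereMeasure n)) :
    DifferentiableOn ℂ (fun z : CSpace n =>
      ∫ x : CSphere n, Ψ x * ∑' l, g l * cdot z x ^ l ∂(sphereMeasure n)) (Metric.ball 0 R) := by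
  set h : ℂ → ℂ := fun w => ∑' l, g l * w ^ l with hh
  have hd : DifferentiableOn ℂ h (Metric.ball 0 R) := by
    intro w hw
    rw [mem_ball_zero_iff] at hw
    obtain ⟨r, hwr, hrR⟩ := exists_between hw
    have hr0 : 0 ≤ r := (norm_nonneg w).trans hwr.le
    have := Complex.differentiableOn_tsum_of_summable_norm (hg r hr0 hrR)
      (F := fun l w => g l * w ^ l) (fun l => by fun_prop) (Metric.isOpen_ball (x := 0) (ε := r))
      (fun l w hw => by
        rw [mem_ball_zero_iff] at hw
        rw [norm_mul, norm_pow]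
        gcongr)
    exact (this.differentiableAt (Metric.isOpen_ball.mem_nhds
      (by rwa [mem_ball_zero_iff]))).differentiableWithinAt
  have hd' : ContinuousOn (deriv h) (Metric.ball 0 R) :=
    (hd.deriv Metric.isOpen_ball).continuousOn
  intro z₀ hz₀
  rw [mem_ball_zero_iff] at hz₀
  obtain ⟨r, hzr, hrR⟩ := exists_between hz₀
  obtain ⟨M, hM⟩ := (isCompact_closedBall (0 : ℂ) r).exists_bound_of_continuousOn
    (hd'.mono (Metric.closedBall_subset_ball hrR))
  have hmem : ∀ z : CSpace n, ‖z‖ < r → ∀ x : CSphere n, cdot z x ∈ Metric.ball (0 : ℂ) R := by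
    intro z hz x
    rw [mem_ball_zero_iff]
    exact (norm_cdot_sphere_le z x).trans_lt (hz.trans hrR)
  have hcont : ∀ z : CSpace n, ‖z‖ < r → ∀ {q : ℂ → ℂ}, ContinuousOn q (Metric.ball 0 R) →
      Continuous fun x : CSphere n => q (cdot z x) := fun z hz q hq =>
    hq.comp_continuous (continuous_cdot_sphere z) fun x => hmem z hz x
  have hder : ∀ z : CSpace n, ‖z‖ < r → ∀ x : CSphere n,
      HasFDerivAt (fun z : CSpace n => Ψ x * h (cdot z x))
        ((Ψ x * deriv h (cdot z x)) • innerSL ℂ (x : CSpace n)) z := by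
    intro z hz x
    have h1 : HasDerivAt h (deriv h (cdot z x)) (cdot z x) :=
      (hd.differentiableAt (Metric.isOpen_ball.mem_nhds (hmem z hz x))).hasDerivAt
    have h2 : HasFDerivAt (fun z : CSpace n => cdot z x) (innerSL ℂ (x : CSpace n)) z := by
      have := (innerSL ℂ (x : CSpace n)).hasFDerivAt (x := z)
      refine this.congr_of_eventuallyEq (Eventually.of_forall fun w => ?_)
      exact cdot_eq_inner w x
    have h3 := (h1.comp_hasFDerivAt z h2).const_mul (Ψ x)
    rwa [smul_smul] at h3
  have hz₀r : Metric.ball (0 : CSpace n) r ∈ 𝓝 z₀ :=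
    Metric.isOpen_ball.mem_nhds (by rwa [mem_ball_zero_iff])
  refine HasFDerivAt.differentiableAt (f' := ∫ x : CSphere n,
    ((Ψ x * deriv h (cdot z₀ x)) • innerSL ℂ (x : CSpace n)) ∂(sphereMeasure n)) ?_
    |>.differentiableWithinAt
  refine hasFDerivAt_integral_of_dominated_of_fderiv_le (s := Metric.ball 0 r)
    (F := fun (z : CSpace n) (x : CSphere n) => Ψ x * h (cdot z x))
    (F' := fun (z : CSpace n) (x : CSphere n) =>
      (Ψ x * deriv h (cdot z x)) • innerSL ℂ (x : CSpace n)) (bound := fun x => ‖Ψ x‖ * M)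
    hz₀r ?_ ?_ ?_ ?_ ?_ ?_
  · filter_upwards [hz₀r] with z hz
    exact hΨ.aestronglyMeasurable.mul
      (hcont z (by simpa using hz) hd.continuousOn).aestronglyMeasurable
  · exact integrable_mul_sphere hΨ (hcont z₀ hzr hd.continuousOn)
  · refine (hΨ.aestronglyMeasurable.mul (hcont z₀ hzr hd').aestronglyMeasurable).smul ?_
    exact ((innerSL ℂ (E := CSpace n)).continuous.comp continuous_subtype_val).aestronglyMeasurable
  · refine Eventually.of_forall fun x z hz => ?_
    rw [norm_smul, norm_mul, innerSL_apply_norm, norm_sphere, mul_one]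
    refine mul_le_mul_of_nonneg_left (hM _ ?_) (norm_nonneg _)
    rw [mem_ball_zero_iff] at hz
    rw [mem_closedBall_zero_iff]
    exact (norm_cdot_sphere_le z x).trans hz.le
  · exact hΨ.norm.mul_const M
  · exact Eventually.of_forall fun x z hz => hder z (by simpa using hz) x

/-! ### Sums of the `φ_k` belong to `𝒪` -/

/-- The Poisson kernel as a continuous function on the sphere. -/
noncomputable def poissonMap {n : ℕ} (z : CSpace n) (hz : z ∈ Metric.ball (0 : CSpace n) 1) :
    C(CSphere n, ℂ) :=
  ⟨fun x => (poissonKernel z x : ℂ), continuous_poissonKernel hz⟩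

lemma pairing_poissonMap {n : ℕ} {z : CSpace n} (hz : z ∈ Metric.ball (0 : CSpace n) 1)
    (Ψ : Lp ℂ 2 (sphereMeasure n)) : pairing (poissonMap z hz) Ψ = poissonExt Ψ z := by
  rw [pairing_apply, poissonExt]
  refine integral_congr_ae (Eventually.of_forall fun x => ?_)
  exact mul_comm _ _

lemma summable_szego {n : ℕ} (hn : 0 < n) {r : ℝ} (hr : 0 ≤ r) (hr1 : r < 1) :
    Summable fun l : ℕ => ‖((poch n l / l.factorial : ℝ) : ℂ)‖ * r ^ l := by
  have h := summable_choose_mul_geometric_of_norm_lt_one (n - 1) (r := r)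
    (by rwa [Real.norm_of_nonneg hr])
  refine h.congr fun l => ?_
  have h0 : 0 < poch n l := poch_pos (by exact_mod_cast hn) l
  rw [Complex.norm_real, Real.norm_of_nonneg (by positivity), Nat.cast_choose ℝ (by omega),
    Nat.add_sub_cancel, poch_natCast hn, add_comm l, div_div]

/-- On the closed span of the `φ_k` the Poisson integral coincides with the integral against the
Szegő kernel `∑_l ((n)_l / l!) (z · x) ^ l = (1 - z · x) ^ (-n)`, which is holomorphic in `z`. -/
lemma mem_hardyO_of_hasSum {n : ℕ} (hn : 0 < n) {a : (Fin n → ℕ) → ℂ}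
    {Ψ : Lp ℂ 2 (sphereMeasure n)} (h : HasSum (fun k => a k • phiLp k) Ψ) : Ψ ∈ hardyO n := by
  have hd := differentiableOn_integral_kernel (n := n)
    (g := fun l => ((poch n l / l.factorial : ℝ) : ℂ)) (R := 1)
    (fun r hr hr1 => summable_szego hn hr hr1) (integrable_sphere_Lp Ψ)
  refine hd.congr fun z hz => ?_
  have hz1 : ‖z‖ < 1 := by simpa using hz
  have hs := summable_szego hn (norm_nonneg z) hz1
  have h1 := h.mapL (pairing (poissonMap z hz))
  have h2 := h.mapL (pairing (kernelMap _ z hs))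
  rw [pairing_poissonMap] at h1
  rw [pairing_apply] at h2
  refine h1.unique ?_
  convert! h2 using 1
  funext k
  rw [map_smul, map_smul, pairing_phiLp, pairing_phiLp, integral_monom_mul_kernelMap hn]
  have h3 : ∫ x : CSphere n, monom k x * poissonMap z hz x ∂(sphereMeasure n) = monom k z := by
    rw [← poissonExt_monom hn k hz1]
    exact integral_congr_ae (Eventually.of_forall fun x => mul_comm _ _)
  have h4 : (poch n (len k) / (len k).factorial : ℝ) * ((len k).factorial / poch n (len k)) = 1 := by
    have h5 := (poch_pos (b := n) (by exact_mod_cast hn) (len k)).ne'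
    have h6 := (len k).factorial_ne_zero
    field_simp
  rw [h3, ← Complex.ofReal_mul, h4, Complex.ofReal_one, one_mul]

/-! ### Elements of `𝒪` are determined by their coefficients -/

lemma poissonKernel_swap {n : ℕ} (r : ℝ) (x y : CSphere n) :
    poissonKernel (r • (x : CSpace n)) y = poissonKernel (r • (y : CSpace n)) x := by
  have h1 : ‖r • (x : CSpace n) - y‖ ^ 2 = ‖r • (y : CSpace n) - x‖ ^ 2 := by
    rw [norm_sub_sq_sphere, norm_sub_sq_sphere, norm_smul, norm_smul, norm_sphere, norm_sphere,
      cdot_eq_inner, cdot_eq_inner, ← Complex.coe_smul, ← Complex.coe_smul, inner_smul_right,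
      inner_smul_right, Complex.re_ofReal_mul, Complex.re_ofReal_mul]
    have := inner_re_symm (𝕜 := ℂ) (x : CSpace n) y
    simp only [RCLike.re_to_complex] at this
    rw [this]
  rw [poissonKernel, poissonKernel, pow_mul, pow_mul, h1, norm_smul, norm_smul, norm_sphere,
    norm_sphere]

lemma norm_smul_sphere {n : ℕ} {r : ℝ} (hr : 0 ≤ r) (x : CSphere n) :
    ‖r • (x : CSpace n)‖ = r := by
  rw [norm_smul, norm_sphere, mul_one, Real.norm_of_nonneg hr]

/-- The moments of a Poisson extension over a sphere, by the symmetry of the kernel. -/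
lemma integral_poissonExt_mul_monom {n : ℕ} (hn : 0 < n) {D : CSphere n → ℂ}
    (hD : Integrable D (sphereMeasure n)) {r : ℝ} (hr : 0 < r) (hr1 : r < 1) (k : Fin n → ℕ) :
    ∫ x : CSphere n, poissonExt D (r • (x : CSpace n)) * conj (monom k (x : CSpace n))
      ∂(sphereMeasure n) =
      (r : ℂ) ^ len k * ∫ y, D y * conj (monom k (y : CSpace n)) ∂(sphereMeasure n) := by
  have hlt : ∀ x : CSphere n, ‖r • (x : CSpace n)‖ < 1 := fun x => by
    rwa [norm_smul_sphere hr.le]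
  have hcont : Continuous (fun q : CSphere n × CSphere n =>
      (poissonKernel (r • (q.1 : CSpace n)) q.2 : ℂ) * conj (monom k (q.1 : CSpace n))) := by
    refine (Complex.continuous_ofReal.comp ?_).mul (Complex.continuous_conj.comp
      ((continuous_monom_sphere k).comp continuous_fst))
    unfold poissonKernel
    refine Continuous.div (by fun_prop) (by fun_prop) fun q => pow_ne_zero _ ?_
    rw [norm_ne_zero_iff, sub_ne_zero]
    intro h
    have := hlt q.1
    rw [h, norm_sphere] at this
    exact lt_irrefl _ this
  have hint : Integrable (Function.uncurry fun x y : CSphere n =>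
      (poissonKernel (r • (x : CSpace n)) y : ℂ) * conj (monom k (x : CSpace n)) * D y)
      ((sphereMeasure n).prod (sphereMeasure n)) := by
    obtain ⟨C, hC⟩ := isCompact_univ.exists_bound_of_continuousOn hcont.continuousOn
    exact (hD.comp_snd (sphereMeasure n)).bdd_mul (c := C) hcont.aestronglyMeasurable
      (Eventually.of_forall fun q => hC q (Set.mem_univ q))
  calc _ = ∫ x : CSphere n, ∫ y : CSphere n, (poissonKernel (r • (x : CSpace n)) y : ℂ) *
          conj (monom k (x : CSpace n)) * D y ∂(sphereMeasure n) ∂(sphereMeasure n) := by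
        refine integral_congr_ae (Eventually.of_forall fun x => ?_)
        simp only [poissonExt]
        rw [← integral_mul_const]
        exact integral_congr_ae (Eventually.of_forall fun y => by ring)
    _ = ∫ y : CSphere n, ∫ x : CSphere n, (poissonKernel (r • (x : CSpace n)) y : ℂ) *
          conj (monom k (x : CSpace n)) * D y ∂(sphereMeasure n) ∂(sphereMeasure n) :=
        integral_integral_swap hint
    _ = ∫ y : CSphere n, (r : ℂ) ^ len k * (D y * conj (monom k (y : CSpace n)))
          ∂(sphereMeasure n) := by
        refine integral_congr_ae (Eventually.of_forall fun y => ?_)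
        simp only
        rw [integral_mul_const]
        have h1 : ∫ x : CSphere n, (poissonKernel (r • (x : CSpace n)) y : ℂ) *
            conj (monom k (x : CSpace n)) ∂(sphereMeasure n) =
            conj (poissonExt (fun x : CSphere n => monom k x) (r • (y : CSpace n))) := by
          rw [poissonExt, ← integral_conj]
          refine integral_congr_ae (Eventually.of_forall fun x => ?_)
          simp only [map_mul, Complex.conj_ofReal]
          rw [poissonKernel_swap]
        rw [h1, poissonExt_monom hn k (hlt y), monom_real_smul, map_mul, map_pow,
          Complex.conj_ofReal]
        ring
    _ = _ := integral_const_mul _ _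

/-- A power series that sums to zero at all small positive arguments is zero. -/
lemma coeff_eq_zero_of_hasSum {q : ℕ → ℂ}
    (h : ∀ᶠ w : ℝ in 𝓝[>] 0, HasSum (fun m => q m * (w : ℂ) ^ m) 0) (m : ℕ) : q m = 0 := by
  obtain ⟨w₀, hw₀, hw₀pos⟩ : ∃ w : ℝ, HasSum (fun m => q m * (w : ℂ) ^ m) 0 ∧ 0 < w :=
    (h.and self_mem_nhdsWithin).exists
  obtain ⟨K, hK⟩ : ∃ K, ∀ j, ‖q j * (w₀ : ℂ) ^ j‖ ≤ K := by
    obtain ⟨K, hK⟩ := (Metric.isBounded_range_of_tendsto _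
      hw₀.summable.tendsto_atTop_zero).exists_norm_le
    exact ⟨K, fun j => hK _ ⟨j, rfl⟩⟩
  induction m using Nat.strong_induction_on with
  | _ m ih =>
  rw [← norm_le_zero_iff]
  have ht : Tendsto (fun w : ℝ => 2 * K / w₀ ^ (m + 1) * w) (𝓝[>] 0) (𝓝 0) := by
    have : Tendsto (fun w : ℝ => 2 * K / w₀ ^ (m + 1) * w) (𝓝 0)
      (𝓝 (2 * K / w₀ ^ (m + 1) * 0)) := tendsto_id.const_mul _
    rw [mul_zero] at this
    exact this.mono_left nhdsWithin_le_nhds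
  refine ge_of_tendsto ht ?_
  filter_upwards [h, Ioc_mem_nhdsGT (half_pos hw₀pos)] with w hw hw2
  have hwpos : 0 < w := hw2.1
  have hr : w / w₀ ≤ 1 / 2 := by
    rw [div_le_iff₀ hw₀pos]
    linarith [hw2.2]
  have hK0 : 0 ≤ K := (norm_nonneg _).trans (hK 0)
  have hb := norm_sub_le_of_geometric_bound_of_hasSum (r := w / w₀) (C := K) (by linarith)
    (fun j => by
      have := hK j
      rw [norm_mul, norm_pow, Complex.norm_real, Real.norm_of_nonneg hw₀pos.le] at this
      rw [norm_mul, norm_pow, Complex.norm_real, Real.norm_of_nonneg hwpos.le, div_pow]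
      calc ‖q j‖ * w ^ j = ‖q j‖ * w₀ ^ j * (w ^ j / w₀ ^ j) := by field_simp
        _ ≤ K * (w ^ j / w₀ ^ j) := by gcongr) hw (m + 1)
  rw [Finset.sum_range_succ, Finset.sum_eq_zero fun j hj => by
    rw [ih j (Finset.mem_range.1 hj), zero_mul], zero_add, sub_zero, norm_mul, norm_pow,
    Complex.norm_real, Real.norm_of_nonneg hwpos.le] at hb
  have hb2 : ‖q m‖ * w ^ m ≤ 2 * K * (w / w₀) ^ (m + 1) := by
    refine hb.trans ?_
    rw [div_le_iff₀ (by linarith)]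
    have : 0 ≤ K * (w / w₀) ^ (m + 1) := by positivity
    nlinarith
  have hb3 : 2 * K * (w / w₀) ^ (m + 1) = (2 * K / w₀ ^ (m + 1) * w) * w ^ m := by
    rw [div_pow, pow_succ w]
    ring
  rw [hb3] at hb2
  exact le_of_mul_le_mul_right hb2 (by positivity)

lemma twoRe_real_smul {n : ℕ} (r : ℝ) (z w : CSpace n) :
    twoRe (r • z) w = (r : ℂ) * twoRe z w := by
  rw [twoRe_eq, twoRe_eq, cdot_eq_inner, cdot_eq_inner, ← Complex.coe_smul, inner_smul_right,
    Complex.re_ofReal_mul]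
  push_cast
  ring

/-- If the Poisson extension of `D` vanishes, then all moments of `D` against powers of
`Re (z · x)` vanish: along a ray the Poisson integral is a power series in `τ / (1 + τ ^ 2)` whose
coefficients are nonzero multiples of these moments. -/
lemma integral_mul_twoRe_pow_eq_zero {n : ℕ} (hn : 0 < n) {D : CSphere n → ℂ}
    (hD : Integrable D (sphereMeasure n)) (h0 : ∀ z, ‖z‖ < 1 → poissonExt D z = 0)
    (z : CSpace n) (m : ℕ) :
    ∫ x : CSphere n, D x * twoRe z x ^ m ∂(sphereMeasure n) = 0 := by
  have hunit : ∀ (v : CSphere n) (m : ℕ),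
      ∫ x : CSphere n, D x * twoRe (v : CSpace n) x ^ m ∂(sphereMeasure n) = 0 := by
    intro v
    set μ : ℕ → ℂ := fun m => ∫ x : CSphere n, D x * twoRe (v : CSpace n) x ^ m ∂(sphereMeasure n)
      with hμ
    have hq := coeff_eq_zero_of_hasSum
      (q := fun m => (((m + (n - 1)).choose (n - 1) : ℕ) : ℂ) * μ m) ?_
    · intro m
      refine (mul_eq_zero.1 (hq m)).resolve_left ?_
      exact_mod_cast (Nat.choose_pos (by omega)).ne'
    filter_upwards [Ioo_mem_nhdsGT (by norm_num : (0 : ℝ) < 1 / 2)] with w hw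
    -- solve `τ / (1 + τ ^ 2) = w`
    have hf : ContinuousOn (fun τ : ℝ => τ / (1 + τ ^ 2)) (Set.Icc 0 1) := by
      refine Continuous.continuousOn (Continuous.div (by fun_prop) (by fun_prop) fun τ => ?_)
      positivity
    have hivt := intermediate_value_Ioo (zero_le_one' ℝ) hf
    obtain ⟨τ, hτ, hτw⟩ := hivt (by norm_num; exact ⟨hw.1, by linarith [hw.2]⟩)
    have hn1 : ‖τ • (v : CSpace n)‖ = τ := norm_smul_sphere hτ.1.le v
    have h := hasSum_integral_poissonKernel hn (z := τ • (v : CSpace n)) (by rw [hn1]; exact hτ.2) hD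
    rw [h0 _ (by rw [hn1]; exact hτ.2), hn1] at h
    have hs : (0 : ℝ) < 1 - τ ^ 2 := by nlinarith [hτ.1, hτ.2]
    have hp : (0 : ℝ) < 1 + τ ^ 2 := by positivity
    have h2 := h.mul_left (((1 + τ ^ 2) ^ n / (1 - τ ^ 2) : ℝ) : ℂ)
    rw [mul_zero] at h2
    convert! h2 using 1
    funext m
    simp only [twoRe_real_smul, mul_pow]
    have e : ∀ x : CSphere n, D x * ((τ : ℂ) ^ m * twoRe (v : CSpace n) x ^ m) =
        (τ : ℂ) ^ m * (D x * twoRe (v : CSpace n) x ^ m) := fun x => by ring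
    simp_rw [e]
    rw [integral_const_mul, ← hτw]
    have hp' : (1 + (τ : ℂ) ^ 2) ≠ 0 := by exact_mod_cast hp.ne'
    have hs' : (1 - (τ : ℂ) ^ 2) ≠ 0 := by exact_mod_cast hs.ne'
    push_cast
    rw [div_pow, pow_add]
    field_simp
    simp only [hμ]
    ring
  rcases eq_or_ne z 0 with rfl | hz
  · have : Nonempty (Fin n) := ⟨⟨0, hn⟩⟩
    obtain ⟨v⟩ : Nonempty (CSphere n) :=
      (NormedSpace.sphere_nonempty.2 zero_le_one).to_subtype
    have h := hunit v m
    have e : ∀ x : CSphere n, D x * twoRe (0 : CSpace n) x ^ m =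
        (0 : ℂ) ^ m * (D x * twoRe (v : CSpace n) x ^ m) := by
      intro x
      have h0 := twoRe_real_smul 0 (v : CSpace n) x
      rw [zero_smul, Complex.ofReal_zero] at h0
      rw [h0, mul_pow]
      ring
    simp_rw [e]
    rw [integral_const_mul, h, mul_zero]
  · have hz0 : ‖z‖ ≠ 0 := norm_ne_zero_iff.2 hz
    let v : CSphere n := ⟨‖z‖⁻¹ • z, by simp [norm_smul, hz0]⟩
    have hv : z = ‖z‖ • (v : CSpace n) := by
      simp [v, smul_smul, hz0]
    have e : ∀ x : CSphere n, D x * twoRe z x ^ m =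
        (‖z‖ : ℂ) ^ m * (D x * twoRe (v : CSpace n) x ^ m) := by
      intro x
      conv_lhs => rw [hv]
      rw [twoRe_real_smul, mul_pow]
      ring
    simp_rw [e]
    rw [integral_const_mul, hunit, mul_zero]

/-- The character `x ↦ exp (2 i Re (z · x))` on the sphere. -/
noncomputable def sphereChar {n : ℕ} (z : CSpace n) : C(CSphere n, ℂ) :=
  ⟨fun x => Complex.exp (Complex.I * twoRe z x),
    Complex.continuous_exp.comp (continuous_const.mul (continuous_twoRe_sphere z))⟩

lemma integral_mul_sphereChar_eq_zero {n : ℕ} {D : CSphere n → ℂ}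
    (hD : Integrable D (sphereMeasure n)) {z : CSpace n}
    (h : ∀ m : ℕ, ∫ x : CSphere n, D x * twoRe z x ^ m ∂(sphereMeasure n) = 0) :
    ∫ x, D x * sphereChar z x ∂(sphereMeasure n) = 0 := by
  set F : ℕ → CSphere n → ℂ := fun m x =>
    (Complex.I ^ m / m.factorial) * (D x * twoRe z x ^ m) with hF
  have hFi : ∀ m, Integrable (F m) (sphereMeasure n) := fun m =>
    (integrable_mul_sphere hD ((continuous_twoRe_sphere z).pow m)).const_mul _
  have hFb : ∀ m, ∫ x, ‖F m x‖ ∂(sphereMeasure n) ≤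
      ((2 * ‖z‖) ^ m / m.factorial) * ∫ x, ‖D x‖ ∂(sphereMeasure n) := by
    intro m
    rw [← integral_const_mul]
    refine integral_mono (hFi m).norm (hD.norm.const_mul _) fun x => ?_
    simp only [hF, norm_mul, norm_div, norm_pow, Complex.norm_I, one_pow, Complex.norm_natCast]
    have := norm_twoRe_le z x
    calc 1 / (m.factorial : ℝ) * (‖D x‖ * ‖twoRe z x‖ ^ m)
        ≤ 1 / (m.factorial : ℝ) * (‖D x‖ * (2 * ‖z‖) ^ m) := by gcongr
      _ = _ := by ring
  have hs := Summable.of_nonneg_of_le (fun m => integral_nonneg fun x => norm_nonneg (F m x)) hFb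
    ((Real.summable_pow_div_factorial _).mul_right _)
  have hsum := hasSum_integral_of_summable_integral_norm hFi hs
  have h1 : ∀ x, ∑' m, F m x = D x * sphereChar z x := by
    intro x
    rw [sphereChar, ContinuousMap.coe_mk, Complex.exp_eq_exp_ℂ, NormedSpace.exp_eq_tsum_div,
      ← tsum_mul_left]
    refine tsum_congr fun m => ?_
    simp only [hF, mul_pow]
    ring
  have h2 : ∀ m, ∫ x, F m x ∂(sphereMeasure n) = 0 := fun m => by
    simp only [hF]
    rw [integral_const_mul, h m, mul_zero]
  simp_rw [h1, h2] at hsum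
  exact hsum.unique hasSum_zero

lemma sphereChar_mul {n : ℕ} (z w : CSpace n) :
    sphereChar z * sphereChar w = sphereChar (z + w) := by
  ext x
  simp only [sphereChar, ContinuousMap.mul_apply, ContinuousMap.coe_mk]
  rw [← Complex.exp_add, twoRe_eq, twoRe_eq, twoRe_eq, cdot_eq_inner, cdot_eq_inner,
    cdot_eq_inner, inner_add_right, Complex.add_re]
  push_cast
  ring_nf

lemma star_sphereChar {n : ℕ} (z : CSpace n) : star (sphereChar z) = sphereChar (-z) := by
  ext x
  simp only [sphereChar, ContinuousMap.star_apply, ContinuousMap.coe_mk]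
  rw [RCLike.star_def, ← Complex.exp_conj, map_mul, Complex.conj_I, twoRe_eq, twoRe_eq,
    Complex.conj_ofReal, cdot_eq_inner, cdot_eq_inner, inner_neg_right, Complex.neg_re]
  push_cast
  ring_nf

lemma sphereChar_zero {n : ℕ} : (sphereChar 0 : C(CSphere n, ℂ)) = 1 := by
  ext x
  simp [sphereChar, twoRe_eq, cdot]

/-- The characters span a dense subspace of the continuous functions, by Stone–Weierstrass. -/
lemma dense_span_sphereChar {n : ℕ} :
    Dense (Submodule.span ℂ (Set.range (sphereChar : CSpace n → C(CSphere n, ℂ))) :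
      Set C(CSphere n, ℂ)) := by
  set A₀ : Set C(CSphere n, ℂ) := Set.range sphereChar with hA₀
  let S : Submonoid C(CSphere n, ℂ) :=
    { carrier := A₀
      one_mem' := ⟨0, sphereChar_zero⟩
      mul_mem' := by
        rintro _ _ ⟨z, rfl⟩ ⟨w, rfl⟩
        exact ⟨z + w, (sphereChar_mul z w).symm⟩ }
  have hcl : (Submonoid.closure A₀ : Set C(CSphere n, ℂ)) = A₀ :=
    congrArg SetLike.coe (Submonoid.closure_eq S)
  have hstar : star A₀ = A₀ := by
    ext c
    constructor
    · rintro ⟨z, hz⟩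
      exact ⟨-z, by rw [← star_sphereChar, hz, star_star]⟩
    · rintro ⟨z, rfl⟩
      exact ⟨-z, (star_sphereChar z).symm⟩
  have hspan : ((StarAlgebra.adjoin ℂ A₀ : StarSubalgebra ℂ C(CSphere n, ℂ)) :
      Set C(CSphere n, ℂ)) = Submodule.span ℂ A₀ := by
    have h1 : (StarAlgebra.adjoin ℂ A₀).toSubalgebra = Algebra.adjoin ℂ A₀ := by
      rw [StarAlgebra.adjoin_toSubalgebra, hstar, Set.union_self]
    have h2 := Algebra.adjoin_eq_span ℂ A₀
    rw [hcl, ← h1] at h2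
    exact congrArg SetLike.coe h2
  have hsep : (StarAlgebra.adjoin ℂ A₀).SeparatesPoints := by
    intro x y hxy
    by_contra hcon
    push Not at hcon
    have hall : ∀ z : CSpace n, sphereChar z x = sphereChar z y := fun z =>
      hcon _ ⟨sphereChar z, StarAlgebra.subset_adjoin ℂ A₀ ⟨z, rfl⟩, rfl⟩
    -- differentiate along the ray spanned by `x - y`
    set d : CSpace n := (x : CSpace n) - y with hd
    set a : ℝ := 2 * (cdot d x).re with ha
    set b : ℝ := 2 * (cdot d y).re with hb
    have hder : ∀ c : ℝ, HasDerivAt (fun t : ℝ => Complex.exp (Complex.I * ((t : ℂ) * c)))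
        (Complex.I * c) 0 := by
      intro c
      have h1 : HasDerivAt (fun t : ℝ => Complex.I * ((t : ℂ) * c)) (Complex.I * (1 * c)) 0 :=
        ((Complex.ofRealCLM.hasDerivAt).mul_const (c : ℂ)).const_mul Complex.I
      have h2 := h1.cexp
      simpa using h2
    have heq : (fun t : ℝ => Complex.exp (Complex.I * ((t : ℂ) * a))) =
        fun t : ℝ => Complex.exp (Complex.I * ((t : ℂ) * b)) := by
      funext t
      have h1 := hall (t • d)
      simp only [sphereChar, ContinuousMap.coe_mk, twoRe_real_smul] at h1
      simpa only [twoRe_eq] using h1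
    have hab : a = b := by
      have h1 := hder a
      rw [heq] at h1
      have := mul_left_cancel₀ Complex.I_ne_zero (h1.unique (hder b))
      exact_mod_cast this
    have h3 : (cdot d d).re = 0 := by
      have e : cdot d d = cdot d x - cdot d y := by
        rw [cdot_eq_inner, cdot_eq_inner, cdot_eq_inner, ← inner_sub_left, ← hd]
      rw [e, Complex.sub_re]
      linarith
    rw [cdot_self, Complex.ofReal_re, pow_eq_zero_iff two_ne_zero, norm_eq_zero, hd,
      sub_eq_zero] at h3
    exact hxy (Subtype.ext h3)
  have h := ContinuousMap.starSubalgebra_topologicalClosure_eq_top_of_separatesPoints _ hsep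
  have h2 := congrArg (SetLike.coe) h
  rw [StarSubalgebra.topologicalClosure_coe, hspan] at h2
  rw [dense_iff_closure_eq, h2]
  rfl

/-- An element of `𝒪` orthogonal to all `φ_k` is zero. -/
lemma eq_zero_of_mem_hardyO {n : ℕ} (hn : 0 < n) {D : Lp ℂ 2 (sphereMeasure n)}
    (hD : D ∈ hardyO n) (h0 : ∀ k, inner ℂ (phiLp k) D = 0) : D = 0 := by
  have hint := integrable_sphere_Lp D
  have hmom : ∀ k : Fin n → ℕ, ∫ x, D x * conj (monom k (x : CSpace n)) ∂(sphereMeasure n) = 0 := by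
    intro k
    have h := h0 k
    rw [inner_phiLp] at h
    refine (mul_eq_zero.1 h).resolve_left ?_
    exact_mod_cast (Real.sqrt_pos.2 (poch_div_mfact_pos hn k)).ne'
  obtain ⟨c, hc, hc0⟩ := exists_coeff hn one_pos hD
  have hzero : ∀ z, ‖z‖ < 1 → poissonExt D z = 0 := by
    refine hc0 fun k => ?_
    have h := hc (1 / 2) k (by norm_num) (by norm_num)
    rw [integral_poissonExt_mul_monom hn hint (by norm_num) (by norm_num), hmom, mul_zero] at h
    have h1 : ((mfact k / poch n (len k) : ℝ) : ℂ) ≠ 0 := by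
      have h2 : (0 : ℝ) < mfact k := by exact_mod_cast mfact_pos k
      exact_mod_cast (div_pos h2 (poch_pos (by exact_mod_cast hn) _)).ne'
    have h2 : ((1 / 2 : ℝ) : ℂ) ^ len k ≠ 0 := pow_ne_zero _ (by norm_num)
    exact (mul_eq_zero.1 ((mul_eq_zero.1 h.symm).resolve_right h2)).resolve_right h1
  have hchar : ∀ z : CSpace n, ∫ x, D x * sphereChar z x ∂(sphereMeasure n) = 0 := fun z =>
    integral_mul_sphereChar_eq_zero hint (integral_mul_twoRe_pow_eq_zero hn hint hzero z)
  let Λ : C(CSphere n, ℂ) →L[ℂ] ℂ :=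
    (innerSL ℂ D).comp (ContinuousMap.toLp (E := ℂ) 2 (sphereMeasure n) ℂ)
  have hΛ : ∀ z, Λ (sphereChar z) = 0 := by
    intro z
    have h1 := pairing_apply (sphereChar (-z)) D
    rw [hchar, ← star_sphereChar, pairing, star_star, innerSL_apply_apply] at h1
    change inner ℂ D (ContinuousMap.toLp (E := ℂ) 2 (sphereMeasure n) ℂ (sphereChar z)) = 0
    rw [← inner_conj_symm, h1, map_zero]
  have hker : ∀ c, Λ c = 0 := by
    have hle : Submodule.span ℂ (Set.range (sphereChar : CSpace n → C(CSphere n, ℂ))) ≤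
        Λ.ker := by
      rw [Submodule.span_le]
      rintro _ ⟨z, rfl⟩
      exact hΛ z
    have hcl : IsClosed (Λ.ker : Set C(CSphere n, ℂ)) := Λ.isClosed_ker
    intro c
    exact hcl.closure_subset_iff.2 hle (dense_span_sphereChar c)
  have hdense := ContinuousMap.toLp_denseRange (p := 2) (E := ℂ) (𝕜 := ℂ) (μ := sphereMeasure n)
    (by norm_num)
  refine Dense.eq_zero_of_inner_left ℂ hdense ?_
  rintro _ ⟨c, rfl⟩
  exact hker c

/-! ### Orthonormal expansions ordered by degree -/

/-- The multi-indices of length at most `K`. -/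
def degLE (n K : ℕ) : Finset (Fin n → ℕ) :=
  (Finset.range (K + 1)).biUnion fun l => Finset.univ.piAntidiag l

lemma mem_degLE {n K : ℕ} {k : Fin n → ℕ} : k ∈ degLE n K ↔ len k ≤ K := by
  simp only [degLE, Finset.mem_biUnion, mem_piAntidiag_univ, Finset.mem_range]
  exact ⟨fun ⟨l, hl, h⟩ => by omega, fun h => ⟨len k, by omega, rfl⟩⟩

lemma sum_range_piAntidiag {n : ℕ} {M : Type*} [AddCommMonoid M] (K : ℕ) (f : (Fin n → ℕ) → M) :
    ∑ l ∈ Finset.range (K + 1), ∑ k ∈ Finset.univ.piAntidiag l, f k = ∑ k ∈ degLE n K, f k := by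
  rw [degLE, Finset.sum_biUnion]
  intro l _ l' _ hll
  rw [Function.onFun, Finset.disjoint_left]
  intro k hk hk'
  rw [mem_piAntidiag_univ] at hk hk'
  exact hll (hk.symm.trans hk')

lemma tendsto_degLE (n : ℕ) : Tendsto (degLE n) atTop atTop := by
  refine tendsto_atTop_finset_of_monotone (fun K K' h k hk => ?_) fun k => ⟨len k, ?_⟩
  · rw [mem_degLE] at hk ⊢
    exact hk.trans h
  · rw [mem_degLE]

section Hilbert

variable {ι H : Type*} [NormedAddCommGroup H] [InnerProductSpace ℂ H]

lemma Orthonormal.inner_eq_of_hasSum {v : ι → H} (hv : Orthonormal ℂ v) {a : ι → ℂ} {x : H}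
    (h : HasSum (fun i => a i • v i) x) (i : ι) : inner ℂ (v i) x = a i := by
  classical
  have h1 := h.mapL (innerSL ℂ (v i))
  refine h1.unique ?_
  convert! hasSum_ite_eq i (a i) using 1
  funext j
  rw [innerSL_apply_apply, inner_smul_right, orthonormal_iff_ite.1 hv]
  by_cases hij : i = j
  · simp [hij]
  · simp [hij, Ne.symm hij]

lemma Orthonormal.summable_smul [CompleteSpace H] {v : ι → H} (hv : Orthonormal ℂ v) {a : ι → ℂ}
    (ha : Summable fun i => ‖a i‖ ^ 2) : Summable fun i => a i • v i := by
  have := (hv.orthogonalFamily.summable_iff_norm_sq_summable a).2 ha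
  simpa using this

/-- Parseval's identity for two sums along an orthonormal system. -/
lemma Orthonormal.hasSum_inner {v : ι → H} (hv : Orthonormal ℂ v) {a b : ι → ℂ} {x y : H}
    (hx : HasSum (fun i => a i • v i) x) (hy : HasSum (fun i => b i • v i) y) :
    HasSum (fun i => b i * conj (a i)) (inner ℂ x y) := by
  have h1 := hy.mapL (innerSL ℂ x)
  convert! h1 using 1
  funext i
  rw [innerSL_apply_apply, inner_smul_right, ← inner_conj_symm, inner_eq_of_hasSum hv hx]

end Hilbert

lemma eLpNorm_sub_sum_eq {α ι : Type*} [MeasurableSpace α] {μ : Measure α} {s : Finset ι}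
    {a : ι → ℂ} {u : ι → Lp ℂ 2 μ} {v : ι → α → ℂ} (huv : ∀ i, u i =ᵐ[μ] v i) {Φ : Lp ℂ 2 μ}
    {f : α → ℂ} (hf : Φ =ᵐ[μ] f) :
    eLpNorm (fun x => f x - ∑ i ∈ s, a i * v i x) 2 μ = ‖Φ - ∑ i ∈ s, a i • u i‖ₑ := by
  rw [Lp.enorm_def]
  refine eLpNorm_congr_ae ?_
  have h1 : ∀ᵐ x ∂μ, ∀ i ∈ s, (a i • u i : Lp ℂ 2 μ) x = a i * v i x := by
    refine (Finset.eventually_all s).2 fun i _ => ?_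
    filter_upwards [huv i, Lp.coeFn_smul (a i) (u i)] with x hx hx2
    rw [hx2, Pi.smul_apply, hx, smul_eq_mul]
  filter_upwards [Lp.coeFn_sub Φ (∑ i ∈ s, a i • u i), hf, h1,
    Lp.coeFn_finsetSum s (fun i => a i • u i)] with x hx hx2 hx3 hx4
  rw [hx, Pi.sub_apply, hx2, hx4]
  congr 1
  rw [Finset.sum_apply]
  exact Finset.sum_congr rfl fun i hi => (hx3 i hi).symm

lemma tendsto_eLpNorm_iff {α : Type*} [MeasurableSpace α] {μ : Measure α} {n : ℕ}
    {a : (Fin n → ℕ) → ℂ} {u : (Fin n → ℕ) → Lp ℂ 2 μ} {v : (Fin n → ℕ) → α → ℂ}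
    (huv : ∀ i, u i =ᵐ[μ] v i) {Φ : Lp ℂ 2 μ} {f : α → ℂ} (hf : Φ =ᵐ[μ] f) :
    Tendsto (fun K : ℕ => eLpNorm (fun x => f x - ∑ l ∈ Finset.range (K + 1),
      ∑ k ∈ Finset.univ.piAntidiag l, a k * v k x) 2 μ) atTop (𝓝 0) ↔
    Tendsto (fun K => ∑ k ∈ degLE n K, a k • u k) atTop (𝓝 Φ) := by
  simp_rw [sum_range_piAntidiag, eLpNorm_sub_sum_eq huv hf]
  rw [tendsto_iff_edist_tendsto_0]
  simp_rw [edist_comm _ Φ, edist_eq_enorm_sub]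

/-! ### The orthonormal system `Φ_k` -/

lemma bigPhi_coeff_pos {n : ℕ} {p ħ : ℝ} (hp : -(n : ℝ) < p) (hħ : 0 < ħ) (k : Fin n → ℕ) :
    0 < 1 / ħ ^ len k * Real.sqrt (1 / (poch (n + p) (len k) * mfact k)) := by
  have h1 := poch_pos (b := n + p) (by linarith) (len k)
  have h2 : (0 : ℝ) < mfact k := by exact_mod_cast mfact_pos k
  positivity

lemma memLp_bigPhi {n : ℕ} (hn : 0 < n) {p ħ : ℝ} (hp : -(n : ℝ) < p) (hħ : 0 < ħ)
    (k : Fin n → ℕ) : MemLp (bigPhi p ħ k) 2 (measureM n p ħ) :=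
  (memLp_monom_measureM hn hp hħ k).const_mul _

/-- `Φ_k` as an element of `L²` of the measure `m`. -/
noncomputable def bigPhiLp {n : ℕ} (hn : 0 < n) {p ħ : ℝ} (hp : -(n : ℝ) < p) (hħ : 0 < ħ)
    (k : Fin n → ℕ) : Lp ℂ 2 (measureM n p ħ) :=
  (memLp_bigPhi hn hp hħ k).toLp

section Transform

variable {n : ℕ} (hn : 0 < n) {p ħ : ℝ} (hp : -(n : ℝ) < p) (hħ : 0 < ħ)

lemma coeFn_bigPhiLp (k : Fin n → ℕ) :
    bigPhiLp hn hp hħ k =ᵐ[measureM n p ħ] bigPhi p ħ k :=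
  (memLp_bigPhi hn hp hħ k).coeFn_toLp

lemma inner_bigPhiLp (k : Fin n → ℕ) {Φ : Lp ℂ 2 (measureM n p ħ)} {f : CSpace n → ℂ}
    (hf : Φ =ᵐ[measureM n p ħ] f) :
    inner ℂ (bigPhiLp hn hp hħ k) Φ =
      ((1 / ħ ^ len k * Real.sqrt (1 / (poch (n + p) (len k) * mfact k)) : ℝ) : ℂ) *
        ∫ z, f z * conj (monom k z) ∂(measureM n p ħ) := by
  rw [L2.inner_def, ← integral_const_mul]
  refine integral_congr_ae ?_
  filter_upwards [coeFn_bigPhiLp hn hp hħ k, hf] with z hz hz2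
  rw [hz, hz2, RCLike.inner_apply, bigPhi, map_mul, Complex.conj_ofReal]
  ring

lemma orthonormal_bigPhiLp :
    Orthonormal ℂ (bigPhiLp hn hp hħ : (Fin n → ℕ) → Lp ℂ 2 (measureM n p ħ)) := by
  rw [orthonormal_iff_ite]
  intro k l
  rw [inner_bigPhiLp hn hp hħ k (coeFn_bigPhiLp hn hp hħ l)]
  simp_rw [bigPhi, mul_assoc]
  rw [integral_const_mul, integral_monom_measureM hn hp hħ]
  by_cases hkl : k = l
  · subst hkl
    rw [if_pos rfl, if_pos rfl, ← Complex.ofReal_mul, ← Complex.ofReal_mul]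
    have h1 := poch_pos (b := n + p) (by linarith) (len k)
    have h2 : (0 : ℝ) < mfact k := by exact_mod_cast mfact_pos k
    have h3 := Real.mul_self_sqrt (x := 1 / (poch (n + p) (len k) * mfact k)) (by positivity)
    rw [show ∀ A S X : ℝ, A * S * (A * S * X) = (A * A) * (S * S) * X by intros; ring, h3,
      mul_comm 2 (len k), pow_mul]
    rw [← Complex.ofReal_one]
    congr 1
    field_simp
  · rw [if_neg (Ne.symm hkl), if_neg hkl, mul_zero, mul_zero]

/-! ### The integral transform -/

lemma poch_succ {b : ℝ} (hb : 0 < b) (l : ℕ) : poch b (l + 1) = (b + l) * poch b l := by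
  rw [poch, poch, Nat.cast_add_one, ← add_assoc, Real.Gamma_add_one (by positivity)]
  ring

/-- The coefficient of `(z · x) ^ l` in the kernel of the transform. -/
noncomputable def kernelCoeff (n : ℕ) (p ħ : ℝ) (l : ℕ) : ℂ :=
  ((coeffC n p l / l.factorial : ℝ) : ℂ) / (ħ : ℂ) ^ l

lemma kernelTerm_eq (z x : CSpace n) (l : ℕ) :
    kernelTerm p ħ z x l = kernelCoeff n p ħ l * cdot z x ^ l := by
  rw [kernelTerm, kernelCoeff, div_pow]
  ring

include hn hp in
/-- The coefficients `c_l` grow at most geometrically, since the ratios `(n + l) / (n + p + l)` are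
bounded; for `p < 0` they are not bounded by `1`. -/
lemma coeffC_le (l : ℕ) : coeffC n p l ≤ (1 + n / (n + p)) ^ l := by
  have hn' : (0 : ℝ) < n := by exact_mod_cast hn
  have hnp : 0 < (n : ℝ) + p := by linarith
  have hB : (1 : ℝ) ≤ 1 + n / (n + p) := by
    have : 0 < (n : ℝ) / (n + p) := by positivity
    linarith
  have h : ∀ l : ℕ, poch n l ≤ (1 + n / (n + p)) ^ l * poch (n + p) l := by
    intro l
    induction l with
    | zero =>
      have h1 := (Real.Gamma_pos_of_pos hn').ne'
      have h2 := (Real.Gamma_pos_of_pos hnp).ne'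
      simp [poch, h1, h2]
    | succ l ih =>
      rw [poch_succ hn', poch_succ hnp, pow_succ]
      have h1 := poch_pos hn' l
      have h2 : (n : ℝ) + l ≤ (1 + n / (n + p)) * (n + p + l) := by
        have h3 : (1 + n / (n + p)) * (n + p + l) = n + p + l + n + n / (n + p) * l := by
          field_simp
          ring
        rw [h3]
        have : 0 ≤ (n : ℝ) / (n + p) * l := by positivity
        linarith
      calc ((n : ℝ) + l) * poch n l
          ≤ ((1 + n / (n + p)) * (n + p + l)) * ((1 + n / (n + p)) ^ l * poch (n + p) l) := by
            gcongr
        _ = _ := by ring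
  rw [coeffC, Real.sqrt_le_left (by positivity), div_le_iff₀ (poch_pos hnp l)]
  refine (h l).trans ?_
  have h2 := poch_pos hnp l
  gcongr
  rw [← pow_mul]
  exact pow_le_pow_right₀ hB (by omega)

include hn hp hħ in
lemma summable_kernelCoeff {r : ℝ} (hr : 0 ≤ r) :
    Summable fun l => ‖kernelCoeff n p ħ l‖ * r ^ l := by
  have hnp : 0 < (n : ℝ) + p := by linarith
  refine Summable.of_nonneg_of_le (fun l => by positivity) (fun l => ?_)
    (Real.summable_pow_div_factorial ((1 + n / (n + p)) * r / ħ))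
  have h0 : 0 ≤ coeffC n p l := Real.sqrt_nonneg _
  rw [kernelCoeff, norm_div, norm_pow, Complex.norm_real, Complex.norm_real,
    Real.norm_of_nonneg (by positivity), Real.norm_of_nonneg hħ.le]
  calc coeffC n p l / l.factorial / ħ ^ l * r ^ l
      ≤ (1 + n / (n + p)) ^ l / l.factorial / ħ ^ l * r ^ l := by
        have := coeffC_le hn hp l
        gcongr
    _ = _ := by
        rw [div_pow, mul_pow]
        ring

/-- The integral operator with kernel `∑_l (c_l / l!) ((z · x) / ħ) ^ l`. -/
noncomputable def kernelTransform (n : ℕ) (p ħ : ℝ) (Ψ : CSphere n → ℂ) (z : CSpace n) : ℂ :=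
  ∫ x : CSphere n, Ψ x * ∑' l : ℕ, kernelTerm p ħ z (x : CSpace n) l ∂(sphereMeasure n)

lemma tsum_kernelTerm (z : CSpace n) (x : CSphere n) :
    ∑' l : ℕ, kernelTerm p ħ z (x : CSpace n) l =
      kernelMap (kernelCoeff n p ħ) z (summable_kernelCoeff hn hp hħ (norm_nonneg z)) x := by
  rw [kernelMap, ContinuousMap.coe_mk]
  exact tsum_congr fun l => kernelTerm_eq z x l

include hn hp hħ in
lemma integrable_mul_kernel {Ψ : CSphere n → ℂ} (hΨ : Integrable Ψ (sphereMeasure n))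
    (z : CSpace n) : Integrable (fun x : CSphere n =>
      Ψ x * ∑' l : ℕ, kernelTerm p ħ z (x : CSpace n) l) (sphereMeasure n) := by
  simp_rw [tsum_kernelTerm hn hp hħ]
  exact integrable_mul_sphere hΨ (ContinuousMap.continuous _)

include hn hp hħ in
lemma differentiable_kernelTransform {Ψ : CSphere n → ℂ} (hΨ : Integrable Ψ (sphereMeasure n)) :
    Differentiable ℂ (kernelTransform n p ħ Ψ) := by
  intro z
  have h := differentiableOn_integral_kernel (g := kernelCoeff n p ħ) (R := ‖z‖ + 1)
    (fun r hr _ => summable_kernelCoeff hn hp hħ hr) hΨ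
  have h2 := h.differentiableAt (Metric.isOpen_ball.mem_nhds (x := z) (by simp))
  refine h2.congr_of_eventuallyEq (Eventually.of_forall fun w => ?_)
  rw [kernelTransform]
  simp_rw [kernelTerm_eq]

include hn hp hħ in
/-- The transform maps `φ_k` to `Φ_k`, hence a sum of the `φ_k` to the corresponding sum of the
`Φ_k`, pointwise. -/
lemma hasSum_kernelTransform {a : (Fin n → ℕ) → ℂ} {Ψ : Lp ℂ 2 (sphereMeasure n)}
    (h : HasSum (fun k => a k • phiLp k) Ψ) (z : CSpace n) :
    HasSum (fun k => a k * bigPhi p ħ k z) (kernelTransform n p ħ Ψ z) := by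
  have hs := summable_kernelCoeff hn hp hħ (norm_nonneg z)
  have h1 := h.mapL (pairing (kernelMap _ z hs))
  rw [pairing_apply] at h1
  simp_rw [← tsum_kernelTerm hn hp hħ] at h1
  convert! h1 using 1
  funext k
  rw [map_smul, pairing_phiLp, integral_monom_mul_kernelMap hn, smul_eq_mul, bigPhi, kernelCoeff,
    coeffC, ← mul_assoc (Complex.ofReal _)]
  congr 2
  have h1 := poch_pos (b := n) (by exact_mod_cast hn) (len k)
  have h2 := poch_pos (b := n + p) (by linarith) (len k)
  have h3 : (0 : ℝ) < mfact k := by exact_mod_cast mfact_pos k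
  have h4 : Real.sqrt (poch n (len k) / mfact k) * Real.sqrt (poch n (len k) / poch (n + p) (len k))
      = poch n (len k) * Real.sqrt (1 / (poch (n + p) (len k) * mfact k)) := by
    rw [← Real.sqrt_mul (by positivity), div_mul_div_comm, ← sq,
      show poch n (len k) ^ 2 / (mfact k * poch (n + p) (len k)) =
        poch n (len k) ^ 2 * (1 / (poch (n + p) (len k) * mfact k)) by ring,
      Real.sqrt_mul (by positivity), Real.sqrt_sq h1.le]
  rw [← Complex.ofReal_pow, ← Complex.ofReal_div, ← Complex.ofReal_mul, ← Complex.ofReal_mul]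
  congr 1
  have h5 : (0 : ℝ) < (len k).factorial := by exact_mod_cast (len k).factorial_pos
  calc 1 / ħ ^ len k * Real.sqrt (1 / (poch (n + p) (len k) * mfact k))
      = (poch n (len k) * Real.sqrt (1 / (poch (n + p) (len k) * mfact k))) /
          (ħ ^ len k * poch n (len k)) := by field_simp
    _ = _ := by
      rw [← h4]
      field_simp

/-- The pointwise sum of the transform agrees with the sum in `L²` of the measure `m`. -/
lemma coeFn_ae_eq_kernelTransform {a : (Fin n → ℕ) → ℂ} {Ψ : Lp ℂ 2 (sphereMeasure n)}
    (h : HasSum (fun k => a k • phiLp k) Ψ) {Φ : Lp ℂ 2 (measureM n p ħ)}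
    (hΦ : HasSum (fun k => a k • bigPhiLp hn hp hħ k) Φ) :
    Φ =ᵐ[measureM n p ħ] kernelTransform n p ħ Ψ := by
  have h1 : Tendsto (fun K => ∑ k ∈ degLE n K, a k • bigPhiLp hn hp hħ k) atTop (𝓝 Φ) :=
    hΦ.comp (tendsto_degLE n)
  obtain ⟨ns, hns, hae⟩ := (tendstoInMeasure_of_tendsto_Lp h1).exists_seq_tendsto_ae
  have h2 : ∀ᵐ z ∂(measureM n p ħ), ∀ K, (∑ k ∈ degLE n K, a k • bigPhiLp hn hp hħ k :
      Lp ℂ 2 (measureM n p ħ)) z = ∑ k ∈ degLE n K, a k * bigPhi p ħ k z := by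
    refine ae_all_iff.2 fun K => ?_
    have h3 : ∀ᵐ z ∂(measureM n p ħ), ∀ k ∈ degLE n K,
        (a k • bigPhiLp hn hp hħ k : Lp ℂ 2 (measureM n p ħ)) z = a k * bigPhi p ħ k z := by
      refine (Finset.eventually_all _).2 fun k _ => ?_
      filter_upwards [coeFn_bigPhiLp hn hp hħ k, Lp.coeFn_smul (a k) (bigPhiLp hn hp hħ k)]
        with z hz hz2
      rw [hz2, Pi.smul_apply, hz, smul_eq_mul]
    filter_upwards [h3, Lp.coeFn_finsetSum (degLE n K) (fun k => a k • bigPhiLp hn hp hħ k)]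
      with z hz hz2
    rw [hz2, Finset.sum_apply]
    exact Finset.sum_congr rfl hz
  filter_upwards [hae, h2] with z hz hz2
  simp_rw [hz2] at hz
  have h4 : Tendsto (fun K => ∑ k ∈ degLE n K, a k * bigPhi p ħ k z) atTop
      (𝓝 (kernelTransform n p ħ Ψ z)) :=
    (hasSum_kernelTransform hn hp hħ h z).comp (tendsto_degLE n)
  exact tendsto_nhds_unique hz (h4.comp hns.tendsto_atTop)

end Transform

/-! ### Entire functions are determined by their moments -/

lemma exists_coeff_entire {n : ℕ} (hn : 0 < n) {f : CSpace n → ℂ} (hf : Differentiable ℂ f) :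
    ∃ c : (Fin n → ℕ) → ℂ,
      (∀ (r : ℝ) (k : Fin n → ℕ), 0 < r →
        ∫ x : CSphere n, f (r • (x : CSpace n)) * conj (monom k x) ∂(sphereMeasure n) =
          c k * ((mfact k / poch n (len k) : ℝ) : ℂ) * (r : ℂ) ^ len k) ∧
      ((∀ k, c k = 0) → f = 0) := by
  -- the coefficients obtained from different balls agree, as they are read off at radius `1 / 2`
  choose c hc hc0 using fun R : ℝ => fun hR : 0 < R =>
    exists_coeff hn hR (hf.differentiableOn (s := Metric.ball 0 R))
  have heq : ∀ R (hR : 1 ≤ R) k, c R (one_pos.trans_le hR) k = c 1 one_pos k := by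
    intro R hR k
    have h1 := hc R (one_pos.trans_le hR) (1 / 2) k (by norm_num) (by linarith)
    rw [hc 1 one_pos (1 / 2) k (by norm_num) (by norm_num)] at h1
    have h2 : ((mfact k / poch n (len k) : ℝ) : ℂ) ≠ 0 := by
      have h3 : (0 : ℝ) < mfact k := by exact_mod_cast mfact_pos k
      exact_mod_cast (div_pos h3 (poch_pos (by exact_mod_cast hn) _)).ne'
    have h3 : ((1 / 2 : ℝ) : ℂ) ^ len k ≠ 0 := pow_ne_zero _ (by norm_num)
    exact (mul_right_cancel₀ h2 (mul_right_cancel₀ h3 h1)).symm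
  refine ⟨c 1 one_pos, fun r k hr => ?_, fun h0 => funext fun z => ?_⟩
  · rw [hc (r + 1) (by linarith) r k hr (by linarith), heq (r + 1) (by linarith)]
  · have hR : 1 ≤ ‖z‖ + 1 := by linarith [norm_nonneg z]
    exact hc0 (‖z‖ + 1) (by linarith) (fun k => by rw [heq _ hR, h0]) z (by linarith)

/-- An entire function that is square integrable for the measure `m` vanishes if it is orthogonal
to all monomials: the measure is rotation invariant, so on every sphere only the `k`-th Taylor
coefficient contributes to the `k`-th moment. -/
lemma eq_zero_of_integral_mul_conj_monom {n : ℕ} (hn : 0 < n) {p ħ : ℝ} (hp : -(n : ℝ) < p)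
    (hħ : 0 < ħ) {f : CSpace n → ℂ} (hf : f ∈ entireE n p ħ)
    (h0 : ∀ k, ∫ z, f z * conj (monom k z) ∂(measureM n p ħ) = 0) : f = 0 := by
  obtain ⟨c, hc, hc0⟩ := exists_coeff_entire hn hf.1
  refine hc0 fun k => ?_
  set τ := (volume : Measure (CSpace n)).toSphere with hτ
  have hτC : (τ Set.univ).toReal ≠ 0 := by
    rw [hτ, toSphere_univ_toReal hn]
    have := Real.Gamma_pos_of_pos (s := n) (by exact_mod_cast hn)
    have := Real.pi_pos
    positivity
  have hpolar : ∀ g : CSpace n → ℂ, MemLp g 2 (measureM n p ħ) →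
      ∫ z, g z * conj (monom k z) ∂(measureM n p ħ) =
        ∫ r : Set.Ioi (0 : ℝ), ((τ Set.univ).toReal : ℂ) *
          ((r : ℂ) ^ len k * ((1 / Real.Gamma (n + p) * (2 / (Real.pi * ħ ^ 2) ^ n) *
            (r / ħ) ^ p * besselK p (2 * (r / ħ)) : ℝ) : ℂ)) *
          (∫ x : CSphere n, g ((r : ℝ) • (x : CSpace n)) * conj (monom k x) ∂(sphereMeasure n))
            ∂(Measure.volumeIoiPow (2 * n - 1)) := by
    intro g hg
    have hi : Integrable (fun z => g z * conj (monom k z)) (measureM n p ħ) :=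
      hg.integrable_mul (memLp_monom_measureM hn hp hħ k).star
    rw [integrable_measureM hn hp hħ, ← (measurePreserving_polar hn).integrable_comp_emb
      measurableEmbedding_polar] at hi
    rw [integral_measureM hn hp hħ, integral_cspace_polar hn]
    refine (integral_prod_symm _ hi).trans (integral_congr_ae (Eventually.of_forall fun r => ?_))
    have hr : (0 : ℝ) < r := r.2
    simp only [Function.comp_apply]
    rw [integral_sphereMeasure, ← integral_const_mul, ← integral_const_mul]
    refine integral_congr_ae (Eventually.of_forall fun x => ?_)
    simp only
    rw [densityM, norm_smul_sphere hr.le, monom_real_smul, map_mul, map_pow, Complex.conj_ofReal,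
      ← hτ]
    have : ((τ Set.univ).toReal : ℂ) ≠ 0 := by exact_mod_cast hτC
    field_simp
  have hm : ∀ r : ℝ,
      ∫ x : CSphere n, monom k (r • (x : CSpace n)) * conj (monom k x) ∂(sphereMeasure n) =
        ((mfact k / poch n (len k) : ℝ) : ℂ) * (r : ℂ) ^ len k := by
    intro r
    simp_rw [monom_real_smul, mul_assoc]
    rw [integral_const_mul, integral_sphere_monom hn, if_pos rfl, mul_comm]
  have h1 : ∫ z, f z * conj (monom k z) ∂(measureM n p ħ) =
      c k * ∫ z, monom k z * conj (monom k z) ∂(measureM n p ħ) := by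
    rw [hpolar f hf.2, hpolar _ (memLp_monom_measureM hn hp hħ k), ← integral_const_mul]
    refine integral_congr_ae (Eventually.of_forall fun r => ?_)
    simp only
    rw [hc r k r.2, hm]
    ring
  rw [h0, integral_monom_measureM hn hp hħ, if_pos rfl] at h1
  refine (mul_eq_zero.1 h1.symm).resolve_right ?_
  have h2 := poch_pos (b := n + p) (by linarith) (len k)
  have h3 : (0 : ℝ) < mfact k := by exact_mod_cast mfact_pos k
  exact_mod_cast (by positivity : ħ ^ (2 * len k) * mfact k * poch (n + p) (len k) ≠ 0)

/-! ### The transform as an isometry -/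

/-- The `φ_k` are complete in `𝒪`. -/
lemma hasSum_of_mem_hardyO {n : ℕ} (hn : 0 < n) {Ψ : Lp ℂ 2 (sphereMeasure n)}
    (hΨ : Ψ ∈ hardyO n) : HasSum (fun k => inner ℂ (phiLp k) Ψ • phiLp k) Ψ := by
  have hv := orthonormal_phiLp hn
  have hs := Orthonormal.summable_smul hv (hv.inner_products_summable (x := Ψ))
  have h := hs.hasSum
  have h1 : Ψ - ∑' k, inner ℂ (phiLp k) Ψ • phiLp k = 0 := by
    refine eq_zero_of_mem_hardyO hn (sub_mem hΨ (mem_hardyO_of_hasSum hn h)) fun k => ?_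
    rw [inner_sub_right, Orthonormal.inner_eq_of_hasSum hv h, sub_self]
  rwa [← sub_eq_zero.1 h1] at h

section Isometry

variable {n : ℕ} (hn : 0 < n) {p ħ : ℝ} (hp : -(n : ℝ) < p) (hħ : 0 < ħ)

/-- The `Φ_k`-series with square summable coefficients converges in `L²` of the measure `m`, to
the transform of the `φ_k`-series. -/
lemma exists_hasSum_bigPhiLp {a : (Fin n → ℕ) → ℂ} {Ψ : Lp ℂ 2 (sphereMeasure n)}
    (h : HasSum (fun k => a k • phiLp k) Ψ) :
    ∃ Φ : Lp ℂ 2 (measureM n p ħ), HasSum (fun k => a k • bigPhiLp hn hp hħ k) Φ ∧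
      Φ =ᵐ[measureM n p ħ] kernelTransform n p ħ Ψ := by
  have hv := orthonormal_phiLp hn
  have hs : Summable fun k => ‖a k‖ ^ 2 := by
    have := hv.inner_products_summable (x := Ψ)
    simpa only [Orthonormal.inner_eq_of_hasSum hv h] using this
  have h1 := (Orthonormal.summable_smul (orthonormal_bigPhiLp hn hp hħ) hs).hasSum
  exact ⟨_, h1, coeFn_ae_eq_kernelTransform hn hp hħ h h1⟩

include hn hp hħ in
lemma kernelTransform_mem_entireE {Ψ : Lp ℂ 2 (sphereMeasure n)} (hΨ : Ψ ∈ hardyO n) :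
    kernelTransform n p ħ Ψ ∈ entireE n p ħ := by
  obtain ⟨Φ, -, hΦ⟩ := exists_hasSum_bigPhiLp hn hp hħ (hasSum_of_mem_hardyO hn hΨ)
  exact ⟨differentiable_kernelTransform hn hp hħ (integrable_sphere_Lp Ψ),
    (memLp_congr_ae hΦ).1 (Lp.memLp Φ)⟩

include hn hp hħ in
/-- Existence and uniqueness of the limit that defines the transform, and its integral formula. -/
lemma isTransform_iff {Ψ : Lp ℂ 2 (sphereMeasure n)} (hΨ : Ψ ∈ hardyO n) {f : CSpace n → ℂ} :
    IsTransform n p ħ Ψ f ↔ f = kernelTransform n p ħ Ψ := by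
  have hsum := hasSum_of_mem_hardyO hn hΨ
  obtain ⟨Φ, hΦ, hΦe⟩ := exists_hasSum_bigPhiLp hn hp hħ hsum
  have hd := differentiable_kernelTransform hn hp hħ (integrable_sphere_Lp Ψ)
  constructor
  · rintro ⟨hf, a, ha, hfa⟩
    rw [tendsto_eLpNorm_iff coeFn_phiLp (EventuallyEq.refl _ _)] at ha
    rw [tendsto_eLpNorm_iff (coeFn_bigPhiLp hn hp hħ) hf.2.coeFn_toLp] at hfa
    -- the coefficients are those of the expansion along the orthonormal system
    have hcoef : ∀ k, inner ℂ (phiLp k) Ψ = a k := by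
      intro k
      have h1 : Tendsto (fun K => inner ℂ (phiLp k) (∑ j ∈ degLE n K, a j • phiLp j)) atTop
          (𝓝 (inner ℂ (phiLp k) Ψ)) :=
        ((innerSL ℂ (phiLp k)).continuous.tendsto Ψ).comp ha
      refine tendsto_nhds_unique h1 (tendsto_const_nhds.congr' ?_)
      filter_upwards [eventually_ge_atTop (len k)] with K hK
      rw [(orthonormal_phiLp hn).inner_right_sum _ (mem_degLE.2 hK)]
    simp_rw [hcoef] at hΦ
    have h2 : hf.2.toLp f = Φ := tendsto_nhds_unique hfa (hΦ.comp (tendsto_degLE n))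
    have h3 : f =ᵐ[measureM n p ħ] kernelTransform n p ħ Ψ := by
      rw [← h2] at hΦe
      exact hf.2.coeFn_toLp.symm.trans hΦe
    -- the density of `m` is positive, so the equality holds almost everywhere for Lebesgue measure
    exact Continuous.ae_eq_iff_eq (volume : Measure (CSpace n)) hf.1.continuous hd.continuous |>.1
      ((volume_absolutelyContinuous_measureM hn hp hħ).ae_eq h3)
  · rintro rfl
    refine ⟨kernelTransform_mem_entireE hn hp hħ hΨ, fun k => inner ℂ (phiLp k) Ψ, ?_, ?_⟩
    · rw [tendsto_eLpNorm_iff coeFn_phiLp (EventuallyEq.refl _ _)]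
      exact hsum.comp (tendsto_degLE n)
    · rw [tendsto_eLpNorm_iff (coeFn_bigPhiLp hn hp hħ) hΦe]
      exact hΦ.comp (tendsto_degLE n)

include hn hp hħ in
lemma transformU_eq (Ψ : hardyO n) :
    transformU n p ħ Ψ = kernelTransform n p ħ (Ψ : Lp ℂ 2 (sphereMeasure n)) := by
  have h : ∃ f, IsTransform n p ħ (Ψ : Lp ℂ 2 (sphereMeasure n)) f :=
    ⟨_, (isTransform_iff hn hp hħ Ψ.2).2 rfl⟩
  rw [transformU, dif_pos h]
  exact (isTransform_iff hn hp hħ Ψ.2).1 h.choose_spec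

include hn hp hħ in
/-- The transform preserves inner products, by Parseval's identity on both sides. -/
lemma innerP_kernelTransform {Ψ Φ : Lp ℂ 2 (sphereMeasure n)} (hΨ : Ψ ∈ hardyO n)
    (hΦ : Φ ∈ hardyO n) :
    innerP n p ħ (kernelTransform n p ħ Ψ) (kernelTransform n p ħ Φ) = inner ℂ Φ Ψ := by
  have h1 := hasSum_of_mem_hardyO hn hΨ
  have h2 := hasSum_of_mem_hardyO hn hΦ
  obtain ⟨F, hF, hFe⟩ := exists_hasSum_bigPhiLp hn hp hħ h1
  obtain ⟨G, hG, hGe⟩ := exists_hasSum_bigPhiLp hn hp hħ h2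
  have h3 := Orthonormal.hasSum_inner (orthonormal_phiLp hn) h2 h1
  have h4 := Orthonormal.hasSum_inner (orthonormal_bigPhiLp hn hp hħ) hG hF
  rw [h3.unique h4, L2.inner_def, innerP]
  refine integral_congr_ae ?_
  filter_upwards [hFe, hGe] with z hz hz2
  rw [hz, hz2, RCLike.inner_apply]

include hn hp hħ in
lemma normP_kernelTransform {Ψ : Lp ℂ 2 (sphereMeasure n)} (hΨ : Ψ ∈ hardyO n) :
    normP n p ħ (kernelTransform n p ħ Ψ) = ‖Ψ‖ := by
  rw [normP, innerP_kernelTransform hn hp hħ hΨ hΨ, inner_self_eq_norm_sq_to_K]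
  have : (((‖Ψ‖ : ℝ) : ℂ) ^ 2).re = ‖Ψ‖ ^ 2 := by
    rw [← Complex.ofReal_pow, Complex.ofReal_re]
  exact (congrArg Real.sqrt this).trans (Real.sqrt_sq (norm_nonneg _))

include hn hp hħ in
/-- Every element of `ℰ_{n,p}` is a transform: the `φ_k`-series with its coefficients along the
`Φ_k` has a transform with the same moments. -/
lemma exists_kernelTransform_eq {f : CSpace n → ℂ} (hf : f ∈ entireE n p ħ) :
    ∃ Ψ ∈ hardyO n, kernelTransform n p ħ Ψ = f := by
  have hv := orthonormal_bigPhiLp hn hp hħ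
  have h := (Orthonormal.summable_smul (orthonormal_phiLp hn)
    (hv.inner_products_summable (x := hf.2.toLp f))).hasSum
  set Ψ := ∑' k, inner ℂ (bigPhiLp hn hp hħ k) (hf.2.toLp f) • phiLp (n := n) k with hΨdef
  have hΨ := mem_hardyO_of_hasSum hn h
  obtain ⟨F, hF, hFe⟩ := exists_hasSum_bigPhiLp hn hp hħ h
  refine ⟨Ψ, hΨ, ?_⟩
  have hmem := kernelTransform_mem_entireE hn hp hħ hΨ
  refine sub_eq_zero.1 (eq_zero_of_integral_mul_conj_monom hn hp hħ (sub_mem hmem hf) fun k => ?_)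
  have h1 : (F - hf.2.toLp f : Lp ℂ 2 (measureM n p ħ)) =ᵐ[measureM n p ħ]
      kernelTransform n p ħ Ψ - f :=
    (Lp.coeFn_sub _ _).trans (hFe.sub hf.2.coeFn_toLp)
  have h2 := inner_bigPhiLp hn hp hħ k h1
  rw [inner_sub_right, Orthonormal.inner_eq_of_hasSum hv hF, sub_self] at h2
  exact (mul_eq_zero.1 h2.symm).resolve_left
    (by exact_mod_cast (bigPhi_coeff_pos hp hħ k).ne')

/-- The transform as a linear map from `𝒪` to `ℰ_{n,p}`. -/
noncomputable def transformLinear : hardyO n →ₗ[ℂ] entireE n p ħ where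
  toFun Ψ := ⟨kernelTransform n p ħ (Ψ : Lp ℂ 2 (sphereMeasure n)),
    kernelTransform_mem_entireE hn hp hħ Ψ.2⟩
  map_add' Ψ Φ := by
    refine Subtype.ext (funext fun z => ?_)
    simp only [kernelTransform, Submodule.coe_add, Pi.add_apply]
    rw [← integral_add (integrable_mul_kernel hn hp hħ (integrable_sphere_Lp _) z)
      (integrable_mul_kernel hn hp hħ (integrable_sphere_Lp _) z)]
    refine integral_congr_ae ?_
    filter_upwards [Lp.coeFn_add (Ψ : Lp ℂ 2 (sphereMeasure n)) (Φ : Lp ℂ 2 (sphereMeasure n))]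
      with x hx
    rw [hx, Pi.add_apply, add_mul]
  map_smul' c Ψ := by
    refine Subtype.ext (funext fun z => ?_)
    simp only [kernelTransform, Submodule.coe_smul, Pi.smul_apply, RingHom.id_apply]
    rw [← integral_smul]
    refine integral_congr_ae ?_
    filter_upwards [Lp.coeFn_smul c (Ψ : Lp ℂ 2 (sphereMeasure n))] with x hx
    rw [hx, Pi.smul_apply, smul_eq_mul, smul_eq_mul, mul_assoc]

lemma transformLinear_apply (Ψ : hardyO n) :
    (transformLinear hn hp hħ Ψ : CSpace n → ℂ) =
      kernelTransform n p ħ (Ψ : Lp ℂ 2 (sphereMeasure n)) :=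
  rfl

lemma bijective_transformLinear : Function.Bijective (transformLinear hn hp hħ) := by
  constructor
  · refine (injective_iff_map_eq_zero _).2 fun Ψ hΨ => ?_
    have h1 := normP_kernelTransform hn hp hħ Ψ.2
    rw [← transformLinear_apply hn hp hħ, hΨ] at h1
    have h2 : normP n p ħ ((0 : entireE n p ħ) : CSpace n → ℂ) = 0 := by
      simp [normP, innerP]
    rw [h2] at h1
    exact Subtype.ext (norm_eq_zero.1 h1.symm)
  · rintro ⟨f, hf⟩
    obtain ⟨Ψ, hΨ, h⟩ := exists_kernelTransform_eq hn hp hħ hf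
    exact ⟨⟨Ψ, hΨ⟩, Subtype.ext h⟩

end Isometry

lemma hasSum_single_phiLp {n : ℕ} (k : Fin n → ℕ) :
    HasSum (fun j => (Pi.single k 1 : (Fin n → ℕ) → ℂ) j • phiLp j) (phiLp k) := by
  have h := hasSum_single (f := fun j => (Pi.single k 1 : (Fin n → ℕ) → ℂ) j • phiLp j) k
    fun j hj => by rw [Pi.single_eq_of_ne hj, zero_smul]
  simpa using h

end SphereTransform

theorem mainTheorem1 (n : ℕ) (hn : 2 ≤ n) (p : ℝ) (hp : -(n : ℝ) < p) (ħ : ℝ) (hħ : 0 < ħ) :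
    -- `U` is well defined as a limit, and it sends `φ_k ∈ 𝒪` to `Φ_k`
    (∀ (Ψ : SphereTransform.hardyO n) (f : SphereTransform.CSpace n → ℂ),
      SphereTransform.IsTransform n p ħ (Ψ : Lp ℂ 2 (SphereTransform.sphereMeasure n)) f ↔
        f = SphereTransform.transformU n p ħ Ψ) ∧
    (∀ k : Fin n → ℕ, ∃ Ψ : SphereTransform.hardyO n,
      ((Ψ : Lp ℂ 2 (SphereTransform.sphereMeasure n)) : SphereTransform.CSphere n → ℂ)
        =ᵐ[SphereTransform.sphereMeasure n] SphereTransform.phi k ∧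
      SphereTransform.transformU n p ħ Ψ = SphereTransform.bigPhi p ħ k) ∧
    -- `U` is a linear isometry of `𝒪` onto `ℰ_{n,p}`
    (∃ T : SphereTransform.hardyO n ≃ₗ[ℂ] SphereTransform.entireE n p ħ,
      (∀ Ψ, (T Ψ : SphereTransform.CSpace n → ℂ) = SphereTransform.transformU n p ħ Ψ) ∧
      (∀ Ψ, SphereTransform.normP n p ħ (T Ψ) = ‖Ψ‖) ∧
      (∀ Ψ Φ, SphereTransform.innerP n p ħ (T Ψ) (T Φ) =
        ∫ x, (Ψ : Lp ℂ 2 (SphereTransform.sphereMeasure n)) x *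
          conj ((Φ : Lp ℂ 2 (SphereTransform.sphereMeasure n)) x)
          ∂(SphereTransform.sphereMeasure n))) ∧
    -- the integral formula
    (∀ (z : SphereTransform.CSpace n) (x : SphereTransform.CSphere n),
      Summable (SphereTransform.kernelTerm p ħ z (x : SphereTransform.CSpace n))) ∧
    (∀ (Ψ : SphereTransform.hardyO n) (z : SphereTransform.CSpace n),
      Integrable (fun x : SphereTransform.CSphere n =>
        (Ψ : Lp ℂ 2 (SphereTransform.sphereMeasure n)) x *
          ∑' l : ℕ, SphereTransform.kernelTerm p ħ z (x : SphereTransform.CSpace n) l)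
        (SphereTransform.sphereMeasure n) ∧
      SphereTransform.transformU n p ħ Ψ z =
        ∫ x, (Ψ : Lp ℂ 2 (SphereTransform.sphereMeasure n)) x *
          ∑' l : ℕ, SphereTransform.kernelTerm p ħ z (x : SphereTransform.CSpace n) l
          ∂(SphereTransform.sphereMeasure n)) := by
  have hn0 : 0 < n := by omega
  refine ⟨fun Ψ f => ?_, fun k => ?_, ?_, fun z x => ?_, fun Ψ z => ⟨?_, ?_⟩⟩
  · rw [SphereTransform.transformU_eq hn0 hp hħ, SphereTransform.isTransform_iff hn0 hp hħ Ψ.2]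
  · have hs := SphereTransform.hasSum_single_phiLp k
    refine ⟨⟨SphereTransform.phiLp k, SphereTransform.mem_hardyO_of_hasSum hn0 hs⟩,
      SphereTransform.coeFn_phiLp k, ?_⟩
    rw [SphereTransform.transformU_eq hn0 hp hħ]
    funext z
    refine (SphereTransform.hasSum_kernelTransform hn0 hp hħ hs z).unique ?_
    have h := hasSum_single (f := fun j => (Pi.single k 1 : (Fin n → ℕ) → ℂ) j *
      SphereTransform.bigPhi p ħ j z) k fun j hj => by rw [Pi.single_eq_of_ne hj, zero_mul]
    simpa using h
  · refine ⟨LinearEquiv.ofBijective _ (SphereTransform.bijective_transformLinear hn0 hp hħ),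
      fun Ψ => ?_, fun Ψ => ?_, fun Ψ Φ => ?_⟩
    · rw [SphereTransform.transformU_eq hn0 hp hħ]
      rfl
    · exact SphereTransform.normP_kernelTransform hn0 hp hħ Ψ.2
    · refine (SphereTransform.innerP_kernelTransform hn0 hp hħ Ψ.2 Φ.2).trans ?_
      rw [L2.inner_def]
      rfl
  · have h := SphereTransform.summable_kernel
      (SphereTransform.summable_kernelCoeff hn0 hp hħ (norm_nonneg z)) x
    exact h.congr fun l => (SphereTransform.kernelTerm_eq z x l).symm
  · exact SphereTransform.integrable_mul_kernel hn0 hp hħ (SphereTransform.integrable_sphere_Lp _) z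
  · rw [SphereTransform.transformU_eq hn0 hp hħ]
    rfl
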